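/- **Setting.** Let $n>2$ and let $\mathbb K$ be a field with nonzero elements $r^{1/2},s^{1/2}$; put $r=(r^{1/2})^2$, $s=(s^{1/2})^2$ and assume $r\neq s$ (for example $\mathbb K=\mathbb Q(r^{1/2},s^{1/2})$). Put $I_0=\{0,1,\dots,n-1\}$, $I=I_0\setminus\{0\}$, with indices in $I_0$ added modulo $n$ when they label generators. Let $\varepsilon_1,\dots,\varepsilon_n$ be orthonormal, $\delta$ orthogonal to all of them, $\alpha_i=\varepsilon_i-\varepsilon_{i+1}$ for $i\in I$, $\alpha_0=\delta-(\varepsilon_1-\varepsilon_n)$, and let $(a_{ij})_{i,j\in I_0}$ be the generalized Cartan matrix of type $A^{(1)}_{n-1}$. For $i,j\in I_0$ put $$c_{ij}(a,b)=a^{(\varepsilon_j,\alpha_i)}b^{(\varepsilon_{j+1},\alpha_i)}\ (j\in I),\qquad c_{i0}(a,b)=a^{-(\varepsilon_{i+1},\alpha_0)}b^{(\varepsilon_1,\alpha_i)} .$$ **The algebra.** $U=U_{r,s}(\widehat{\mathfrak{sl}_n})$ is the unital associative $\mathbb K$-algebra generated by $e_j,f_j,\omega_j^{\pm1},\omega_j'^{\pm1}$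 $(j\in I_0)$, $\gamma^{\pm1/2},\gamma'^{\pm1/2},D^{\pm1},D'^{\pm1}$ with the following relations. - $\omega_j^{\pm1},\omega_j'^{\pm1},\gamma^{\pm1/2},\gamma'^{\pm1/2},D^{\pm1},D'^{\pm1}$ commute with each other, and $x\,x^{-1}=x^{-1}x=1$ for each of these invertible generators $x$. Moreover $\gamma^{1/2},\gamma'^{1/2}$ are central, $\gamma:=(\gamma^{1/2})^2=\omega_0\omega_1\cdots\omega_{n-1}$ and $\gamma':=(\gamma'^{1/2})^2=\omega'_0\omega'_1\cdots\omega'_{n-1}$. - For $i,j\in I_0$: $\omega_je_i\omega_j^{-1}=c_{ij}(r,s)e_i$, $\omega_jf_i\omega_j^{-1}=c_{ij}(r,s)^{-1}f_i$, $\omega'_je_i\omega_j'^{-1}=c_{ij}(s,r)e_i$, $\omega'_jf_i\omega_j'^{-1}=c_{ij}(s,r)^{-1}f_i$, $De_iD^{-1}=r^{\delta_{0i}}e_i$, $Df_iD^{-1}=r^{-\delta_{0i}}f_i$, $D'e_iD'^{-1}=s^{\delta_{0i}}e_i$, $D'f_iD'^{-1}=s^{-\delta_{0i}}f_i$. - $[e_i,f_j]=\frac{\delta_{ij}}{r-s}(\omega_i-\omega'_i)$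 for $i,j\in I_0$, and $[e_i,e_j]=0=[f_i,f_j]$ whenever $a_{ij}=0$. - For $i\in I_0$ (indices modulo $n$): $$e_i^2e_{i+1}-(r+s)e_ie_{i+1}e_i+rs\,e_{i+1}e_i^2=0,\qquad e_ie_{i+1}^2-(r+s)e_{i+1}e_ie_{i+1}+rs\,e_{i+1}^2e_i=0,$$ and the same two relations with $e$ replaced by $f$, $r$ by $r^{-1}$ and $s$ by $s^{-1}$. $U$ is a Hopf algebra in which $\omega_i,\omega'_i,\gamma^{\pm1/2},\gamma'^{\pm1/2},D^{\pm1},D'^{\pm1}$ are group-like (with counit $1$ and the inverse as antipode), $\Delta(e_i)=e_i\otimes1+\omega_i\otimes e_i$, $\Delta(f_i)=f_i\otimes\omega'_i+1\otimes f_i$, $\varepsilon(e_i)=\varepsilon(f_i)=0$, $S(e_i)=-\omega_i^{-1}e_i$, $S(f_i)=-f_i\omega_i'^{-1}$. Let $\widehat{\mathcal B}$ and $\widehat{\mathcal B'}$ be the Hopf subalgebras generated by $e_j,\omega_j^{\pm1},\gamma^{\pm1/2},D^{\pm1}$ and by $f_j,\omega_j'^{\pm1},\gamma'^{\pm1/2},D'^{\pm1}$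 $(j\in I_0)$, respectively. **Pairings and doubles.** A *skew-dual pairing* of Hopf algebras $\mathfrak A,\mathfrak B$ is a bilinear form $\langle\,,\rangle:\mathfrak B\times\mathfrak A\to\mathbb K$ with $\langle b,1\rangle=\varepsilon(b)$, $\langle1,a\rangle=\varepsilon(a)$, $\langle b,a_1a_2\rangle=\langle\Delta^{\rm op}(b),a_1\otimes a_2\rangle$ and $\langle b_1b_2,a\rangle=\langle b_1\otimes b_2,\Delta(a)\rangle$. The *Drinfel'd quantum double* $\mathcal D(\mathfrak A,\mathfrak B)$ with respect to it is the Hopf algebra with underlying coalgebra $\mathfrak A\otimes\mathfrak B$ (tensor product coalgebra), unit $1\otimes1$, product $$(a\otimes b)(a'\otimes b')=\sum\langle S(b_{(1)}),a'_{(1)}\rangle\langle b_{(3)},a'_{(3)}\rangle\,aa'_{(2)}\otimes b_{(2)}b'$$ and antipode $S(a\otimes b)=(1\otimes S(b))(S(a)\otimes1)$. **Theorem 2.5.** There is exactly one skew-dual pairing $\langle\,,\rangle:\widehat{\mathcal B'}\times\widehat{\mathcal B}\to\mathbb K$ such that, for all $i,j\in I_0$, $$\langle f_i,e_j\rangle=\frac{\delta_{ij}}{s-r},\quad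 \langle\omega'_i,\omega_j\rangle=c_{ij}(r,s),\quad \langle\omega'_i,\gamma^{1/2}\rangle=\langle\gamma'^{1/2},\omega_j\rangle=\langle\gamma'^{1/2},\gamma^{1/2}\rangle=\langle D',D\rangle=1,$$ $$\langle\omega'_i,D\rangle=r^{\delta_{0i}},\quad \langle D',\omega_j\rangle=s^{-\delta_{0j}},\quad \langle\gamma'^{1/2},D\rangle=r^{1/2},\quad \langle D',\gamma^{1/2}\rangle=s^{-1/2},$$ $\langle x^{\eta},y^{\theta}\rangle=\langle x,y\rangle^{\eta\theta}$ for $\eta,\theta\in\{1,-1\}$ and $x\in\{\omega'_i,\gamma'^{1/2},D'\}$, $y\in\{\omega_j,\gamma^{1/2},D\}$, and $\langle f_i,y^{\pm1}\rangle=0=\langle x^{\pm1},e_j\rangle$ for all such $x,y$. For the Drinfel'd quantum double $\mathcal D(\widehat{\mathcal B},\widehat{\mathcal B'})$ with respect to this pairing there is an isomorphism of Hopf algebras $$\varphi:\mathcal D(\widehat{\mathcal B},\widehat{\mathcal B'})\longrightarrow U_{r,s}(\widehat{\mathfrak{sl}_n})$$ that sends each generator to the corresponding generator: $\varphi(e_i\otimes1)=e_i$,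 $\varphi(1\otimes f_i)=f_i$, $\varphi(y^{\pm1}\otimes1)=y^{\pm1}$ for $y\in\{\omega_i,\gamma^{1/2},D\}$ and $\varphi(1\otimes x^{\pm1})=x^{\pm1}$ for $x\in\{\omega'_i,\gamma'^{1/2},D'\}$, $i\in I_0$. -/

import Mathlib

open scoped TensorProduct

/-- The parameters: an integer `n > 2` and two parameters `r ≠ s` of the ground field `K`, given
together with square roots `rh = r^{1/2}`, `sh = s^{1/2}` in `K`, all of them nonzero. -/
structure QParams (K : Type*) [Field K] where
  n : ℕ
  two_lt_n : 2 < n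
  rh : K
  sh : K
  rh_ne_zero : rh ≠ 0
  sh_ne_zero : sh ≠ 0
  sq_ne_sq : rh ^ 2 ≠ sh ^ 2

namespace QParams

variable {K : Type*} [Field K] (P : QParams K)

/-- The parameter `r`. -/
def r : K := P.rh ^ 2
/-- The parameter `s`. -/
def s : K := P.sh ^ 2

instance : NeZero P.n := ⟨by have := P.two_lt_n; omega⟩

theorem r_ne_zero : P.r ≠ 0 := pow_ne_zero _ P.rh_ne_zero
theorem s_ne_zero : P.s ≠ 0 := pow_ne_zero _ P.sh_ne_zero

/-- The index set `I_0 = {0, 1, ..., n - 1}` of the simple roots; addition is modulo `n`. -/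
abbrev Idx : Type := Fin P.n

/-- The number `(ε_k, α_i)`, where `α_i = ε_i - ε_{i+1}` for `1 ≤ i ≤ n - 1`,
`α_0 = δ - (ε_1 - ε_n)`, the `ε_k` are orthonormal and `δ` is orthogonal to all of them. -/
def epsAlpha (k : ℕ) (i : P.Idx) : ℤ :=
  if i = 0 then (if k = P.n then 1 else 0) - (if k = 1 then 1 else 0)
  else (if k = i.val then 1 else 0) - (if k = i.val + 1 then 1 else 0)

/-- The generalized Cartan matrix `a_{ij}` of type `A_{n-1}^{(1)}`, `n > 2`. -/
def cartan (i j : P.Idx) : ℤ :=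
  if i = j then 2 else if j = i + 1 ∨ i = j + 1 then -1 else 0

/-- For `1 ≤ j ≤ n - 1` the scalar `a^{(ε_j, α_i)} b^{(ε_{j+1}, α_i)}`, and for `j = 0` the scalar
`a^{-(ε_{i+1}, α_0)} b^{(ε_1, α_i)}`. -/
def chi (a b : K) (i j : P.Idx) : K :=
  if j = 0 then a ^ (-P.epsAlpha (i.val + 1) 0) * b ^ P.epsAlpha 1 i
  else a ^ P.epsAlpha j.val i * b ^ P.epsAlpha (j.val + 1) i

theorem val_succ (i : P.Idx) : (i + 1).val = if i.val + 1 = P.n then 0 else i.val + 1 := by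
  have h := P.two_lt_n
  rw [Fin.val_add, Fin.val_one', Nat.mod_eq_of_lt (a := 1) (by omega)]
  split_ifs with h1
  · rw [h1, Nat.mod_self]
  · exact Nat.mod_eq_of_lt (by omega)

theorem chi_exp (a b : K) (i j : P.Idx) :
    P.chi a b i j = a ^ ((if i = j then 1 else 0) - (if j = i + 1 then 1 else 0) : ℤ) *
      b ^ ((if i = j + 1 then 1 else 0) - (if i = j then 1 else 0) : ℤ) := by
  have h := P.two_lt_n
  have hi := i.isLt
  have hj := j.isLt
  have h1 := P.val_succ i
  have h2 := P.val_succ j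
  have h0 : (0 : P.Idx).val = 0 := rfl
  have key : (if j = 0 then -P.epsAlpha (i.val + 1) 0 else P.epsAlpha j.val i) =
        ((if i = j then 1 else 0) - (if j = i + 1 then 1 else 0) : ℤ) ∧
      (if j = 0 then P.epsAlpha 1 i else P.epsAlpha (j.val + 1) i) =
        ((if i = j + 1 then 1 else 0) - (if i = j then 1 else 0) : ℤ) := by
    unfold epsAlpha
    simp only [Fin.ext_iff, h1, h2, h0]
    constructor <;> grind
  rw [← key.1, ← key.2, chi]
  split_ifs <;> rfl

end QParams

/-- a² b − (u+v) a b a + uv b a². -/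
def qSerre {K A : Type*} [Field K] [Ring A] [Algebra K A] (u v : K) (a b : A) : A :=
  a ^ 2 * b - (u + v) • (a * b * a) + (u * v) • (b * a ^ 2)

/-- a b² − (u+v) b a b + uv b² a. -/
def qSerre' {K A : Type*} [Field K] [Ring A] [Algebra K A] (u v : K) (a b : A) : A :=
  a * b ^ 2 - (u + v) • (b * a * b) + (u * v) • (b ^ 2 * a)

section SerreLemmas

variable {K A : Type*} [Field K] [Ring A] [Algebra K A]

theorem qSerre_add {u v : K} (hu : u ≠ 0) (hv : v ≠ 0) {X Y X' Y' : A}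
    (h1 : Y * X = (u / v) • (X * Y)) (h2 : Y * X' = v • (X' * Y)) (h3 : Y' * X = u⁻¹ • (X * Y')) :
    qSerre u v (X + Y) (X' + Y') = qSerre u v X X' + qSerre u v Y Y' := by
  have h1' (Z : A) : Y * (X * Z) = (u / v) • (X * (Y * Z)) := by
    rw [← mul_assoc, h1, smul_mul_assoc, mul_assoc]
  have h2' (Z : A) : Y * (X' * Z) = v • (X' * (Y * Z)) := by
    rw [← mul_assoc, h2, smul_mul_assoc, mul_assoc]
  have h3' (Z : A) : Y' * (X * Z) = u⁻¹ • (X * (Y' * Z)) := by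
    rw [← mul_assoc, h3, smul_mul_assoc, mul_assoc]
  unfold qSerre
  simp only [pow_two, mul_add, add_mul, mul_assoc, h1, h2, h3, h1', h2', h3',
    mul_smul_comm, smul_mul_assoc, smul_smul, smul_add]
  match_scalars <;> field_simp <;> ring

theorem qSerre'_add {u v : K} (hu : u ≠ 0) (hv : v ≠ 0) {X Y X' Y' : A}
    (h1 : Y' * X' = (u / v) • (X' * Y')) (h2 : Y * X' = v • (X' * Y))
    (h3 : Y' * X = u⁻¹ • (X * Y')) :
    qSerre' u v (X + Y) (X' + Y') = qSerre' u v X X' + qSerre' u v Y Y' := by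
  have h1' (Z : A) : Y' * (X' * Z) = (u / v) • (X' * (Y' * Z)) := by
    rw [← mul_assoc, h1, smul_mul_assoc, mul_assoc]
  have h2' (Z : A) : Y * (X' * Z) = v • (X' * (Y * Z)) := by
    rw [← mul_assoc, h2, smul_mul_assoc, mul_assoc]
  have h3' (Z : A) : Y' * (X * Z) = u⁻¹ • (X * (Y' * Z)) := by
    rw [← mul_assoc, h3, smul_mul_assoc, mul_assoc]
  unfold qSerre'
  simp only [pow_two, mul_add, add_mul, mul_assoc, h1, h2, h3, h1', h2', h3',
    mul_smul_comm, smul_mul_assoc, smul_smul, smul_add]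
  match_scalars <;> field_simp <;> ring

theorem qSerre_symm (u v : K) (a b : A) : qSerre u v a b = qSerre v u a b := by
  unfold qSerre; rw [add_comm u v, mul_comm u v]

theorem qSerre'_symm (u v : K) (a b : A) : qSerre' u v a b = qSerre' v u a b := by
  unfold qSerre'; rw [add_comm u v, mul_comm u v]

variable {B : Type*} [Ring B] [Algebra K B]

theorem qSerre_left_tmul {w w' : A} (h : w * w' = w' * w) (u v : K) (a b : B) :
    qSerre u v (w ⊗ₜ[K] a) (w' ⊗ₜ[K] b) = (w ^ 2 * w') ⊗ₜ[K] qSerre u v a b := by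
  have h1 : w * w' * w = w ^ 2 * w' := by rw [pow_two, mul_assoc, ← h, mul_assoc]
  have h2 : w' * w ^ 2 = w ^ 2 * w' := by
    rw [pow_two, ← mul_assoc, ← h, mul_assoc, ← h, mul_assoc]
  simp only [qSerre, Algebra.TensorProduct.tmul_mul_tmul, Algebra.TensorProduct.tmul_pow, h1, h2,
    TensorProduct.tmul_add, TensorProduct.tmul_sub, TensorProduct.tmul_smul]

theorem qSerre'_left_tmul {w w' : A} (h : w * w' = w' * w) (u v : K) (a b : B) :
    qSerre' u v (w ⊗ₜ[K] a) (w' ⊗ₜ[K] b) = (w * w' ^ 2) ⊗ₜ[K] qSerre' u v a b := by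
  have h1 : w' * w * w' = w * w' ^ 2 := by rw [pow_two, ← h, mul_assoc]
  have h2 : w' ^ 2 * w = w * w' ^ 2 := by
    rw [pow_two, mul_assoc, ← h, ← mul_assoc, ← h, mul_assoc]
  simp only [qSerre', Algebra.TensorProduct.tmul_mul_tmul, Algebra.TensorProduct.tmul_pow, h1, h2,
    TensorProduct.tmul_add, TensorProduct.tmul_sub, TensorProduct.tmul_smul]

theorem qSerre_right_tmul {w w' : B} (h : w * w' = w' * w) (u v : K) (a b : A) :
    qSerre u v (a ⊗ₜ[K] w) (b ⊗ₜ[K] w') = qSerre u v a b ⊗ₜ[K] (w ^ 2 * w') := by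
  have h1 : w * w' * w = w ^ 2 * w' := by rw [pow_two, mul_assoc, ← h, mul_assoc]
  have h2 : w' * w ^ 2 = w ^ 2 * w' := by
    rw [pow_two, ← mul_assoc, ← h, mul_assoc, ← h, mul_assoc]
  simp only [qSerre, Algebra.TensorProduct.tmul_mul_tmul, Algebra.TensorProduct.tmul_pow, h1, h2,
    TensorProduct.add_tmul, TensorProduct.sub_tmul, ← TensorProduct.smul_tmul']

theorem qSerre'_right_tmul {w w' : B} (h : w * w' = w' * w) (u v : K) (a b : A) :
    qSerre' u v (a ⊗ₜ[K] w) (b ⊗ₜ[K] w') = qSerre' u v a b ⊗ₜ[K] (w * w' ^ 2) := by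
  have h1 : w' * w * w' = w * w' ^ 2 := by rw [pow_two, ← h, mul_assoc]
  have h2 : w' ^ 2 * w = w * w' ^ 2 := by
    rw [pow_two, mul_assoc, ← h, ← mul_assoc, ← h, mul_assoc]
  simp only [qSerre', Algebra.TensorProduct.tmul_mul_tmul, Algebra.TensorProduct.tmul_pow, h1, h2,
    TensorProduct.add_tmul, TensorProduct.sub_tmul, ← TensorProduct.smul_tmul']

/-- The Serre expression of `x a`, `x' a'` in the opposite order. -/
theorem qSerre_twist {u v : K} (hu : u ≠ 0) (hv : v ≠ 0) {x x' a a' : A} (hx : x * x' = x' * x)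
    (h1 : a * x = (u / v) • (x * a)) (h2 : a' * x = v • (x * a')) (h3 : a * x' = u⁻¹ • (x' * a))
    (h : qSerre u v a a' = 0) :
    (x' * a') * (x * a) ^ 2 - (u + v) • ((x * a) * (x' * a') * (x * a)) +
      (u * v) • ((x * a) ^ 2 * (x' * a')) = 0 := by
  have h0' (Z : A) : x * (x' * Z) = x' * (x * Z) := by rw [← mul_assoc, hx, mul_assoc]
  have h1' (Z : A) : a * (x * Z) = (u / v) • (x * (a * Z)) := by
    rw [← mul_assoc, h1, smul_mul_assoc, mul_assoc]
  have h2' (Z : A) : a' * (x * Z) = v • (x * (a' * Z)) := by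
    rw [← mul_assoc, h2, smul_mul_assoc, mul_assoc]
  have h3' (Z : A) : a * (x' * Z) = u⁻¹ • (x' * (a * Z)) := by
    rw [← mul_assoc, h3, smul_mul_assoc, mul_assoc]
  have h4 : x' * (x * (x * qSerre u v a a')) = 0 := by rw [h]; simp
  rw [← h4]
  unfold qSerre
  simp only [pow_two, mul_assoc, h0', h1', h2', h3', mul_add, mul_sub,
    mul_smul_comm, smul_mul_assoc, smul_smul]
  match_scalars <;> field_simp

theorem qSerre'_twist {u v : K} (hu : u ≠ 0) (hv : v ≠ 0) {x x' a a' : A} (hx : x * x' = x' * x)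
    (h1 : a' * x' = (u / v) • (x' * a')) (h2 : a' * x = v • (x * a'))
    (h3 : a * x' = u⁻¹ • (x' * a)) (h : qSerre' u v a a' = 0) :
    (x' * a') ^ 2 * (x * a) - (u + v) • ((x' * a') * (x * a) * (x' * a')) +
      (u * v) • ((x * a) * (x' * a') ^ 2) = 0 := by
  have h0' (Z : A) : x * (x' * Z) = x' * (x * Z) := by rw [← mul_assoc, hx, mul_assoc]
  have h1' (Z : A) : a' * (x' * Z) = (u / v) • (x' * (a' * Z)) := by
    rw [← mul_assoc, h1, smul_mul_assoc, mul_assoc]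
  have h2' (Z : A) : a' * (x * Z) = v • (x * (a' * Z)) := by
    rw [← mul_assoc, h2, smul_mul_assoc, mul_assoc]
  have h3' (Z : A) : a * (x' * Z) = u⁻¹ • (x' * (a * Z)) := by
    rw [← mul_assoc, h3, smul_mul_assoc, mul_assoc]
  have h4 : x' * (x' * (x * qSerre' u v a a')) = 0 := by rw [h]; simp
  rw [← h4]
  unfold qSerre'
  simp only [pow_two, mul_assoc, h0', h1', h2', h3', mul_add, mul_sub,
    mul_smul_comm, smul_mul_assoc, smul_smul]
  match_scalars <;> field_simp

end SerreLemmas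

namespace QParams

variable {K : Type*} [Field K] (P : QParams K)

/-- The invertible generators. Here `γ` and `γ'` stand for the elements `γ^{1/2}` and `γ'^{1/2}`. -/
inductive Tor : Type
  | ω (i : P.Idx)
  | ω' (i : P.Idx)
  | γ
  | γ'
  | D
  | D'

/-- The Chevalley-Kac-Lusztig generators: `e_i`, `f_i`, the elements of `Tor` and their inverses. -/
inductive Gen : Type
  | e (i : P.Idx)
  | f (i : P.Idx)
  | t (x : P.Tor)
  | tinv (x : P.Tor)

/-- The scalar `c` with `x e_i x⁻¹ = c e_i` and `x f_i x⁻¹ = c⁻¹ f_i`, for `x` an invertible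
generator. -/
def wt : P.Tor → P.Idx → K
  | .ω j, i => P.chi P.r P.s i j
  | .ω' j, i => P.chi P.s P.r i j
  | .γ, _ => 1
  | .γ', _ => 1
  | .D, i => if i = 0 then P.r else 1
  | .D', i => if i = 0 then P.s else 1

/-- The free algebra on the generators. -/
abbrev Free : Type _ := FreeAlgebra K P.Gen

namespace Free
abbrev e (i : P.Idx) : P.Free := FreeAlgebra.ι K (.e i)
abbrev f (i : P.Idx) : P.Free := FreeAlgebra.ι K (.f i)
abbrev t (x : P.Tor) : P.Free := FreeAlgebra.ι K (.t x)
abbrev tinv (x : P.Tor) : P.Free := FreeAlgebra.ι K (.tinv x)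
end Free

open Free in
/-- The defining relations. The invertible generators are inverted by the `tinv` and commute with
each other; the square `γ` of `γ^{1/2}` is `ω_δ = ω_0 ω_1 ⋯ ω_{n-1}`, and `γ' = ω'_δ` likewise;
the invertible generators act on `e_i`, `f_i` by scalars (in particular `γ^{1/2}`, `γ'^{1/2}` are
central); `[e_i, f_j] = δ_{ij} (ω_i - ω'_i) / (r - s)`; generators whose Cartan entry is zero
commute; and the `(r, s)`-Serre relations hold for the pairs `(i, i + 1)`, `i ∈ ℤ / n`. -/
inductive Rel : P.Free → P.Free → Prop
  | t_tinv (x : P.Tor) : Rel (t P x * tinv P x) 1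
  | tinv_t (x : P.Tor) : Rel (tinv P x * t P x) 1
  | t_comm (x y : P.Tor) : Rel (t P x * t P y) (t P y * t P x)
  | γ_sq : Rel (t P .γ ^ 2) (List.ofFn fun i : P.Idx => t P (.ω i)).prod
  | γ'_sq : Rel (t P .γ' ^ 2) (List.ofFn fun i : P.Idx => t P (.ω' i)).prod
  | t_e (x : P.Tor) (i : P.Idx) : Rel (t P x * e P i * tinv P x) (P.wt x i • e P i)
  | t_f (x : P.Tor) (i : P.Idx) : Rel (t P x * f P i * tinv P x) ((P.wt x i)⁻¹ • f P i)
  | e_f (i j : P.Idx) : Rel (e P i * f P j - f P j * e P i)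
      (((if i = j then 1 else 0) / (P.r - P.s)) • (t P (.ω i) - t P (.ω' i)))
  | e_comm (i j : P.Idx) (h : P.cartan i j = 0) : Rel (e P i * e P j) (e P j * e P i)
  | f_comm (i j : P.Idx) (h : P.cartan i j = 0) : Rel (f P i * f P j) (f P j * f P i)
  | e_serre (i : P.Idx) : Rel (qSerre P.r P.s (e P i) (e P (i + 1))) 0
  | e_serre' (i : P.Idx) : Rel (qSerre' P.r P.s (e P i) (e P (i + 1))) 0
  | f_serre (i : P.Idx) : Rel (qSerre P.r⁻¹ P.s⁻¹ (f P i) (f P (i + 1))) 0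
  | f_serre' (i : P.Idx) : Rel (qSerre' P.r⁻¹ P.s⁻¹ (f P i) (f P (i + 1))) 0

/-- The two-parameter quantum affine algebra `U_{r,s}` of affine `sl_n`, as an algebra. -/
def U : Type _ := RingQuot P.Rel

noncomputable instance : Ring P.U := inferInstanceAs (Ring (RingQuot P.Rel))
noncomputable instance : Algebra K P.U := inferInstanceAs (Algebra K (RingQuot P.Rel))

/-- The quotient map. -/
noncomputable def toU : P.Free →ₐ[K] P.U := RingQuot.mkAlgHom K P.Rel

namespace U
noncomputable def e (i : P.Idx) : P.U := P.toU (Free.e P i)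
noncomputable def f (i : P.Idx) : P.U := P.toU (Free.f P i)
noncomputable def t (x : P.Tor) : P.U := P.toU (Free.t P x)
noncomputable def tinv (x : P.Tor) : P.U := P.toU (Free.tinv P x)
end U

theorem toU_rel {x y : P.Free} (h : P.Rel x y) : P.toU x = P.toU y := RingQuot.mkAlgHom_rel K h

theorem map_qSerre {A B : Type*} [Ring A] [Algebra K A] [Ring B] [Algebra K B] (φ : A →ₐ[K] B)
    (u v : K) (a b : A) : φ (qSerre u v a b) = qSerre u v (φ a) (φ b) := by
  simp [qSerre]

theorem map_qSerre' {A B : Type*} [Ring A] [Algebra K A] [Ring B] [Algebra K B] (φ : A →ₐ[K] B)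
    (u v : K) (a b : A) : φ (qSerre' u v a b) = qSerre' u v (φ a) (φ b) := by
  simp [qSerre']

/-- A family of elements of an algebra that satisfies the defining relations. -/
structure IsModel {A : Type*} [Ring A] [Algebra K A] (e f : P.Idx → A) (t tinv : P.Tor → A) :
    Prop where
  t_tinv (x : P.Tor) : t x * tinv x = 1
  tinv_t (x : P.Tor) : tinv x * t x = 1
  t_comm (x y : P.Tor) : t x * t y = t y * t x
  γ_sq : t .γ ^ 2 = (List.ofFn fun i : P.Idx => t (.ω i)).prod
  γ'_sq : t .γ' ^ 2 = (List.ofFn fun i : P.Idx => t (.ω' i)).prod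
  t_e (x : P.Tor) (i : P.Idx) : t x * e i * tinv x = P.wt x i • e i
  t_f (x : P.Tor) (i : P.Idx) : t x * f i * tinv x = (P.wt x i)⁻¹ • f i
  e_f (i j : P.Idx) : e i * f j - f j * e i =
    ((if i = j then 1 else 0) / (P.r - P.s)) • (t (.ω i) - t (.ω' i))
  e_comm (i j : P.Idx) (h : P.cartan i j = 0) : e i * e j = e j * e i
  f_comm (i j : P.Idx) (h : P.cartan i j = 0) : f i * f j = f j * f i
  e_serre (i : P.Idx) : qSerre P.r P.s (e i) (e (i + 1)) = 0
  e_serre' (i : P.Idx) : qSerre' P.r P.s (e i) (e (i + 1)) = 0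
  f_serre (i : P.Idx) : qSerre P.r⁻¹ P.s⁻¹ (f i) (f (i + 1)) = 0
  f_serre' (i : P.Idx) : qSerre' P.r⁻¹ P.s⁻¹ (f i) (f (i + 1)) = 0

theorem U.isModel : P.IsModel (U.e P) (U.f P) (U.t P) (U.tinv P) where
  t_tinv x := by simpa [U.t, U.tinv] using P.toU_rel (.t_tinv x)
  tinv_t x := by simpa [U.t, U.tinv] using P.toU_rel (.tinv_t x)
  t_comm x y := by simpa [U.t, U.tinv] using P.toU_rel (.t_comm x y)
  γ_sq := by simpa [U.t, map_list_prod, List.map_ofFn, Function.comp_def] using P.toU_rel .γ_sq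
  γ'_sq := by simpa [U.t, map_list_prod, List.map_ofFn, Function.comp_def] using P.toU_rel .γ'_sq
  t_e x i := by simpa [U.t, U.tinv, U.e] using P.toU_rel (.t_e x i)
  t_f x i := by simpa [U.t, U.tinv, U.f] using P.toU_rel (.t_f x i)
  e_f i j := by simpa only [U.t, U.f, U.e, map_mul, map_sub, map_smul] using P.toU_rel (.e_f i j)
  e_comm i j h := by simpa [U.e] using P.toU_rel (.e_comm i j h)
  f_comm i j h := by simpa [U.f] using P.toU_rel (.f_comm i j h)
  e_serre i := by simpa [U.e, map_qSerre] using P.toU_rel (.e_serre i)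
  e_serre' i := by simpa [U.e, map_qSerre'] using P.toU_rel (.e_serre' i)
  f_serre i := by simpa [U.f, map_qSerre] using P.toU_rel (.f_serre i)
  f_serre' i := by simpa [U.f, map_qSerre'] using P.toU_rel (.f_serre' i)

section lift
variable {P} {A : Type*} [Ring A] [Algebra K A] {e f : P.Idx → A} {t tinv : P.Tor → A}

/-- The values of a family on the generators. -/
def genVal (e f : P.Idx → A) (t tinv : P.Tor → A) : P.Gen → A
  | .e i => e i
  | .f i => f i
  | .t x => t x
  | .tinv x => tinv x

/-- The universal property. -/
noncomputable def U.lift (h : P.IsModel e f t tinv) : P.U →ₐ[K] A :=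
  RingQuot.liftAlgHom K ⟨FreeAlgebra.lift K (genVal e f t tinv), by
    intro x y hxy
    cases hxy with
    | t_tinv x => simpa [genVal] using h.t_tinv x
    | tinv_t x => simpa [genVal] using h.tinv_t x
    | t_comm x y => simpa [genVal] using h.t_comm x y
    | γ_sq => simpa [genVal, map_list_prod, List.map_ofFn, Function.comp_def] using h.γ_sq
    | γ'_sq => simpa [genVal, map_list_prod, List.map_ofFn, Function.comp_def] using h.γ'_sq
    | t_e x i => simpa [genVal] using h.t_e x i
    | t_f x i => simpa [genVal] using h.t_f x i
    | e_f i j =>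
        simpa only [genVal, map_mul, map_sub, map_smul, FreeAlgebra.lift_ι_apply] using h.e_f i j
    | e_comm i j hc => simpa [genVal] using h.e_comm i j hc
    | f_comm i j hc => simpa [genVal] using h.f_comm i j hc
    | e_serre i => simpa [genVal, map_qSerre] using h.e_serre i
    | e_serre' i => simpa [genVal, map_qSerre'] using h.e_serre' i
    | f_serre i => simpa [genVal, map_qSerre] using h.f_serre i
    | f_serre' i => simpa [genVal, map_qSerre'] using h.f_serre' i⟩

variable (h : P.IsModel e f t tinv)

@[simp] theorem U.lift_e (i : P.Idx) : U.lift h (U.e P i) = e i :=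
  (RingQuot.liftAlgHom_mkAlgHom_apply K _ _ _).trans (FreeAlgebra.lift_ι_apply _ _)
@[simp] theorem U.lift_f (i : P.Idx) : U.lift h (U.f P i) = f i :=
  (RingQuot.liftAlgHom_mkAlgHom_apply K _ _ _).trans (FreeAlgebra.lift_ι_apply _ _)
@[simp] theorem U.lift_t (x : P.Tor) : U.lift h (U.t P x) = t x :=
  (RingQuot.liftAlgHom_mkAlgHom_apply K _ _ _).trans (FreeAlgebra.lift_ι_apply _ _)
@[simp] theorem U.lift_tinv (x : P.Tor) : U.lift h (U.tinv P x) = tinv x :=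
  (RingQuot.liftAlgHom_mkAlgHom_apply K _ _ _).trans (FreeAlgebra.lift_ι_apply _ _)

end lift

/-- The set of generators of `U`. -/
def U.gens : Set P.U :=
  Set.range (U.e P) ∪ Set.range (U.f P) ∪ Set.range (U.t P) ∪ Set.range (U.tinv P)

theorem U.adjoin_gens : Algebra.adjoin K (U.gens P) = ⊤ := by
  rw [eq_top_iff]
  rintro x -
  obtain ⟨y, rfl⟩ := RingQuot.mkAlgHom_surjective K P.Rel x
  change P.toU y ∈ _
  induction y using FreeAlgebra.induction with
  | grade0 c => rw [AlgHom.commutes]; exact Subalgebra.algebraMap_mem _ _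
  | grade1 g =>
    apply Algebra.subset_adjoin
    cases g with
    | e i => exact .inl (.inl (.inl ⟨i, rfl⟩))
    | f i => exact .inl (.inl (.inr ⟨i, rfl⟩))
    | t x => exact .inl (.inr ⟨x, rfl⟩)
    | tinv x => exact .inr ⟨x, rfl⟩
  | mul a b ha hb => rw [map_mul]; exact mul_mem ha hb
  | add a b ha hb => rw [map_add]; exact add_mem ha hb

theorem U.algHom_ext {A : Type*} [Ring A] [Algebra K A] {φ ψ : P.U →ₐ[K] A}
    (he : ∀ i, φ (U.e P i) = ψ (U.e P i)) (hf : ∀ i, φ (U.f P i) = ψ (U.f P i))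
    (ht : ∀ x, φ (U.t P x) = ψ (U.t P x)) (hti : ∀ x, φ (U.tinv P x) = ψ (U.tinv P x)) :
    φ = ψ := by
  refine AlgHom.ext_of_adjoin_eq_top (U.adjoin_gens P) ?_
  rintro _ (((⟨i, rfl⟩ | ⟨i, rfl⟩) | ⟨x, rfl⟩) | ⟨x, rfl⟩)
  exacts [he i, hf i, ht x, hti x]

theorem chi_self (a b : K) (i : P.Idx) : P.chi a b i i = a / b := by
  have h := P.two_lt_n
  have h1 := P.val_succ i
  have hi : i ≠ i + 1 := by
    intro hh; rw [Fin.ext_iff, h1] at hh; split_ifs at hh <;> omega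
  simp [chi_exp, hi, div_eq_mul_inv]

theorem chi_right (a b : K) (i : P.Idx) : P.chi a b i (i + 1) = a⁻¹ := by
  have h := P.two_lt_n
  have h1 := P.val_succ i
  have h2 := P.val_succ (i + 1)
  have hi : i ≠ i + 1 := by
    intro hh; rw [Fin.ext_iff, h1] at hh; split_ifs at hh <;> omega
  have hi2 : i ≠ i + 1 + 1 := by
    intro hh; rw [Fin.ext_iff, h2, h1] at hh; split_ifs at hh <;> omega
  simp [chi_exp, hi, hi2]

theorem chi_left (a b : K) (i : P.Idx) : P.chi a b (i + 1) i = b := by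
  have h := P.two_lt_n
  have h1 := P.val_succ i
  have h2 := P.val_succ (i + 1)
  have hi : i + 1 ≠ i := by
    intro hh; rw [Fin.ext_iff, h1] at hh; split_ifs at hh <;> omega
  have hi2 : i ≠ i + 1 + 1 := by
    intro hh; rw [Fin.ext_iff, h2, h1] at hh; split_ifs at hh <;> omega
  simp [chi_exp, hi, hi2]

theorem chi_zero (a b : K) {i j : P.Idx} (h : P.cartan i j = 0) : P.chi a b i j = 1 := by
  unfold cartan at h
  split_ifs at h with h1 h2
  all_goals first | omega | skip
  rw [not_or] at h2
  simp [chi_exp, h1, h2.1, h2.2]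

theorem cartan_symm (i j : P.Idx) : P.cartan i j = P.cartan j i := by
  simp only [cartan, eq_comm (a := i) (b := j), or_comm]

theorem chi_swap (i j : P.Idx) : P.chi P.s P.r i j = (P.chi P.r P.s j i)⁻¹ := by
  have hr := P.r_ne_zero
  have hs := P.s_ne_zero
  simp only [chi_exp, eq_comm (a := i) (b := j), mul_inv, ← zpow_neg, neg_sub]
  rw [mul_comm]

namespace IsModel

variable {P} {A : Type*} [Ring A] [Algebra K A] {e f : P.Idx → A} {t tinv : P.Tor → A}

theorem tinv_mul_cancel (h : P.IsModel e f t tinv) (x : P.Tor) (a : A) : tinv x * (t x * a) = a := by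
  rw [← mul_assoc, h.tinv_t, one_mul]

theorem t_mul_cancel (h : P.IsModel e f t tinv) (x : P.Tor) (a : A) : t x * (tinv x * a) = a := by
  rw [← mul_assoc, h.t_tinv, one_mul]

theorem te (h : P.IsModel e f t tinv) (x : P.Tor) (i : P.Idx) :
    t x * e i = P.wt x i • (e i * t x) := by
  rw [← smul_mul_assoc, ← h.t_e, mul_assoc _ (tinv x), h.tinv_t, mul_one]

theorem tf (h : P.IsModel e f t tinv) (x : P.Tor) (i : P.Idx) :
    t x * f i = (P.wt x i)⁻¹ • (f i * t x) := by
  rw [← smul_mul_assoc, ← h.t_f, mul_assoc _ (tinv x), h.tinv_t, mul_one]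

theorem e_tinv (h : P.IsModel e f t tinv) (x : P.Tor) (i : P.Idx) :
    e i * tinv x = P.wt x i • (tinv x * e i) := by
  rw [← mul_smul_comm, ← h.t_e, ← mul_assoc, ← mul_assoc, h.tinv_t, one_mul]

theorem f_tinv (h : P.IsModel e f t tinv) (x : P.Tor) (i : P.Idx) :
    f i * tinv x = (P.wt x i)⁻¹ • (tinv x * f i) := by
  rw [← mul_smul_comm, ← h.t_f, ← mul_assoc, ← mul_assoc, h.tinv_t, one_mul]

theorem tinv_comm (h : P.IsModel e f t tinv) (x y : P.Tor) : tinv x * tinv y = tinv y * tinv x := by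
  calc tinv x * tinv y = tinv x * tinv y * (t x * t y * tinv y * tinv x) := by
        rw [mul_assoc (t x), h.t_tinv, mul_one, h.t_tinv, mul_one]
    _ = tinv x * (tinv y * (t y * (t x * (tinv y * tinv x)))) := by
        rw [h.t_comm]; simp only [mul_assoc]
    _ = _ := by rw [h.tinv_mul_cancel, h.tinv_mul_cancel]

end IsModel

theorem wt_ne_zero (x : P.Tor) (i : P.Idx) : P.wt x i ≠ 0 := by
  have hr := P.r_ne_zero
  have hs := P.s_ne_zero
  cases x <;> simp only [wt, chi_exp] <;> try split_ifs
  all_goals first | positivity | simp [hr, hs]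

theorem prod_ofFn_tmul {n : ℕ} {A B : Type*} [Ring A] [Algebra K A] [Ring B] [Algebra K B]
    (a : Fin n → A) (b : Fin n → B) :
    (List.ofFn fun i => a i ⊗ₜ[K] b i).prod = (List.ofFn a).prod ⊗ₜ[K] (List.ofFn b).prod := by
  simp only [List.ofFn_eq_map]
  induction List.finRange n with
  | nil => rfl
  | cons i l ih => simp [ih]

section models

variable {P} {A B : Type*} [Ring A] [Algebra K A] [Ring B] [Algebra K B]
  {e f : P.Idx → A} {t tinv : P.Tor → A} {e' f' : P.Idx → B} {t' tinv' : P.Tor → B}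

theorem IsModel.tmul (h : P.IsModel e f t tinv) (h' : P.IsModel e' f' t' tinv') :
    P.IsModel (A := A ⊗[K] B)
      (fun i => e i ⊗ₜ 1 + t (.ω i) ⊗ₜ e' i) (fun i => f i ⊗ₜ t' (.ω' i) + 1 ⊗ₜ f' i)
      (fun x => t x ⊗ₜ t' x) (fun x => tinv x ⊗ₜ tinv' x) where
  t_tinv x := by simp [h.t_tinv, h'.t_tinv, Algebra.TensorProduct.one_def]
  tinv_t x := by simp [h.tinv_t, h'.tinv_t, Algebra.TensorProduct.one_def]
  t_comm x y := by simp [h.t_comm x y, h'.t_comm x y]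
  γ_sq := by rw [prod_ofFn_tmul, ← h.γ_sq, ← h'.γ_sq]; simp [pow_two]
  γ'_sq := by rw [prod_ofFn_tmul, ← h.γ'_sq, ← h'.γ'_sq]; simp [pow_two]
  t_e x i := by
    simp only [mul_add, add_mul, Algebra.TensorProduct.tmul_mul_tmul, mul_one, h.t_e, h'.t_e,
      h'.t_tinv, h.t_comm x (.ω i), mul_assoc (t (.ω i)), h.t_tinv, TensorProduct.tmul_smul,
      smul_add]
    rw [← TensorProduct.smul_tmul']
  t_f x i := by
    simp only [mul_add, add_mul, Algebra.TensorProduct.tmul_mul_tmul, mul_one, h.t_f, h'.t_f,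
      h.t_tinv, h'.t_comm x (.ω' i), mul_assoc (t' (.ω' i)), h'.t_tinv, TensorProduct.tmul_smul,
      smul_add]
    rw [← TensorProduct.smul_tmul']
  e_f i j := by
    have h1 := h.tf (.ω i) j
    have h2 := h'.te (.ω' j) i
    have h3 : P.wt (.ω' j) i = (P.wt (.ω i) j)⁻¹ := P.chi_swap i j
    have h4 := sub_eq_iff_eq_add.1 (h.e_f i j)
    have h5 := sub_eq_iff_eq_add.1 (h'.e_f i j)
    simp only [mul_add, add_mul, Algebra.TensorProduct.tmul_mul_tmul, mul_one, one_mul, h1, h2, h3,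
      h4, h5]
    by_cases hij : i = j
    · subst hij
      simp only [TensorProduct.add_tmul, TensorProduct.tmul_add, TensorProduct.tmul_smul,
        ← TensorProduct.smul_tmul', TensorProduct.tmul_sub, TensorProduct.sub_tmul]
      module
    · simp only [hij, if_false, zero_div, zero_smul, zero_add, TensorProduct.tmul_smul,
        ← TensorProduct.smul_tmul']
      abel
  e_comm i j hc := by
    have h1 := h.te (.ω i) j
    have h2 := h.te (.ω j) i
    have h3 : P.wt (.ω i) j = 1 := P.chi_zero _ _ (P.cartan_symm i j ▸ hc)
    have h4 : P.wt (.ω j) i = 1 := P.chi_zero _ _ hc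
    simp only [mul_add, add_mul, Algebra.TensorProduct.tmul_mul_tmul, mul_one, one_mul, h1, h2, h3,
      h4, one_smul, h.e_comm i j hc, h'.e_comm i j hc, h.t_comm (.ω i) (.ω j)]
    abel
  f_comm i j hc := by
    have h1 := h'.tf (.ω' i) j
    have h2 := h'.tf (.ω' j) i
    have h3 : P.wt (.ω' i) j = 1 := P.chi_zero _ _ (P.cartan_symm i j ▸ hc)
    have h4 : P.wt (.ω' j) i = 1 := P.chi_zero _ _ hc
    simp only [mul_add, add_mul, Algebra.TensorProduct.tmul_mul_tmul, mul_one, one_mul, h1, h2, h3,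
      h4, inv_one, one_smul, h.f_comm i j hc, h'.f_comm i j hc, h'.t_comm (.ω' i) (.ω' j)]
    abel
  e_serre i := by
    have h1 := h.te (.ω i) i
    have h2 := h.te (.ω i) (i + 1)
    have h3 := h.te (.ω (i + 1)) i
    simp only [wt, chi_self, chi_left, chi_right] at h1 h2 h3
    rw [qSerre_add P.r_ne_zero P.s_ne_zero, qSerre_left_tmul (h.t_comm _ _), h'.e_serre,
      ← Algebra.TensorProduct.includeLeft_apply (S := K),
      ← Algebra.TensorProduct.includeLeft_apply (S := K), ← map_qSerre, h.e_serre]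
    · simp
    · simp [h1, TensorProduct.smul_tmul']
    · simp [h2, TensorProduct.smul_tmul']
    · simp [h3, TensorProduct.smul_tmul']
  e_serre' i := by
    have h1 := h.te (.ω (i + 1)) (i + 1)
    have h2 := h.te (.ω i) (i + 1)
    have h3 := h.te (.ω (i + 1)) i
    simp only [wt, chi_self, chi_left, chi_right] at h1 h2 h3
    rw [qSerre'_add P.r_ne_zero P.s_ne_zero, qSerre'_left_tmul (h.t_comm _ _), h'.e_serre',
      ← Algebra.TensorProduct.includeLeft_apply (S := K),
      ← Algebra.TensorProduct.includeLeft_apply (S := K), ← map_qSerre', h.e_serre']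
    · simp
    · simp [h1, TensorProduct.smul_tmul']
    · simp [h2, TensorProduct.smul_tmul']
    · simp [h3, TensorProduct.smul_tmul']
  f_serre i := by
    have h1 := h'.tf (.ω' i) i
    have h2 := h'.tf (.ω' i) (i + 1)
    have h3 := h'.tf (.ω' (i + 1)) i
    simp only [wt, chi_self, chi_left, chi_right] at h1 h2 h3
    rw [qSerre_symm, add_comm (f i ⊗ₜ[K] _), add_comm (f (i + 1) ⊗ₜ[K] _),
      qSerre_add (inv_ne_zero P.s_ne_zero) (inv_ne_zero P.r_ne_zero),
      qSerre_symm, qSerre_symm _ _ (f i ⊗ₜ[K] _), qSerre_right_tmul (h'.t_comm _ _), h.f_serre,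
      ← Algebra.TensorProduct.includeRight_apply (R := K),
      ← Algebra.TensorProduct.includeRight_apply (R := K), ← map_qSerre, h'.f_serre]
    · simp
    · simp [h1, TensorProduct.tmul_smul, div_eq_mul_inv, mul_comm]
    · simp [h2, TensorProduct.tmul_smul]
    · simp [h3, TensorProduct.tmul_smul]
  f_serre' i := by
    have h1 := h'.tf (.ω' (i + 1)) (i + 1)
    have h2 := h'.tf (.ω' i) (i + 1)
    have h3 := h'.tf (.ω' (i + 1)) i
    simp only [wt, chi_self, chi_left, chi_right] at h1 h2 h3
    rw [qSerre'_symm, add_comm (f i ⊗ₜ[K] _), add_comm (f (i + 1) ⊗ₜ[K] _),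
      qSerre'_add (inv_ne_zero P.s_ne_zero) (inv_ne_zero P.r_ne_zero),
      qSerre'_symm, qSerre'_symm _ _ (f i ⊗ₜ[K] _), qSerre'_right_tmul (h'.t_comm _ _), h.f_serre',
      ← Algebra.TensorProduct.includeRight_apply (R := K),
      ← Algebra.TensorProduct.includeRight_apply (R := K), ← map_qSerre', h'.f_serre']
    · simp
    · simp [h1, TensorProduct.tmul_smul, div_eq_mul_inv, mul_comm]
    · simp [h2, TensorProduct.tmul_smul]
    · simp [h3, TensorProduct.tmul_smul]

/-- A family in the base field, for the counit. -/
theorem isModel_counit : P.IsModel (A := K) (fun _ => 0) (fun _ => 0) (fun _ => 1) (fun _ => 1)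
    where
  t_tinv x := by simp
  tinv_t x := by simp
  t_comm x y := by simp
  γ_sq := by simp
  γ'_sq := by simp
  t_e x i := by simp
  t_f x i := by simp
  e_f i j := by simp
  e_comm i j hc := by simp
  f_comm i j hc := by simp
  e_serre i := by simp [qSerre]
  e_serre' i := by simp [qSerre']
  f_serre i := by simp [qSerre]
  f_serre' i := by simp [qSerre']

open MulOpposite in
theorem op_prod_ofFn {n : ℕ} {t : Fin n → A} (h : ∀ i j, t i * t j = t j * t i) :
    (List.ofFn fun i => op (t i)).prod = op (List.ofFn t).prod := by
  simp only [List.ofFn_eq_map]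
  have key (l : List (Fin n)) (j : Fin n) : (l.map t).prod * t j = t j * (l.map t).prod := by
    induction l with
    | nil => simp
    | cons i l ih =>
      rw [List.map_cons, List.prod_cons, mul_assoc, ih, ← mul_assoc, ← mul_assoc, h i j]
  induction List.finRange n with
  | nil => rfl
  | cons i l ih => rw [List.map_cons, List.prod_cons, ih, List.map_cons, List.prod_cons, ← op_mul, key]

theorem IsModel.prod_tinv (h : P.IsModel e f t tinv) (c : P.Idx → P.Tor) :
    (List.ofFn fun i => tinv (c i)).prod * (List.ofFn fun i => t (c i)).prod = 1 := by
  simp only [List.ofFn_eq_map]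
  have key (l : List P.Idx) (y : P.Tor) :
      (l.map fun i => t (c i)).prod * t y = t y * (l.map fun i => t (c i)).prod := by
    induction l with
    | nil => simp
    | cons i l ih =>
      simp only [List.map_cons, List.prod_cons, mul_assoc, ih]
      simp only [← mul_assoc, h.t_comm y (c i)]
  induction List.finRange P.n with
  | nil => simp
  | cons i l ih =>
    simp only [List.map_cons, List.prod_cons]
    rw [← key, mul_assoc, ← mul_assoc _ _ (t (c i)), ih, one_mul, h.tinv_t]

theorem IsModel.tinv_sq (h : P.IsModel e f t tinv) (x : P.Tor) (c : P.Idx → P.Tor)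
    (hc : t x ^ 2 = (List.ofFn fun i => t (c i)).prod) :
    tinv x ^ 2 = (List.ofFn fun i => tinv (c i)).prod := by
  have h1 := h.prod_tinv c
  rw [← hc] at h1
  have h2 : t x ^ 2 * tinv x ^ 2 = 1 := by
    rw [pow_two, pow_two, mul_assoc, h.t_mul_cancel, h.t_tinv]
  exact (left_inv_eq_right_inv h1 h2).symm

open MulOpposite in
theorem IsModel.op (h : P.IsModel e f t tinv) :
    P.IsModel (A := Aᵐᵒᵖ) (fun i => op (-(tinv (.ω i) * e i))) (fun i => op (-(f i * tinv (.ω' i))))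
      (fun x => op (tinv x)) (fun x => op (t x)) where
  t_tinv x := by rw [← op_mul, h.t_tinv, op_one]
  tinv_t x := by rw [← op_mul, h.tinv_t, op_one]
  t_comm x y := by rw [← op_mul, ← op_mul, h.tinv_comm]
  γ_sq := by
    rw [op_prod_ofFn fun i j => h.tinv_comm _ _, ← h.tinv_sq _ _ h.γ_sq, op_pow]
  γ'_sq := by
    rw [op_prod_ofFn fun i j => h.tinv_comm _ _, ← h.tinv_sq _ _ h.γ'_sq, op_pow]
  t_e x i := by
    rw [← op_mul, ← op_mul, ← op_smul]
    congr 1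
    simp only [neg_mul, mul_neg, smul_neg, neg_inj]
    rw [mul_assoc, h.e_tinv, mul_smul_comm, mul_smul_comm, ← mul_assoc (tinv _), h.tinv_comm,
      mul_assoc, h.t_mul_cancel]
  t_f x i := by
    rw [← op_mul, ← op_mul, ← op_smul]
    congr 1
    simp only [neg_mul, mul_neg, smul_neg, neg_inj]
    rw [mul_assoc (f i), h.tinv_comm, ← smul_mul_assoc, ← h.t_f]
    simp only [mul_assoc]
  e_f i j := by
    have h1 := h.f_tinv (.ω i) j
    have h2 := h.e_tinv (.ω' j) i
    have h3 : P.wt (.ω' j) i = (P.wt (.ω i) j)⁻¹ := P.chi_swap i j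
    have h4 := h.e_f i j
    have hw := P.wt_ne_zero (.ω i) j
    have h5 : f j * tinv (.ω' j) * (tinv (.ω i) * e i) =
        tinv (.ω i) * (f j * e i) * tinv (.ω' j) := by
      rw [mul_assoc (tinv _), mul_assoc (f j) (e i), h2, h3, mul_smul_comm, mul_smul_comm,
        ← mul_assoc (f j), ← mul_assoc (tinv (.ω i)), ← mul_smul_comm]
      rw [← mul_assoc, mul_assoc (f j), h.tinv_comm, ← mul_assoc, h1]
      simp only [smul_mul_assoc, mul_assoc, mul_smul_comm]
    have h6 : tinv (.ω i) * (e i * f j - f j * e i) * tinv (.ω' j) =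
        ((if i = j then 1 else 0) / (P.r - P.s)) • (tinv (.ω' i) - tinv (.ω i)) := by
      rw [h4]
      by_cases hij : i = j
      · subst hij
        simp only [mul_smul_comm, smul_mul_assoc, mul_sub, sub_mul, h.tinv_t, one_mul, mul_assoc,
          h.t_tinv, mul_one]
      · simp [hij]
    rw [← op_mul, ← op_mul, ← op_sub, ← op_sub, ← op_smul, neg_mul_neg, neg_mul_neg, h5]
    congr 1
    rw [← neg_sub (tinv (.ω' i)), smul_neg, ← h6]
    simp only [mul_sub, sub_mul, mul_assoc, neg_sub]
  e_comm i j hc := by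
    have h1 := h.e_tinv (.ω i) j
    have h2 := h.e_tinv (.ω j) i
    have h3 : P.wt (.ω i) j = 1 := P.chi_zero _ _ (P.cartan_symm i j ▸ hc)
    have h4 : P.wt (.ω j) i = 1 := P.chi_zero _ _ hc
    rw [h3, one_smul] at h1
    rw [h4, one_smul] at h2
    rw [← op_mul, ← op_mul, neg_mul_neg, neg_mul_neg]
    congr 1
    rw [mul_assoc, ← mul_assoc (e j), h1, mul_assoc, ← h.e_comm i j hc, ← mul_assoc,
      h.tinv_comm, mul_assoc, ← mul_assoc _ (e i), ← h2]
    simp only [mul_assoc]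
  f_comm i j hc := by
    have h1 := h.f_tinv (.ω' i) j
    have h2 := h.f_tinv (.ω' j) i
    have h3 : P.wt (.ω' i) j = 1 := P.chi_zero _ _ (P.cartan_symm i j ▸ hc)
    have h4 : P.wt (.ω' j) i = 1 := P.chi_zero _ _ hc
    rw [h3, inv_one, one_smul] at h1
    rw [h4, inv_one, one_smul] at h2
    rw [← op_mul, ← op_mul, neg_mul_neg, neg_mul_neg]
    congr 1
    rw [mul_assoc, ← mul_assoc _ (f i), ← h2, mul_assoc (f i), ← mul_assoc (f j),
      ← h.f_comm i j hc, h.tinv_comm, mul_assoc, ← mul_assoc (f j), h1]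
    simp only [mul_assoc]
  e_serre i := by
    have h1 := h.e_tinv (.ω i) i
    have h2 := h.e_tinv (.ω i) (i + 1)
    have h3 := h.e_tinv (.ω (i + 1)) i
    simp only [wt, chi_self, chi_left, chi_right] at h1 h2 h3
    have key := qSerre_twist P.r_ne_zero P.s_ne_zero (h.tinv_comm _ _) h1 h2 h3 (h.e_serre i)
    apply unop_injective
    simp only [qSerre, unop_add, unop_sub, unop_smul, unop_mul, unop_pow, unop_op, unop_zero,
      neg_sq, mul_neg, neg_mul, smul_neg]
    rw [← neg_zero, ← key, mul_assoc (tinv (.ω i) * e i)]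
    module
  e_serre' i := by
    have h1 := h.e_tinv (.ω (i + 1)) (i + 1)
    have h2 := h.e_tinv (.ω i) (i + 1)
    have h3 := h.e_tinv (.ω (i + 1)) i
    simp only [wt, chi_self, chi_left, chi_right] at h1 h2 h3
    have key := qSerre'_twist P.r_ne_zero P.s_ne_zero (h.tinv_comm _ _) h1 h2 h3 (h.e_serre' i)
    apply unop_injective
    simp only [qSerre', unop_add, unop_sub, unop_smul, unop_mul, unop_pow, unop_op, unop_zero,
      neg_sq, mul_neg, neg_mul, smul_neg]
    rw [← neg_zero, ← key, mul_assoc (tinv (.ω (i + 1)) * e (i + 1))]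
    module
  f_serre i := by
    have h1 := h.f_tinv (.ω' i) i
    have h2 := h.f_tinv (.ω' i) (i + 1)
    have h3 := h.f_tinv (.ω' (i + 1)) i
    have h4 := h.f_tinv (.ω' (i + 1)) (i + 1)
    simp only [wt, chi_self, chi_left, chi_right] at h1 h2 h3 h4
    have key := qSerre_twist (inv_ne_zero P.s_ne_zero) (inv_ne_zero P.r_ne_zero)
      (h.tinv_comm (.ω' i) (.ω' (i + 1))) (h1.trans (by simp [div_eq_mul_inv, mul_comm])) h2 h3
      ((qSerre_symm _ _ _ _).trans (h.f_serre i))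
    apply unop_injective
    simp only [qSerre, unop_add, unop_sub, unop_smul, unop_mul, unop_op, unop_zero,
      mul_neg, neg_mul, smul_neg, h1, h4, pow_two, mul_smul_comm,
      smul_mul_assoc, smul_smul, mul_assoc] at key ⊢
    rw [← smul_zero (-((P.s / P.r)⁻¹ ^ 3)), ← key]
    module
  f_serre' i := by
    have h1 := h.f_tinv (.ω' i) i
    have h2 := h.f_tinv (.ω' i) (i + 1)
    have h3 := h.f_tinv (.ω' (i + 1)) i
    have h4 := h.f_tinv (.ω' (i + 1)) (i + 1)
    simp only [wt, chi_self, chi_left, chi_right] at h1 h2 h3 h4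
    have key := qSerre'_twist (inv_ne_zero P.s_ne_zero) (inv_ne_zero P.r_ne_zero)
      (h.tinv_comm (.ω' i) (.ω' (i + 1))) (h4.trans (by simp [div_eq_mul_inv, mul_comm])) h2 h3
      ((qSerre'_symm _ _ _ _).trans (h.f_serre' i))
    apply unop_injective
    simp only [qSerre', unop_add, unop_sub, unop_smul, unop_mul, unop_op, unop_zero,
      mul_neg, neg_mul, smul_neg, h1, h4, pow_two, mul_smul_comm,
      smul_mul_assoc, smul_smul, mul_assoc] at key ⊢
    rw [← smul_zero (-((P.s / P.r)⁻¹ ^ 3)), ← key]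
    module

end models

namespace U

/-- The coproduct: `Δ e_i = e_i ⊗ 1 + ω_i ⊗ e_i`, `Δ f_i = f_i ⊗ ω'_i + 1 ⊗ f_i`, and the invertible
generators are group-like. -/
noncomputable def comulHom : P.U →ₐ[K] P.U ⊗[K] P.U := U.lift ((U.isModel P).tmul (U.isModel P))

/-- The counit: `0` on `e_i`, `f_i`, and `1` on the invertible generators. -/
noncomputable def counitHom : P.U →ₐ[K] K := U.lift P.isModel_counit

/-- The antipode, as a homomorphism to the opposite algebra: `S e_i = -ω_i⁻¹ e_i`,
`S f_i = -f_i ω'_i⁻¹`, and `S x = x⁻¹` for the invertible generators. -/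
noncomputable def antipodeHom : P.U →ₐ[K] P.Uᵐᵒᵖ := U.lift (U.isModel P).op

noncomputable instance : Bialgebra K P.U :=
  Bialgebra.ofAlgHom (comulHom P) (counitHom P)
    (by
      apply U.algHom_ext <;> intro i <;>
        simp [comulHom, TensorProduct.add_tmul, TensorProduct.tmul_add,
          Algebra.TensorProduct.one_def, add_assoc])
    (by
      apply U.algHom_ext <;> intro i <;> simp [comulHom, counitHom])
    (by
      apply U.algHom_ext <;> intro i <;> simp [comulHom, counitHom])

theorem comul_eq (x : P.U) : Coalgebra.comul (R := K) x = comulHom P x := rfl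
theorem counit_eq (x : P.U) : Coalgebra.counit (R := K) x = counitHom P x := rfl

end U

end QParams

section OfGenerators

variable {K A : Type*} [Field K] [Ring A] [Algebra K A] (S : A →ₐ[K] Aᵐᵒᵖ)

/-- The linear map underlying an anti-homomorphism. -/
def antiLin : A →ₗ[K] A := (MulOpposite.opLinearEquiv K).symm.toLinearMap ∘ₗ S.toLinearMap

theorem antiLin_mul (a b : A) : antiLin S (a * b) = antiLin S b * antiLin S a := by
  simp [antiLin]

theorem antiLin_one : antiLin S 1 = 1 := by simp [antiLin]

theorem mul'_rTensor_antiLin {X : A ⊗[K] A} {c : K}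
    (hX : LinearMap.mul' K A ((antiLin S).rTensor A X) = algebraMap K A c) (Y : A ⊗[K] A) :
    LinearMap.mul' K A ((antiLin S).rTensor A (X * Y)) =
      c • LinearMap.mul' K A ((antiLin S).rTensor A Y) := by
  induction Y with
  | zero => simp
  | add Y₁ Y₂ h₁ h₂ => simp only [mul_add, map_add, h₁, h₂, smul_add]
  | tmul a b =>
    have key (X : A ⊗[K] A) : LinearMap.mul' K A ((antiLin S).rTensor A (X * a ⊗ₜ b)) =
        antiLin S a * LinearMap.mul' K A ((antiLin S).rTensor A X) * b := by
      induction X with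
      | zero => simp
      | add X₁ X₂ h₁ h₂ => simp only [add_mul, mul_add, map_add, h₁, h₂]
      | tmul x y => simp [antiLin_mul, mul_assoc]
    rw [key, hX]
    simp [Algebra.algebraMap_eq_smul_one]

theorem mul'_lTensor_antiLin {Y : A ⊗[K] A} {c : K}
    (hY : LinearMap.mul' K A ((antiLin S).lTensor A Y) = algebraMap K A c) (X : A ⊗[K] A) :
    LinearMap.mul' K A ((antiLin S).lTensor A (X * Y)) =
      c • LinearMap.mul' K A ((antiLin S).lTensor A X) := by
  induction X with
  | zero => simp
  | add X₁ X₂ h₁ h₂ => simp only [add_mul, map_add, h₁, h₂, smul_add]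
  | tmul a b =>
    have key (Y : A ⊗[K] A) : LinearMap.mul' K A ((antiLin S).lTensor A (a ⊗ₜ b * Y)) =
        a * LinearMap.mul' K A ((antiLin S).lTensor A Y) * antiLin S b := by
      induction Y with
      | zero => simp
      | add X₁ X₂ h₁ h₂ => simp only [add_mul, mul_add, map_add, h₁, h₂]
      | tmul x y => simp [antiLin_mul, mul_assoc]
    rw [key, hY]
    simp [Algebra.algebraMap_eq_smul_one]

end OfGenerators

/-- A bialgebra with an algebra anti-endomorphism that satisfies the antipode identities on a
generating set is a Hopf algebra. -/
noncomputable abbrev HopfAlgebra.ofGenerators {K A : Type*} [Field K] [Ring A] [Bialgebra K A]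
    (S : A →ₐ[K] Aᵐᵒᵖ) (s : Set A) (hs : Algebra.adjoin K s = ⊤)
    (hl : ∀ a ∈ s, LinearMap.mul' K A ((antiLin S).rTensor A (Coalgebra.comul a)) =
      algebraMap K A (Coalgebra.counit a))
    (hr : ∀ a ∈ s, LinearMap.mul' K A ((antiLin S).lTensor A (Coalgebra.comul a)) =
      algebraMap K A (Coalgebra.counit a)) :
    HopfAlgebra K A where
  antipode := antiLin S
  mul_antipode_rTensor_comul := by
    ext a
    have ha : a ∈ Algebra.adjoin K s := hs ▸ Algebra.mem_top
    simp only [LinearMap.comp_apply, Algebra.linearMap_apply]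
    induction ha using Algebra.adjoin_induction with
    | mem x hx => exact hl x hx
    | algebraMap c =>
      simp [Algebra.TensorProduct.one_def, antiLin_one, Algebra.algebraMap_eq_smul_one]
    | add x y _ _ hx hy => simp only [map_add, hx, hy]
    | mul x y _ _ hx hy =>
      rw [Bialgebra.comul_mul, mul'_rTensor_antiLin S hx, hy, Bialgebra.counit_mul, map_mul,
        Algebra.smul_def]
  mul_antipode_lTensor_comul := by
    ext a
    have ha : a ∈ Algebra.adjoin K s := hs ▸ Algebra.mem_top
    simp only [LinearMap.comp_apply, Algebra.linearMap_apply]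
    induction ha using Algebra.adjoin_induction with
    | mem x hx => exact hr x hx
    | algebraMap c =>
      simp [Algebra.TensorProduct.one_def, antiLin_one, Algebra.algebraMap_eq_smul_one]
    | add x y _ _ hx hy => simp only [map_add, hx, hy]
    | mul x y _ _ hx hy =>
      rw [Bialgebra.comul_mul, mul'_lTensor_antiLin S hy, hx, Bialgebra.counit_mul, map_mul,
        Algebra.smul_def, ← map_mul, mul_comm, map_mul]

namespace QParams

variable {K : Type*} [Field K] (P : QParams K)

namespace U

open Coalgebra

theorem comul_e (i : P.Idx) :
    comul (R := K) (e P i) = e P i ⊗ₜ 1 + t P (.ω i) ⊗ₜ e P i := U.lift_e _ i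
theorem comul_f (i : P.Idx) :
    comul (R := K) (f P i) = f P i ⊗ₜ t P (.ω' i) + 1 ⊗ₜ f P i := U.lift_f _ i
theorem comul_t (x : P.Tor) : comul (R := K) (t P x) = t P x ⊗ₜ t P x := U.lift_t _ x
theorem comul_tinv (x : P.Tor) : comul (R := K) (tinv P x) = tinv P x ⊗ₜ tinv P x :=
  U.lift_tinv _ x
theorem counit_e (i : P.Idx) : counit (R := K) (e P i) = 0 := U.lift_e _ i
theorem counit_f (i : P.Idx) : counit (R := K) (f P i) = 0 := U.lift_f _ i
theorem counit_t (x : P.Tor) : counit (R := K) (t P x) = 1 := U.lift_t _ x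
theorem counit_tinv (x : P.Tor) : counit (R := K) (tinv P x) = 1 := U.lift_tinv _ x

theorem antiLin_e (i : P.Idx) : antiLin (antipodeHom P) (e P i) = -(tinv P (.ω i) * e P i) :=
  congrArg MulOpposite.unop (U.lift_e _ i)
theorem antiLin_f (i : P.Idx) : antiLin (antipodeHom P) (f P i) = -(f P i * tinv P (.ω' i)) :=
  congrArg MulOpposite.unop (U.lift_f _ i)
theorem antiLin_t (x : P.Tor) : antiLin (antipodeHom P) (t P x) = tinv P x :=
  congrArg MulOpposite.unop (U.lift_t _ x)
theorem antiLin_tinv (x : P.Tor) : antiLin (antipodeHom P) (tinv P x) = t P x :=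
  congrArg MulOpposite.unop (U.lift_tinv _ x)

/-- The Hopf algebra structure of `U`. -/
noncomputable instance : HopfAlgebra K P.U :=
  HopfAlgebra.ofGenerators (antipodeHom P) (gens P) (adjoin_gens P)
    (by
      have h := U.isModel P
      rintro _ (((⟨i, rfl⟩ | ⟨i, rfl⟩) | ⟨x, rfl⟩) | ⟨x, rfl⟩)
      · simp [comul_e, counit_e, antiLin_e, antiLin_t]
      · simp [comul_f, counit_f, antiLin_f, antiLin_one, mul_assoc, h.tinv_t]
      · simp [comul_t, counit_t, antiLin_t, h.tinv_t]
      · simp [comul_tinv, counit_tinv, antiLin_tinv, h.t_tinv])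
    (by
      have h := U.isModel P
      rintro _ (((⟨i, rfl⟩ | ⟨i, rfl⟩) | ⟨x, rfl⟩) | ⟨x, rfl⟩)
      · simp [comul_e, counit_e, antiLin_e, antiLin_one, h.t_mul_cancel]
      · simp [comul_f, counit_f, antiLin_f, antiLin_t]
      · simp [comul_t, counit_t, antiLin_t, h.t_tinv]
      · simp [comul_tinv, counit_tinv, antiLin_tinv, h.tinv_t])

theorem antipode_e (i : P.Idx) :
    HopfAlgebra.antipode K (e P i) = -(tinv P (.ω i) * e P i) := antiLin_e P i
theorem antipode_f (i : P.Idx) :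
    HopfAlgebra.antipode K (f P i) = -(f P i * tinv P (.ω' i)) := antiLin_f P i
theorem antipode_t (x : P.Tor) : HopfAlgebra.antipode K (t P x) = tinv P x := antiLin_t P x
theorem antipode_tinv (x : P.Tor) : HopfAlgebra.antipode K (tinv P x) = t P x := antiLin_tinv P x

end U

end QParams

section HopfSubalgebra

variable {K H : Type*} [Field K] [Ring H] [HopfAlgebra K H]

/-- A subalgebra closed under comultiplication and antipode. -/
structure IsHopfSubalgebra (B : Subalgebra K H) : Prop where
  comul_mem : ∀ b ∈ B, Coalgebra.comul (R := K) b ∈ (Algebra.TensorProduct.map B.val B.val).range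
  antipode_mem : ∀ b ∈ B, HopfAlgebra.antipode K b ∈ B

namespace IsHopfSubalgebra

variable {B : Subalgebra K H}

theorem map_val_injective (B : Subalgebra K H) :
    Function.Injective (Algebra.TensorProduct.map B.val B.val) :=
  TensorProduct.map_injective_of_flat_flat (R := K) B.val.toLinearMap B.val.toLinearMap
    Subtype.val_injective Subtype.val_injective

variable (h : IsHopfSubalgebra B)

/-- The restricted coproduct of a Hopf subalgebra. -/
noncomputable def comulHom : B →ₐ[K] B ⊗[K] B :=
  (AlgEquiv.ofInjective _ (map_val_injective B)).symm.toAlgHom.comp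
    (((Bialgebra.comulAlgHom K H).comp B.val).codRestrict _ fun b => h.comul_mem b b.2)

theorem map_comulHom (b : B) :
    Algebra.TensorProduct.map B.val B.val (h.comulHom b) = Coalgebra.comul (R := K) (b : H) :=
  congrArg Subtype.val ((AlgEquiv.ofInjective _ (map_val_injective B)).apply_symm_apply _)

/-- The restricted antipode of a Hopf subalgebra. -/
noncomputable def antipodeLin : B →ₗ[K] B :=
  ((HopfAlgebra.antipode K).comp B.val.toLinearMap).codRestrict (Subalgebra.toSubmodule B)
    fun b => h.antipode_mem b b.2

/-- The bialgebra structure of a Hopf subalgebra. -/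
noncomputable abbrev bialgebra : Bialgebra K B :=
  Bialgebra.ofAlgHom h.comulHom ((Bialgebra.counitAlgHom K H).comp B.val)
    (by
      ext b
      have inj : Function.Injective (TensorProduct.map B.val.toLinearMap
          (TensorProduct.map B.val.toLinearMap B.val.toLinearMap)) :=
        TensorProduct.map_injective_of_flat_flat (R := K) _ _ Subtype.val_injective
          (map_val_injective B)
      apply inj
      have e1 : (TensorProduct.map B.val.toLinearMap
          (TensorProduct.map B.val.toLinearMap B.val.toLinearMap)) ∘ₗ
          (TensorProduct.assoc K B B B).toLinearMap ∘ₗ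
            TensorProduct.map h.comulHom.toLinearMap LinearMap.id =
          (TensorProduct.assoc K H H H).toLinearMap ∘ₗ Coalgebra.comul.rTensor H ∘ₗ
            TensorProduct.map B.val.toLinearMap B.val.toLinearMap := by
        have e3 : (TensorProduct.map B.val.toLinearMap
          (TensorProduct.map B.val.toLinearMap B.val.toLinearMap)) ∘ₗ
          (TensorProduct.assoc K B B B).toLinearMap =
          (TensorProduct.assoc K H H H).toLinearMap ∘ₗ
          TensorProduct.map (TensorProduct.map B.val.toLinearMap B.val.toLinearMap)
            B.val.toLinearMap := by
          ext; rfl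
        rw [← LinearMap.comp_assoc, e3]
        ext x y
        simp only [TensorProduct.AlgebraTensorModule.curry_apply, TensorProduct.curry_apply,
          LinearMap.coe_restrictScalars, LinearMap.comp_apply, TensorProduct.map_tmul]
        congr 1
        exact congrArg (· ⊗ₜ[K] (y : H)) (h.map_comulHom x)
      have e2 : (TensorProduct.map B.val.toLinearMap
          (TensorProduct.map B.val.toLinearMap B.val.toLinearMap)) ∘ₗ
            TensorProduct.map LinearMap.id h.comulHom.toLinearMap =
          Coalgebra.comul.lTensor H ∘ₗ
            TensorProduct.map B.val.toLinearMap B.val.toLinearMap := by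
        ext x y
        simp only [TensorProduct.AlgebraTensorModule.curry_apply, TensorProduct.curry_apply,
          LinearMap.coe_restrictScalars, LinearMap.comp_apply, TensorProduct.map_tmul]
        exact congrArg ((x : H) ⊗ₜ[K] ·) (h.map_comulHom y)
      have e1' := LinearMap.congr_fun e1 (h.comulHom b)
      have e2' := LinearMap.congr_fun e2 (h.comulHom b)
      refine e1'.trans (Eq.trans ?_ e2'.symm)
      have e4 := h.map_comulHom b
      change TensorProduct.map B.val.toLinearMap B.val.toLinearMap (h.comulHom b) = _ at e4
      simp only [LinearMap.comp_apply, e4]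
      exact Coalgebra.coassoc_apply _)
    (by
      ext b
      have inj : Function.Injective (TensorProduct.map (LinearMap.id (R := K) (M := K))
          B.val.toLinearMap) :=
        TensorProduct.map_injective_of_flat_flat (R := K) _ _ Function.injective_id
          Subtype.val_injective
      apply inj
      have e1 : TensorProduct.map (LinearMap.id (R := K) (M := K)) B.val.toLinearMap ∘ₗ
          TensorProduct.map (Coalgebra.counit (R := K) ∘ₗ B.val.toLinearMap) LinearMap.id =
          Coalgebra.counit.rTensor H ∘ₗ
            TensorProduct.map B.val.toLinearMap B.val.toLinearMap := by
        ext x y; rfl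
      have e4 := h.map_comulHom b
      change TensorProduct.map B.val.toLinearMap B.val.toLinearMap (h.comulHom b) = _ at e4
      refine (LinearMap.congr_fun e1 (h.comulHom b)).trans ?_
      simp only [LinearMap.comp_apply, e4]
      exact Coalgebra.rTensor_counit_comul _)
    (by
      ext b
      have inj : Function.Injective (TensorProduct.map
          B.val.toLinearMap (LinearMap.id (R := K) (M := K))) :=
        TensorProduct.map_injective_of_flat_flat (R := K) _ _
          Subtype.val_injective Function.injective_id
      apply inj
      have e1 : TensorProduct.map B.val.toLinearMap (LinearMap.id (R := K) (M := K)) ∘ₗ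
          TensorProduct.map LinearMap.id (Coalgebra.counit (R := K) ∘ₗ B.val.toLinearMap) =
          Coalgebra.counit.lTensor H ∘ₗ
            TensorProduct.map B.val.toLinearMap B.val.toLinearMap := by
        ext x y; rfl
      have e4 := h.map_comulHom b
      change TensorProduct.map B.val.toLinearMap B.val.toLinearMap (h.comulHom b) = _ at e4
      refine (LinearMap.congr_fun e1 (h.comulHom b)).trans ?_
      simp only [LinearMap.comp_apply, e4]
      exact Coalgebra.lTensor_counit_comul _)

/-- The Hopf algebra structure of a Hopf subalgebra. -/
noncomputable abbrev hopfAlgebra : HopfAlgebra K B :=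
  letI := h.bialgebra
  { antipode := h.antipodeLin
    mul_antipode_rTensor_comul := by
      ext b
      have e1 : B.val.toLinearMap ∘ₗ LinearMap.mul' K B ∘ₗ h.antipodeLin.rTensor B =
          LinearMap.mul' K H ∘ₗ (HopfAlgebra.antipode K).rTensor H ∘ₗ
            TensorProduct.map B.val.toLinearMap B.val.toLinearMap := by
        ext x y; rfl
      have e4 := h.map_comulHom b
      change TensorProduct.map B.val.toLinearMap B.val.toLinearMap (h.comulHom b) = _ at e4
      refine (LinearMap.congr_fun e1 (h.comulHom b)).trans ?_
      simp only [LinearMap.comp_apply, e4]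
      exact HopfAlgebra.mul_antipode_rTensor_comul_apply _
    mul_antipode_lTensor_comul := by
      ext b
      have e1 : B.val.toLinearMap ∘ₗ LinearMap.mul' K B ∘ₗ h.antipodeLin.lTensor B =
          LinearMap.mul' K H ∘ₗ (HopfAlgebra.antipode K).lTensor H ∘ₗ
            TensorProduct.map B.val.toLinearMap B.val.toLinearMap := by
        ext x y; rfl
      have e4 := h.map_comulHom b
      change TensorProduct.map B.val.toLinearMap B.val.toLinearMap (h.comulHom b) = _ at e4
      refine (LinearMap.congr_fun e1 (h.comulHom b)).trans ?_
      simp only [LinearMap.comp_apply, e4]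
      exact HopfAlgebra.mul_antipode_lTensor_comul_apply _ }

/-- Criterion on generators. -/
theorem of_adjoin (s : Set H)
    (h1 : ∀ x ∈ s, Coalgebra.comul (R := K) x ∈ (Algebra.TensorProduct.map
      (Algebra.adjoin K s).val (Algebra.adjoin K s).val).range)
    (h2 : ∀ x ∈ s, HopfAlgebra.antipode K x ∈ Algebra.adjoin K s) :
    IsHopfSubalgebra (Algebra.adjoin K s) where
  comul_mem b hb := by
    induction hb using Algebra.adjoin_induction with
    | mem x hx => exact h1 x hx
    | algebraMap c => rw [Bialgebra.comul_algebraMap]; exact Subalgebra.algebraMap_mem _ _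
    | add x y _ _ hx hy => rw [map_add]; exact add_mem hx hy
    | mul x y _ _ hx hy => rw [Bialgebra.comul_mul]; exact mul_mem hx hy
  antipode_mem b hb := by
    induction hb using Algebra.adjoin_induction with
    | mem x hx => exact h2 x hx
    | algebraMap c =>
      rw [Algebra.algebraMap_eq_smul_one, map_smul, HopfAlgebra.antipode_one]
      exact Subalgebra.smul_mem _ (one_mem _) _
    | add x y _ _ hx hy => rw [map_add]; exact add_mem hx hy
    | mul x y _ _ hx hy => rw [HopfAlgebra.antipode_mul_antidistrib]; exact mul_mem hy hx

end IsHopfSubalgebra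

end HopfSubalgebra

section DrinfeldDoubles

open TensorProduct Coalgebra HopfAlgebra

/-- A skew-dual pairing `B × A → K`, `(b, a) ↦ ⟨b, a⟩`, of Hopf algebras `A` and `B`:
`⟨b, 1⟩ = ε(b)`, `⟨1, a⟩ = ε(a)`, `⟨b, a₁ a₂⟩ = ⟨Δᵒᵖ b, a₁ ⊗ a₂⟩`, `⟨b₁ b₂, a⟩ = ⟨b₁ ⊗ b₂, Δ a⟩`,
where `⟨b₁ ⊗ b₂, a₁ ⊗ a₂⟩ = ⟨b₁, a₁⟩ ⟨b₂, a₂⟩`. -/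
structure SkewDualPairing (K A B : Type*) [Field K] [Ring A] [Ring B] [HopfAlgebra K A]
    [HopfAlgebra K B] where
  form : B →ₗ[K] A →ₗ[K] K
  form_one_right (b : B) : form b 1 = counit b
  form_one_left (a : A) : form 1 a = counit a
  form_mul_right (b : B) (a₁ a₂ : A) :
    form b (a₁ * a₂) =
      LinearMap.mul' K K (map₂ form form (TensorProduct.comm K B B (comul b)) (a₁ ⊗ₜ a₂))
  form_mul_left (b₁ b₂ : B) (a : A) :
    form (b₁ * b₂) a = LinearMap.mul' K K (map₂ form form (b₁ ⊗ₜ b₂) (comul a))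

section Double

set_option linter.unusedSimpArgs false

variable {K A B : Type*} [Field K] [Ring A] [Ring B] [HopfAlgebra K A] [HopfAlgebra K B]

/-- x ↦ x₁ ⊗ (x₂ ⊗ x₃). -/
noncomputable def comul₃ (K C : Type*) [Field K] [AddCommGroup C] [Module K C] [Coalgebra K C] :
    C →ₗ[K] C ⊗[K] (C ⊗[K] C) :=
  comul.lTensor C ∘ₗ comul

namespace SkewDualPairing

variable (p : SkewDualPairing K A B)

/-- (x ⊗ (y ⊗ z), u ⊗ (v ⊗ w)) ↦ ⟨S x, u⟩ ⟨z, w⟩ v ⊗ y. -/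
noncomputable def contract₃ : B ⊗[K] (B ⊗[K] B) →ₗ[K] A ⊗[K] (A ⊗[K] A) →ₗ[K] A ⊗[K] B :=
  (map₂ (p.form ∘ₗ antipode K) (map₂ (TensorProduct.mk K A B).flip p.form)).compr₂
    ((TensorProduct.lid K (A ⊗[K] B)).toLinearMap ∘ₗ
      (TensorProduct.rid K (A ⊗[K] B)).toLinearMap.lTensor K)

@[simp] theorem contract₃_tmul (x y z : B) (u v w : A) :
    p.contract₃ (x ⊗ₜ (y ⊗ₜ z)) (u ⊗ₜ (v ⊗ₜ w)) =
      (p.form (antipode K x) u * p.form z w) • (v ⊗ₜ y) := by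
  simp [contract₃, smul_smul, mul_comm]

/-- b ⊗ a ↦ Σ ⟨S b₁, a₁⟩ ⟨b₃, a₃⟩ a₂ ⊗ b₂. -/
noncomputable def cross : B ⊗[K] A →ₗ[K] A ⊗[K] B :=
  TensorProduct.lift (p.contract₃.compl₁₂ (comul₃ K B) (comul₃ K A))

/-- (a ⊗ b) ⊗ (a' ⊗ b') ↦ Σ ⟨S b₁, a'₁⟩ ⟨b₃, a'₃⟩ a a'₂ ⊗ b₂ b'. -/
noncomputable def mulLin : (A ⊗[K] B) ⊗[K] (A ⊗[K] B) →ₗ[K] A ⊗[K] B :=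
  TensorProduct.map (LinearMap.mul' K A) (LinearMap.mul' K B) ∘ₗ
    (TensorProduct.assoc K A A (B ⊗[K] B)).symm.toLinearMap ∘ₗ
    ((TensorProduct.assoc K A B B).toLinearMap ∘ₗ p.cross.rTensor B ∘ₗ
      (TensorProduct.assoc K B A B).symm.toLinearMap).lTensor A ∘ₗ
    (TensorProduct.assoc K A B (A ⊗[K] B)).toLinearMap

theorem mulLin_tmul (a a' : A) (b b' : B) :
    p.mulLin ((a ⊗ₜ b) ⊗ₜ (a' ⊗ₜ b')) =
      TensorProduct.map (LinearMap.mulLeft K a) (LinearMap.mulRight K b')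
        (p.contract₃ (comul₃ K B b) (comul₃ K A a')) := by
  have : p.contract₃ (comul₃ K B b) (comul₃ K A a') = p.cross (b ⊗ₜ a') := rfl
  rw [this]
  simp only [mulLin, LinearMap.comp_apply, LinearEquiv.coe_coe, assoc_tmul, LinearMap.lTensor_tmul,
    assoc_symm_tmul, LinearMap.rTensor_tmul]
  generalize p.cross (b ⊗ₜ a') = w
  hopf_tensor_induction w with x y
  simp

/-- a ↦ ⟨S b, a₁⟩ a₂. -/
noncomputable def lam : B →ₗ[K] A →ₗ[K] A :=
  LinearMap.mk₂ K (fun b a => TensorProduct.lid K A ((p.form (antipode K b)).rTensor A (comul a)))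
    (by intros; simp [LinearMap.rTensor_add]) (by intros; simp [LinearMap.rTensor_smul])
    (by intros; simp) (by intros; simp)

/-- a ↦ a₁ ⟨b, a₂⟩. -/
noncomputable def rho : B →ₗ[K] A →ₗ[K] A :=
  LinearMap.mk₂ K (fun b a => TensorProduct.rid K A ((p.form b).lTensor A (comul a)))
    (by intros; simp [LinearMap.lTensor_add]) (by intros; simp [LinearMap.lTensor_smul])
    (by intros; simp) (by intros; simp)

theorem lam_apply (b : B) (a : A) :
    p.lam b a = TensorProduct.lid K A ((p.form (antipode K b)).rTensor A (comul a)) := rfl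
theorem rho_apply (b : B) (a : A) :
    p.rho b a = TensorProduct.rid K A ((p.form b).lTensor A (comul a)) := rfl

theorem comul_rho (b : B) (a : A) : comul (R := K) (p.rho b a) = (p.rho b).lTensor A (comul a) := by
  have h := congr(TensorProduct.rid K (A ⊗[K] A) ((p.form b).lTensor (A ⊗[K] A)
    ((TensorProduct.assoc K A A A).symm $(coassoc_apply (R := K) a))))
  rw [LinearEquiv.symm_apply_apply] at h
  rw [rho_apply]
  refine Eq.trans ?_ (h.trans ?_)
  · generalize comul (R := K) a = T
    hopf_tensor_induction T with x y
    simp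
  · generalize comul (R := K) a = T
    hopf_tensor_induction T with x y
    simp only [LinearMap.lTensor_tmul, rho_apply]
    generalize comul (R := K) y = T1
    hopf_tensor_induction T1 with y z
    simp

theorem comul_lam (b : B) (a : A) : comul (R := K) (p.lam b a) = (p.lam b).rTensor A (comul a) := by
  have h := congr(TensorProduct.lid K (A ⊗[K] A) ((p.form (antipode K b)).rTensor (A ⊗[K] A)
    $(coassoc_apply (R := K) a)))
  rw [lam_apply]
  refine Eq.trans ?_ (h.symm.trans ?_)
  · generalize comul (R := K) a = T
    hopf_tensor_induction T with x y
    simp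
  · generalize comul (R := K) a = T
    hopf_tensor_induction T with x y
    simp only [LinearMap.rTensor_tmul, lam_apply]
    generalize comul (R := K) x = T2
    hopf_tensor_induction T2 with x z
    simp [TensorProduct.smul_tmul']

theorem contract₃_comul₃ (x y z : B) (a : A) :
    p.contract₃ (x ⊗ₜ (y ⊗ₜ z)) (comul₃ K A a) = p.lam x (p.rho z a) ⊗ₜ y := by
  rw [lam_apply, comul_rho, comul₃, LinearMap.comp_apply]
  generalize comul (R := K) a = T3
  hopf_tensor_induction T3 with u v
  simp only [LinearMap.lTensor_tmul, LinearMap.rTensor_tmul, rho_apply]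
  generalize comul (R := K) v = T4
  hopf_tensor_induction T4 with v w
  simp [mul_comm, TensorProduct.smul_tmul']

theorem lam_rho_comm (x z : B) (a : A) : p.lam x (p.rho z a) = p.rho z (p.lam x a) := by
  rw [rho_apply, rho_apply, comul_lam]
  generalize comul (R := K) a = T5
  hopf_tensor_induction T5 with u v
  simp

theorem lam_one (a : A) : p.lam 1 a = a := by
  rw [lam_apply, antipode_one]
  have : p.form 1 = counit := LinearMap.ext p.form_one_left
  rw [this, rTensor_counit_comul]
  simp

theorem rho_one (a : A) : p.rho 1 a = a := by
  rw [rho_apply]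
  have : p.form 1 = counit := LinearMap.ext p.form_one_left
  rw [this, lTensor_counit_comul]
  simp

theorem lam_map_one (b : B) : p.lam b 1 = counit (R := K) b • 1 := by
  simp [lam_apply, Algebra.TensorProduct.one_def, form_one_right]

theorem rho_map_one (b : B) : p.rho b 1 = counit (R := K) b • 1 := by
  simp [rho_apply, Algebra.TensorProduct.one_def, form_one_right]

theorem rho_mul_left (b b' : B) (a : A) : p.rho (b * b') a = p.rho b (p.rho b' a) := by
  rw [rho_apply p b, comul_rho, rho_apply]
  generalize comul (R := K) a = T6
  hopf_tensor_induction T6 with u v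
  simp only [LinearMap.lTensor_tmul, rid_tmul, p.form_mul_left, rho_apply]
  congr 1
  generalize comul (R := K) v = T7
  hopf_tensor_induction T7 with v w
  simp [mul_comm]

theorem lam_mul_left (b b' : B) (a : A) : p.lam (b * b') a = p.lam b (p.lam b' a) := by
  rw [lam_apply p b, comul_lam, lam_apply, antipode_mul_antidistrib]
  generalize comul (R := K) a = T8
  hopf_tensor_induction T8 with u v
  simp only [LinearMap.rTensor_tmul, lid_tmul, p.form_mul_left, lam_apply]
  congr 1
  generalize comul (R := K) u = T9
  hopf_tensor_induction T9 with v w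
  simp

theorem rho_mul_right (b : B) (a a' : A) :
    p.rho b (a * a') = LinearMap.mul' K A
      (map₂ p.rho p.rho (TensorProduct.comm K B B (comul b)) (a ⊗ₜ a')) := by
  let R : B →ₗ[K] A ⊗[K] A →ₗ[K] A :=
    LinearMap.mk₂ K (fun b T => TensorProduct.rid K A ((p.form b).lTensor A T))
      (by intros; simp [LinearMap.lTensor_add]) (by intros; simp [LinearMap.lTensor_smul])
      (by intros; simp) (by intros; simp)
  have key (T T' : A ⊗[K] A) : R b (T * T') =
      LinearMap.mul' K A (map₂ R R (TensorProduct.comm K B B (comul b)) (T ⊗ₜ T')) := by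
    hopf_tensor_induction T with u v
    hopf_tensor_induction T' with u' v'
    simp only [R, LinearMap.mk₂_apply, Algebra.TensorProduct.tmul_mul_tmul, LinearMap.lTensor_tmul,
      p.form_mul_right, rid_tmul]
    generalize comul (R := K) b = X
    induction X with
    | zero => simp
    | add _ _ h₁ h₂ =>
      simp only [map_add, LinearMap.add_apply, add_smul, h₁, h₂]
    | tmul x y => simp [smul_smul, mul_comm]
  rw [rho_apply, Bialgebra.comul_mul]
  refine (key _ _).trans ?_
  generalize comul (R := K) b = X
  induction X with
  | zero => simp
  | add _ _ h₁ h₂ => simp only [map_add, LinearMap.add_apply, h₁, h₂]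
  | tmul x y => rfl

theorem comul_antipode (b : B) : comul (R := K) (antipode K b) =
    TensorProduct.comm K B B (TensorProduct.map (antipode K) (antipode K) (comul b)) := by
  have h1 := LinearMap.comul_right_inv (R := K) (C := B)
  have h2 : WithConv.toConv ((TensorProduct.comm K B B).toLinearMap ∘ₗ
      TensorProduct.map (antipode K) (antipode K) ∘ₗ comul (R := K) (A := B)) *
        WithConv.toConv (comul (R := K) (A := B)) = 1 := by
    ext b
    rw [LinearMap.convMul_apply, LinearMap.convOne_apply]
    let F : B ⊗[K] ((B ⊗[K] B) ⊗[K] B) →ₗ[K] B ⊗[K] B :=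
      TensorProduct.map (LinearMap.mul' K B ∘ₗ (antipode K).rTensor B)
        (LinearMap.mul' K B ∘ₗ (antipode K).rTensor B) ∘ₗ
        (TensorProduct.leftComm K B (B ⊗[K] B) B).toLinearMap
    have e : (comul.rTensor B).lTensor B (comul₃ K B b) =
        ((TensorProduct.assoc K B B B).symm.toLinearMap.lTensor B)
          (TensorProduct.assoc K B B (B ⊗[K] B)
            (TensorProduct.map (comul (R := K)) comul (comul (R := K) b))) := by
      have : (comul.rTensor B).lTensor B ∘ₗ comul₃ K B =
          ((TensorProduct.assoc K B B B).symm.toLinearMap.lTensor B) ∘ₗ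
          (TensorProduct.assoc K B B (B ⊗[K] B)).toLinearMap ∘ₗ
            (TensorProduct.map (comul (R := K)) comul) ∘ₗ comul (R := K) := by
        simp only [comul₃, coassoc_simps]
      exact LinearMap.congr_fun this b
    have e' := congr(F $e)
    refine Eq.trans ?_ (e'.symm.trans ?_)
    · generalize comul (R := K) b = T
      hopf_tensor_induction T with x y
      simp only [map_tmul, LinearMap.comp_apply]
      generalize comul (R := K) x = T10
      hopf_tensor_induction T10 with x x'
      generalize comul (R := K) y = T11
      hopf_tensor_induction T11 with y y'
      simp [F]
    · have e2 := mul_antipode_rTensor_comul_apply (R := K) b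
      have e3 (x : B) (T : B ⊗[K] B) : F (x ⊗ₜ comul.rTensor B T) =
          1 ⊗ₜ (antipode K x * TensorProduct.lid K B (counit.rTensor B T)) := by
        hopf_tensor_induction T with u v
        have e4 := mul_antipode_rTensor_comul_apply (R := K) u
        have e5 (T' : B ⊗[K] B) : F (x ⊗ₜ (T' ⊗ₜ v)) =
            LinearMap.mul' K B ((antipode K).rTensor B T') ⊗ₜ (antipode K x * v) := by
          hopf_tensor_induction T' with u u'
          simp [F]
        rw [LinearMap.rTensor_tmul, e5, e4]
        simp [Algebra.algebraMap_eq_smul_one, TensorProduct.smul_tmul]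
      have e6 (T : B ⊗[K] B) : F ((comul.rTensor B).lTensor B (comul.lTensor B T)) =
          1 ⊗ₜ LinearMap.mul' K B ((antipode K).rTensor B T) := by
        hopf_tensor_induction T with x y
        rw [LinearMap.lTensor_tmul, LinearMap.lTensor_tmul, e3, rTensor_counit_comul]
        simp
      refine (e6 _).trans ?_
      rw [e2]
      simp [Algebra.algebraMap_eq_smul_one, Algebra.TensorProduct.one_def]
  have h3 := congr(WithConv.ofConv $(left_inv_eq_right_inv h2 h1) b)
  exact h3.symm

theorem lam_mul_right (b : B) (a a' : A) :
    p.lam b (a * a') = LinearMap.mul' K A (map₂ p.lam p.lam (comul b) (a ⊗ₜ a')) := by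
  let R : B →ₗ[K] A ⊗[K] A →ₗ[K] A :=
    LinearMap.mk₂ K (fun b T => TensorProduct.lid K A ((p.form (antipode K b)).rTensor A T))
      (by intros; simp [LinearMap.rTensor_add]) (by intros; simp [LinearMap.rTensor_smul])
      (by intros; simp) (by intros; simp)
  have key (T T' : A ⊗[K] A) : R b (T * T') =
      LinearMap.mul' K A (map₂ R R (comul b) (T ⊗ₜ T')) := by
    hopf_tensor_induction T with u v
    hopf_tensor_induction T' with u' v'
    simp only [R, LinearMap.mk₂_apply, Algebra.TensorProduct.tmul_mul_tmul, LinearMap.rTensor_tmul,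
      p.form_mul_right, lid_tmul, comul_antipode]
    generalize comul (R := K) b = X
    induction X with
    | zero => simp
    | add _ _ h₁ h₂ =>
      simp only [map_add, LinearMap.add_apply, add_smul, h₁, h₂]
    | tmul x y => simp [smul_smul, mul_comm]
  rw [lam_apply, Bialgebra.comul_mul]
  refine (key _ _).trans ?_
  generalize comul (R := K) b = X
  induction X with
  | zero => simp
  | add _ _ h₁ h₂ => simp only [map_add, LinearMap.add_apply, h₁, h₂]
  | tmul x y => rfl

end SkewDualPairing

end Double

section Double2

set_option linter.unusedSimpArgs false

variable {K A B : Type*} [Field K] [Ring A] [Ring B] [HopfAlgebra K A] [HopfAlgebra K B]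

namespace SkewDualPairing

variable (p : SkewDualPairing K A B)

theorem comul₃_mul (b b' : B) : comul₃ K B (b * b') = comul₃ K B b * comul₃ K B b' := by
  simp only [comul₃, LinearMap.comp_apply, Bialgebra.comul_mul]
  generalize comul (R := K) b = X
  generalize comul (R := K) b' = Y
  hopf_tensor_induction X with x y
  hopf_tensor_induction Y with x' y'
  simp

theorem comul₃_one : comul₃ K B 1 = 1 := by
  simp [comul₃, Algebra.TensorProduct.one_def]

/-- `Σ ⟨S b₁, a₁⟩ ⟨b₃, a₃⟩ a₂ ⊗ b₂`. -/
noncomputable def tw (b : B) (a : A) : A ⊗[K] B := p.contract₃ (comul₃ K B b) (comul₃ K A a)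

/-- `x ⊗ y ↦ a x ⊗ y b`. -/
noncomputable def LR (a : A) (b : B) : A ⊗[K] B →ₗ[K] A ⊗[K] B :=
  TensorProduct.map (LinearMap.mulLeft K a) (LinearMap.mulRight K b)

/-- The multiplication of the double as a bilinear map. -/
noncomputable def mul : A ⊗[K] B →ₗ[K] A ⊗[K] B →ₗ[K] A ⊗[K] B := TensorProduct.curry p.mulLin

theorem mul_tmul (a a' : A) (b b' : B) :
    p.mul (a ⊗ₜ b) (a' ⊗ₜ b') = LR a b' (p.tw b a') := p.mulLin_tmul a a' b b'

@[simp] theorem LR_tmul (a a' : A) (b b' : B) :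
    LR (K := K) a b (a' ⊗ₜ b') = (a * a') ⊗ₜ (b' * b) := by simp [LR]

theorem LR_LR (a a' : A) (b b' : B) (W : A ⊗[K] B) :
    LR a b (LR a' b' W) = LR (a * a') (b' * b) W := by
  hopf_tensor_induction W with x y
  simp [mul_assoc]

theorem LR_one (W : A ⊗[K] B) : LR 1 1 W = W := by
  hopf_tensor_induction W with x y
  simp

theorem tw_one_left (a : A) : p.tw 1 a = a ⊗ₜ 1 := by
  rw [tw, comul₃_one, Algebra.TensorProduct.one_def, Algebra.TensorProduct.one_def,
    contract₃_comul₃, rho_one, lam_one]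

theorem tw_one_right (b : B) : p.tw b 1 = 1 ⊗ₜ b := by
  have (T : B ⊗[K] (B ⊗[K] B)) : p.contract₃ T (comul₃ K A 1) =
      1 ⊗ₜ (TensorProduct.lid K B (counit.rTensor B ((TensorProduct.rid K B).toLinearMap.lTensor B
        ((counit.lTensor B).lTensor B T)))) := by
    refine TensorProduct.induction_on T
      (by simp [LinearMap.map_zero, LinearEquiv.map_zero]) (fun x y => ?_)
      (fun _ _ h₁ h₂ => by
        simp only [map_add, LinearMap.map_add, LinearEquiv.map_add, LinearMap.add_apply,
          mul_add, add_mul, TensorProduct.tmul_add, TensorProduct.add_tmul, h₁, h₂])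
    refine TensorProduct.induction_on y
      (by simp [LinearMap.map_zero, LinearEquiv.map_zero]) (fun y z => ?_)
      (fun _ _ h₁ h₂ => by
        simp only [map_add, LinearMap.map_add, LinearEquiv.map_add, LinearMap.add_apply,
          mul_add, add_mul, TensorProduct.tmul_add, TensorProduct.add_tmul, h₁, h₂])
    rw [contract₃_comul₃, rho_map_one, map_smul, lam_map_one]
    simp [smul_smul, mul_comm, TensorProduct.smul_tmul]
  rw [tw, this, comul₃, LinearMap.comp_apply, ← LinearMap.lTensor_comp_apply _ _ comul,
    lTensor_counit_comp_comul]
  have h (T : B ⊗[K] B) : TensorProduct.lid K B (counit.rTensor B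
      ((TensorProduct.rid K B).toLinearMap.lTensor B
        (((TensorProduct.mk K B K).flip 1).lTensor B T))) =
        TensorProduct.lid K B (counit.rTensor B T) := by
    hopf_tensor_induction T with x y
    simp
  rw [h, rTensor_counit_comul]
  simp

theorem mul_LR_left (a : A) (W W' : A ⊗[K] B) : p.mul (LR a 1 W) W' = LR a 1 (p.mul W W') := by
  refine TensorProduct.induction_on W
    (by simp [LinearMap.map_zero, LinearEquiv.map_zero]) (fun c y => ?_)
    (fun _ _ h₁ h₂ => by
      simp only [map_add, LinearMap.map_add, LinearEquiv.map_add, LinearMap.add_apply,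
        mul_add, add_mul, TensorProduct.tmul_add, TensorProduct.add_tmul, h₁, h₂])
  hopf_tensor_induction W' with c' y'
  simp [mul_tmul, LR_LR]

theorem mul_LR_right (b : B) (W W' : A ⊗[K] B) : p.mul W (LR 1 b W') = LR 1 b (p.mul W W') := by
  refine TensorProduct.induction_on W
    (by simp [LinearMap.map_zero, LinearEquiv.map_zero]) (fun c y => ?_)
    (fun _ _ h₁ h₂ => by
      simp only [map_add, LinearMap.map_add, LinearEquiv.map_add, LinearMap.add_apply,
        mul_add, add_mul, TensorProduct.tmul_add, TensorProduct.add_tmul, h₁, h₂])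
  hopf_tensor_induction W' with c' y'
  simp [mul_tmul, LR_LR]

theorem tw_mul_left (b b' : B) (a : A) : p.tw (b * b') a = p.mul (1 ⊗ₜ b) (p.tw b' a) := by
  rw [tw, comul₃_mul, tw]
  have key (X' : B ⊗[K] (B ⊗[K] B)) : p.contract₃ (comul₃ K B b * X') (comul₃ K A a) =
      p.mul (1 ⊗ₜ b) (p.contract₃ X' (comul₃ K A a)) := by
    refine TensorProduct.induction_on X'
      (by simp [LinearMap.map_zero, LinearEquiv.map_zero]) (fun x' y' => ?_)
      (fun _ _ h₁ h₂ => by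
        simp only [map_add, LinearMap.map_add, LinearEquiv.map_add, LinearMap.add_apply,
          mul_add, add_mul, TensorProduct.tmul_add, TensorProduct.add_tmul, h₁, h₂])
    refine TensorProduct.induction_on y'
      (by simp [LinearMap.map_zero, LinearEquiv.map_zero]) (fun y' z' => ?_)
      (fun _ _ h₁ h₂ => by
        simp only [map_add, LinearMap.map_add, LinearEquiv.map_add, LinearMap.add_apply,
          mul_add, add_mul, TensorProduct.tmul_add, TensorProduct.add_tmul, h₁, h₂])
    rw [contract₃_comul₃, mul_tmul, tw]
    generalize comul₃ K B b = X
    induction X with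
    | zero => simp
    | add _ _ h₁ h₂ => simp only [map_add, LinearMap.add_apply, add_mul, h₁, h₂]
    | tmul x y =>
      induction y with
      | zero => simp
      | add _ _ h₁ h₂ =>
        simp only [map_add, LinearMap.add_apply, add_mul, TensorProduct.tmul_add, h₁, h₂]
      | tmul y z =>
        rw [contract₃_comul₃, Algebra.TensorProduct.tmul_mul_tmul,
          Algebra.TensorProduct.tmul_mul_tmul, contract₃_comul₃, lam_mul_left, rho_mul_left,
          LR_tmul, one_mul, p.lam_rho_comm x' z]
  exact key _

end SkewDualPairing

end Double2

section Double3

set_option linter.unusedSimpArgs false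

variable {K A B : Type*} [Field K] [Ring A] [Ring B] [HopfAlgebra K A] [HopfAlgebra K B]

namespace SkewDualPairing

variable (p : SkewDualPairing K A B)

/-- (x, z) ↦ lam x (rho z a). -/
noncomputable def lamRho (a : A) : B →ₗ[K] B →ₗ[K] A := p.lam.compl₂ (p.rho.flip a)

theorem lamRho_apply (a : A) (x z : B) : p.lamRho a x z = p.lam x (p.rho z a) := rfl

/-- `(x ⊗ x') ⊗ (z ⊗ z') ↦ lam x (rho z' a) * lam x' (rho z a')`. -/
noncomputable def lamRho₂ (a a' : A) : (B ⊗[K] B) ⊗[K] (B ⊗[K] B) →ₗ[K] A :=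
  TensorProduct.lift (((map₂ (p.lamRho a) (p.lamRho a')).compl₂
    (TensorProduct.comm K B B).toLinearMap).compr₂ (LinearMap.mul' K A))

/-- `lamRho₂` with a further argument from `B` that is carried along. -/
noncomputable def lamRho₃ (a a' : A) : (B ⊗[K] B) ⊗[K] (B ⊗[K] (B ⊗[K] B)) →ₗ[K] A ⊗[K] B :=
  (TensorProduct.comm K B A).toLinearMap ∘ₗ (p.lamRho₂ a a').lTensor B ∘ₗ
    (TensorProduct.leftComm K (B ⊗[K] B) B (B ⊗[K] B)).toLinearMap

theorem lamRho₃_tmul (a a' : A) (x x' y z z' : B) :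
    p.lamRho₃ a a' ((x ⊗ₜ x') ⊗ₜ (y ⊗ₜ (z ⊗ₜ z'))) =
      (p.lam x (p.rho z' a) * p.lam x' (p.rho z a')) ⊗ₜ y := by
  simp [lamRho₃, lamRho₂, lamRho_apply]

theorem lam_rho_mul (x z : B) (a a' : A) : p.lam x (p.rho z (a * a')) =
    p.lamRho₂ a a' (comul x ⊗ₜ comul z) := by
  rw [rho_mul_right]
  generalize comul (R := K) z = Z
  refine TensorProduct.induction_on Z
    (by simp [LinearMap.map_zero, LinearEquiv.map_zero]) (fun z z' => ?_)
    (fun _ _ h₁ h₂ => by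
      simp only [map_add, LinearMap.map_add, LinearEquiv.map_add, LinearMap.add_apply,
        mul_add, add_mul, TensorProduct.tmul_add, TensorProduct.add_tmul, h₁, h₂])
  rw [comm_tmul, map₂_apply_tmul, map_tmul, LinearMap.mul'_apply, lam_mul_right]
  generalize comul (R := K) x = X
  refine TensorProduct.induction_on X
    (by simp [LinearMap.map_zero, LinearEquiv.map_zero]) (fun x x' => ?_)
    (fun _ _ h₁ h₂ => by
      simp only [map_add, LinearMap.map_add, LinearEquiv.map_add, LinearMap.add_apply,
        mul_add, add_mul, TensorProduct.tmul_add, TensorProduct.add_tmul, h₁, h₂])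
  simp [lamRho₂, lamRho_apply]

theorem coassoc_five (C : Type*) [AddCommGroup C] [Module K C] [Coalgebra K C] :
    (TensorProduct.assoc K C C (C ⊗[K] (C ⊗[K] C))).symm.toLinearMap ∘ₗ
      ((TensorProduct.assoc K C C C).toLinearMap.lTensor C ∘ₗ
        (TensorProduct.assoc K C (C ⊗[K] C) C).toLinearMap).lTensor C ∘ₗ
      ((comul₃ K C).rTensor C).lTensor C ∘ₗ comul₃ K C =
    TensorProduct.map comul (comul.lTensor C) ∘ₗ comul₃ K C := by
  simp only [comul₃, coassoc_simps]

/-- Right multiplication by `a'` after the exchange. -/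
theorem tw_mul_right (b : B) (a a' : A) : p.tw b (a * a') = p.mul (p.tw b a) (a' ⊗ₜ 1) := by
  have h1 (X : B ⊗[K] (B ⊗[K] B)) : p.contract₃ X (comul₃ K A (a * a')) =
      p.lamRho₃ a a' (TensorProduct.map comul (comul.lTensor B) X) := by
    refine TensorProduct.induction_on X
      (by simp [LinearMap.map_zero, LinearEquiv.map_zero]) (fun x y => ?_)
      (fun _ _ h₁ h₂ => by
        simp only [map_add, LinearMap.map_add, LinearEquiv.map_add, LinearMap.add_apply,
          mul_add, add_mul, TensorProduct.tmul_add, TensorProduct.add_tmul, h₁, h₂])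
    refine TensorProduct.induction_on y
      (by simp [LinearMap.map_zero, LinearEquiv.map_zero]) (fun y z => ?_)
      (fun _ _ h₁ h₂ => by
        simp only [map_add, LinearMap.map_add, LinearEquiv.map_add, LinearMap.add_apply,
          mul_add, add_mul, TensorProduct.tmul_add, TensorProduct.add_tmul, h₁, h₂])
    rw [contract₃_comul₃, lam_rho_mul, map_tmul, LinearMap.lTensor_tmul]
    simp [lamRho₃]
  have h2 (X : B ⊗[K] (B ⊗[K] B)) : p.mul (p.contract₃ X (comul₃ K A a)) (a' ⊗ₜ 1) =
      p.lamRho₃ a a' ((TensorProduct.assoc K B B (B ⊗[K] (B ⊗[K] B))).symm.toLinearMap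
        (((TensorProduct.assoc K B B B).toLinearMap.lTensor B ∘ₗ
        (TensorProduct.assoc K B (B ⊗[K] B) B).toLinearMap).lTensor B
          (((comul₃ K B).rTensor B).lTensor B X))) := by
    refine TensorProduct.induction_on X
      (by simp [LinearMap.map_zero, LinearEquiv.map_zero]) (fun x y => ?_)
      (fun _ _ h₁ h₂ => by
        simp only [map_add, LinearMap.map_add, LinearEquiv.map_add, LinearMap.add_apply,
          mul_add, add_mul, TensorProduct.tmul_add, TensorProduct.add_tmul, h₁, h₂])
    refine TensorProduct.induction_on y
      (by simp [LinearMap.map_zero, LinearEquiv.map_zero]) (fun y z => ?_)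
      (fun _ _ h₁ h₂ => by
        simp only [map_add, LinearMap.map_add, LinearEquiv.map_add, LinearMap.add_apply,
          mul_add, add_mul, TensorProduct.tmul_add, TensorProduct.add_tmul, h₁, h₂])
    rw [contract₃_comul₃, mul_tmul, tw]
    simp only [LinearMap.lTensor_tmul, LinearMap.rTensor_tmul]
    generalize comul₃ K B y = Y
    refine TensorProduct.induction_on Y
      (by simp [LinearMap.map_zero, LinearEquiv.map_zero]) (fun u v => ?_)
      (fun _ _ h₁ h₂ => by
        simp only [map_add, LinearMap.map_add, LinearEquiv.map_add, LinearMap.add_apply,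
          mul_add, add_mul, TensorProduct.tmul_add, TensorProduct.add_tmul, h₁, h₂])
    refine TensorProduct.induction_on v
      (by simp [LinearMap.map_zero, LinearEquiv.map_zero]) (fun v w => ?_)
      (fun _ _ h₁ h₂ => by
        simp only [map_add, LinearMap.map_add, LinearEquiv.map_add, LinearMap.add_apply,
          mul_add, add_mul, TensorProduct.tmul_add, TensorProduct.add_tmul, h₁, h₂])
    rw [contract₃_comul₃]
    simp [lamRho₃_tmul]
  rw [tw, tw, h1, h2]
  exact congrArg _ (LinearMap.congr_fun (coassoc_five B) b).symm

theorem mul_assoc' (X Y Z : A ⊗[K] B) : p.mul (p.mul X Y) Z = p.mul X (p.mul Y Z) := by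
  refine TensorProduct.induction_on X
    (by simp [LinearMap.map_zero, LinearEquiv.map_zero]) (fun a b => ?_)
    (fun _ _ h₁ h₂ => by
      simp only [map_add, LinearMap.map_add, LinearEquiv.map_add, LinearMap.add_apply,
        mul_add, add_mul, TensorProduct.tmul_add, TensorProduct.add_tmul, h₁, h₂])
  refine TensorProduct.induction_on Y
    (by simp [LinearMap.map_zero, LinearEquiv.map_zero]) (fun a' b' => ?_)
    (fun _ _ h₁ h₂ => by
      simp only [map_add, LinearMap.map_add, LinearEquiv.map_add, LinearMap.add_apply,
        mul_add, add_mul, TensorProduct.tmul_add, TensorProduct.add_tmul, h₁, h₂])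
  hopf_tensor_induction Z with a'' b''
  have h1 (W : A ⊗[K] B) : p.mul (LR a b' W) (a'' ⊗ₜ b'') =
      LR a b'' (p.mul W (p.tw b' a'')) := by
    refine TensorProduct.induction_on W
      (by simp [LinearMap.map_zero, LinearEquiv.map_zero]) (fun c y => ?_)
      (fun _ _ h₁ h₂ => by
        simp only [map_add, LinearMap.map_add, LinearEquiv.map_add, LinearMap.add_apply,
          mul_add, add_mul, TensorProduct.tmul_add, TensorProduct.add_tmul, h₁, h₂])
    rw [LR_tmul, mul_tmul, tw_mul_left]
    have : c ⊗ₜ[K] y = LR c 1 (1 ⊗ₜ[K] y) := by simp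
    rw [this, mul_LR_left, LR_LR, one_mul]
  have h2 (W : A ⊗[K] B) : p.mul (a ⊗ₜ b) (LR a' b'' W) =
      LR a b'' (p.mul (p.tw b a') W) := by
    hopf_tensor_induction W with c y
    rw [LR_tmul, mul_tmul, tw_mul_right]
    have : c ⊗ₜ[K] y = LR 1 y (c ⊗ₜ[K] 1) := by simp
    rw [this, mul_LR_right, LR_LR, mul_one]
  rw [mul_tmul, mul_tmul, h1, h2]

theorem one_mul' (X : A ⊗[K] B) : p.mul (1 ⊗ₜ 1) X = X := by
  hopf_tensor_induction X with a b
  rw [mul_tmul, tw_one_left, LR_tmul, one_mul, one_mul]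

theorem mul_one' (X : A ⊗[K] B) : p.mul X (1 ⊗ₜ 1) = X := by
  refine TensorProduct.induction_on X
    (by simp [LinearMap.map_zero, LinearEquiv.map_zero]) (fun a b => ?_)
    (fun _ _ h₁ h₂ => by
      simp only [map_add, LinearMap.map_add, LinearEquiv.map_add, LinearMap.add_apply,
        mul_add, add_mul, TensorProduct.tmul_add, TensorProduct.add_tmul, h₁, h₂])
  rw [mul_tmul, tw_one_right, LR_tmul, mul_one, mul_one]


end SkewDualPairing

end Double3

section Double4

set_option linter.unusedSimpArgs false

variable {K A B : Type*} [Field K] [Ring A] [Ring B] [HopfAlgebra K A] [HopfAlgebra K B]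

namespace SkewDualPairing

variable (p : SkewDualPairing K A B)

/-- a ↦ ⟨b, a₁⟩ a₂. -/
noncomputable def lam₀ : B →ₗ[K] A →ₗ[K] A :=
  LinearMap.mk₂ K (fun b a => TensorProduct.lid K A ((p.form b).rTensor A (comul a)))
    (by intros; simp [LinearMap.rTensor_add]) (by intros; simp [LinearMap.rTensor_smul])
    (by intros; simp) (by intros; simp)

theorem lam₀_apply (b : B) (a : A) :
    p.lam₀ b a = TensorProduct.lid K A ((p.form b).rTensor A (comul a)) := rfl

theorem lam_eq_lam₀ (b : B) (a : A) : p.lam b a = p.lam₀ (antipode K b) a := rfl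

theorem comul_lam₀ (b : B) (a : A) :
    comul (R := K) (p.lam₀ b a) = (p.lam₀ b).rTensor A (comul a) := by
  have h := congr(TensorProduct.lid K (A ⊗[K] A) ((p.form b).rTensor (A ⊗[K] A)
    $(coassoc_apply (R := K) a)))
  rw [lam₀_apply]
  refine Eq.trans ?_ (h.symm.trans ?_)
  · generalize comul (R := K) a = T
    hopf_tensor_induction T with x y
    simp
  · generalize comul (R := K) a = T
    hopf_tensor_induction T with x y
    simp only [LinearMap.rTensor_tmul, lam₀_apply]
    generalize comul (R := K) x = S
    hopf_tensor_induction S with x z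
    simp [TensorProduct.smul_tmul']

theorem lam₀_one (a : A) : p.lam₀ 1 a = a := by
  rw [lam₀_apply]
  have : p.form 1 = counit := LinearMap.ext p.form_one_left
  rw [this, rTensor_counit_comul]
  simp

theorem lam₀_mul_left (b b' : B) (a : A) : p.lam₀ (b * b') a = p.lam₀ b' (p.lam₀ b a) := by
  rw [lam₀_apply p b', comul_lam₀, lam₀_apply]
  generalize comul (R := K) a = T
  hopf_tensor_induction T with u v
  simp only [LinearMap.rTensor_tmul, lid_tmul, p.form_mul_left, lam₀_apply]
  congr 1
  generalize comul (R := K) u = S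
  hopf_tensor_induction S with v w
  simp

theorem rho_rTensor_comul (b : B) (a : A) :
    (p.rho b).rTensor A (comul (R := K) a) = (p.lam₀ b).lTensor A (comul (R := K) a) := by
  have h := congr((TensorProduct.lid K A).toLinearMap.lTensor A
    (((p.form b).rTensor A).lTensor A $(coassoc_apply (R := K) a)))
  refine Eq.trans ?_ (h.trans ?_)
  · generalize comul (R := K) a = T
    hopf_tensor_induction T with x y
    simp only [LinearMap.rTensor_tmul, rho_apply]
    generalize comul (R := K) x = S
    hopf_tensor_induction S with x z
    simp [TensorProduct.smul_tmul]
  · generalize comul (R := K) a = T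
    hopf_tensor_induction T with x y
    simp [lam₀_apply]

theorem rho_lam_cancel (b : B) (a : A) :
    map₂ p.rho p.lam (comul b) (comul a) = counit (R := K) b • comul (R := K) a := by
  have h1 (X : B ⊗[K] B) : map₂ p.rho p.lam X (comul a) =
      (p.lam₀ (LinearMap.mul' K B ((antipode K).lTensor B X))).lTensor A (comul a) := by
    refine TensorProduct.induction_on X (by simp) (fun x y => ?_) (fun _ _ h₁ h₂ => by
      simp only [map_add, LinearMap.add_apply, LinearMap.lTensor_add, h₁, h₂])
    have : map₂ p.rho p.lam (x ⊗ₜ y) (comul (R := K) a) =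
      (p.lam y).lTensor A ((p.rho x).rTensor A (comul a)) := by
      generalize comul (R := K) a = T
      hopf_tensor_induction T with u v
      rfl
    rw [this, rho_rTensor_comul, ← LinearMap.lTensor_comp_apply]
    congr 2
    ext c
    simp [lam_eq_lam₀, lam₀_mul_left]
  rw [h1, mul_antipode_lTensor_comul_apply, Algebra.algebraMap_eq_smul_one, map_smul]
  have : p.lam₀ 1 = LinearMap.id := LinearMap.ext p.lam₀_one
  rw [this]
  simp

/-- An auxiliary map with six arguments from `B`, linear in their tensor product. -/
noncomputable def pairL (T : A ⊗[K] A) :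
    ((B ⊗[K] B) ⊗[K] (B ⊗[K] B)) ⊗[K] (B ⊗[K] B) →ₗ[K] (A ⊗[K] B) ⊗[K] (A ⊗[K] B) :=
  (TensorProduct.tensorTensorTensorComm K A A B B).toLinearMap ∘ₗ
    (TensorProduct.lift ((map₂ p.lam p.rho).compl₂ ((map₂ p.rho p.lam).flip T))).rTensor (B ⊗[K] B)

theorem pairL_tmul (T : A ⊗[K] A) (P Z Y : B ⊗[K] B) : p.pairL T ((P ⊗ₜ Z) ⊗ₜ Y) =
    TensorProduct.tensorTensorTensorComm K A A B B
      (map₂ p.lam p.rho P (map₂ p.rho p.lam Z T) ⊗ₜ Y) := by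
  simp [pairL]

theorem pairL_zero : p.pairL 0 = 0 := by
  refine LinearMap.ext fun W => ?_
  hopf_tensor_induction W with V Y
  hopf_tensor_induction V with P Z
  simp [pairL_tmul]

theorem pairL_add (T T' : A ⊗[K] A) : p.pairL (T + T') = p.pairL T + p.pairL T' := by
  refine LinearMap.ext fun W => ?_
  rw [LinearMap.add_apply]
  refine TensorProduct.induction_on W (by simp) (fun V Y => ?_) (fun _ _ h₁ h₂ => by
    simp only [map_add, h₁, h₂]; abel)
  refine TensorProduct.induction_on V (by simp) (fun P Z => ?_) (fun _ _ h₁ h₂ => by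
    simp only [map_add, TensorProduct.add_tmul, h₁, h₂]; abel)
  simp [pairL_tmul, TensorProduct.add_tmul]

/-- x ⊗ ((y ⊗ (Z ⊗ y')) ⊗ z') ↦ ((x ⊗ z') ⊗ Z) ⊗ (y ⊗ y'). -/
noncomputable def shuffle (K C D : Type*) [Field K] [AddCommGroup C] [Module K C]
    [AddCommGroup D] [Module K D] :
    C ⊗[K] ((C ⊗[K] (D ⊗[K] C)) ⊗[K] C) →ₗ[K] ((C ⊗[K] C) ⊗[K] D) ⊗[K] (C ⊗[K] C) :=
  (TensorProduct.assoc K (C ⊗[K] C) D (C ⊗[K] C)).symm.toLinearMap ∘ₗ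
    (TensorProduct.leftComm K C D C).toLinearMap.lTensor (C ⊗[K] C) ∘ₗ
    (TensorProduct.assoc K C C (C ⊗[K] (D ⊗[K] C))).symm.toLinearMap ∘ₗ
    (TensorProduct.comm K (C ⊗[K] (D ⊗[K] C)) C).toLinearMap.lTensor C

@[simp] theorem shuffle_tmul (C D : Type*) [AddCommGroup C] [Module K C]
    [AddCommGroup D] [Module K D] (x y y' z' : C) (Z : D) :
    shuffle K C D (x ⊗ₜ ((y ⊗ₜ (Z ⊗ₜ y')) ⊗ₜ z')) = ((x ⊗ₜ z') ⊗ₜ Z) ⊗ₜ (y ⊗ₜ y') := by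
  simp [shuffle]

/-- (x ⊗ (y ⊗ z)) ⊗ (x' ⊗ (y' ⊗ z')) ↦ x ⊗ ((y ⊗ ((z ⊗ x') ⊗ y')) ⊗ z'). -/
noncomputable def reassoc (K C : Type*) [Field K] [AddCommGroup C] [Module K C] :
    (C ⊗[K] (C ⊗[K] C)) ⊗[K] (C ⊗[K] (C ⊗[K] C)) →ₗ[K]
      C ⊗[K] ((C ⊗[K] ((C ⊗[K] C) ⊗[K] C)) ⊗[K] C) :=
  ((TensorProduct.assoc K C ((C ⊗[K] C) ⊗[K] C) C).symm.toLinearMap ∘ₗ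
    ((TensorProduct.assoc K (C ⊗[K] C) C C).symm.toLinearMap ∘ₗ
      (TensorProduct.assoc K C C (C ⊗[K] C)).symm.toLinearMap).lTensor C ∘ₗ
    (TensorProduct.assoc K C C (C ⊗[K] (C ⊗[K] C))).toLinearMap).lTensor C ∘ₗ
  (TensorProduct.assoc K C (C ⊗[K] C) (C ⊗[K] (C ⊗[K] C))).toLinearMap

theorem reassoc_tmul (C : Type*) [AddCommGroup C] [Module K C] (x y z x' y' z' : C) :
    reassoc K C ((x ⊗ₜ (y ⊗ₜ z)) ⊗ₜ (x' ⊗ₜ (y' ⊗ₜ z'))) =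
      x ⊗ₜ ((y ⊗ₜ ((z ⊗ₜ x') ⊗ₜ y')) ⊗ₜ z') := by
  simp [reassoc]

theorem coassoc_six (C : Type*) [AddCommGroup C] [Module K C] [Coalgebra K C] :
    reassoc K C ∘ₗ TensorProduct.map (comul₃ K C) (comul₃ K C) ∘ₗ comul =
      (((comul.rTensor C).lTensor C ∘ₗ comul₃ K C).rTensor C).lTensor C ∘ₗ comul₃ K C := by
  simp only [comul₃, reassoc, coassoc_simps]

/-- `tw` as a bilinear map. -/
noncomputable def twL : B →ₗ[K] A →ₗ[K] A ⊗[K] B :=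
  p.contract₃.compl₁₂ (comul₃ K B) (comul₃ K A)

theorem comul_tw (b : B) (a : A) :
    comul (R := K) (p.tw b a) = map₂ p.twL p.twL (comul b) (comul a) := by
  have h1 (X : B ⊗[K] (B ⊗[K] B)) : comul (R := K) (p.contract₃ X (comul₃ K A a)) =
      p.pairL (comul a) (shuffle K B (B ⊗[K] B)
        ((((comul.rTensor B).lTensor B ∘ₗ comul₃ K B).rTensor B).lTensor B X)) := by
    refine TensorProduct.induction_on X
      (by simp [LinearMap.map_zero, LinearEquiv.map_zero]) (fun x y => ?_)
      (fun _ _ h₁ h₂ => by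
        simp only [map_add, LinearMap.map_add, LinearEquiv.map_add, LinearMap.add_apply,
          mul_add, add_mul, TensorProduct.tmul_add, TensorProduct.add_tmul, h₁, h₂])
    refine TensorProduct.induction_on y
      (by simp [LinearMap.map_zero, LinearEquiv.map_zero]) (fun y z => ?_)
      (fun _ _ h₁ h₂ => by
        simp only [map_add, LinearMap.map_add, LinearEquiv.map_add, LinearMap.add_apply,
          mul_add, add_mul, TensorProduct.tmul_add, TensorProduct.add_tmul, h₁, h₂])
    have h3 (Y : B ⊗[K] (B ⊗[K] B)) : p.pairL (comul a) (shuffle K B (B ⊗[K] B)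
        (x ⊗ₜ ((((comul.rTensor B).lTensor B) Y) ⊗ₜ z))) =
        TensorProduct.tensorTensorTensorComm K A A B B
          (map (p.lam x) (p.rho z) (comul a) ⊗ₜ
            ((TensorProduct.lid K B).toLinearMap.lTensor B ((counit.rTensor B).lTensor B Y))) := by
      hopf_tensor_induction Y with u v
      hopf_tensor_induction v with v w
      simp only [LinearMap.lTensor_tmul, LinearMap.rTensor_tmul, shuffle_tmul, pairL_tmul,
        rho_lam_cancel, map_smul, map₂_apply_tmul]
      simp [TensorProduct.smul_tmul]
    rw [contract₃_comul₃, LinearMap.lTensor_tmul, LinearMap.rTensor_tmul, LinearMap.comp_apply, h3,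
      comul₃, LinearMap.comp_apply, ← LinearMap.lTensor_comp_apply _ _ comul,
      rTensor_counit_comp_comul]
    have h4 (Y : B ⊗[K] B) : (TensorProduct.lid K B).toLinearMap.lTensor B
        ((TensorProduct.mk K K B 1).lTensor B Y) = Y := by
      hopf_tensor_induction Y with u v
      simp
    rw [h4, TensorProduct.comul_tmul, comul_lam, comul_rho]
    congr 2
    generalize comul (R := K) a = T
    hopf_tensor_induction T with u v
    simp
  have h2 (X : B ⊗[K] B) : map₂ p.twL p.twL X (comul a) =
      p.pairL (comul a) (shuffle K B (B ⊗[K] B) (reassoc K B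
        (TensorProduct.map (comul₃ K B) (comul₃ K B) X))) := by
    refine TensorProduct.induction_on X
      (by simp [LinearMap.map_zero, LinearEquiv.map_zero]) (fun b₁ b₂ => ?_)
      (fun _ _ h₁ h₂ => by
        simp only [map_add, LinearMap.map_add, LinearEquiv.map_add, LinearMap.add_apply,
          mul_add, add_mul, TensorProduct.tmul_add, TensorProduct.add_tmul, h₁, h₂])
    generalize comul (R := K) a = T
    refine TensorProduct.induction_on T (by simp [pairL_zero]) (fun u v => ?_)
      (fun _ _ h₁ h₂ => by rw [map_add, h₁, h₂, pairL_add, LinearMap.add_apply])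
    rw [map₂_apply_tmul, map_tmul, map_tmul, twL, LinearMap.compl₁₂_apply, LinearMap.compl₁₂_apply]
    generalize comul₃ K B b₁ = X
    generalize comul₃ K B b₂ = Y
    refine TensorProduct.induction_on X
      (by simp [LinearMap.map_zero, LinearEquiv.map_zero]) (fun x y => ?_)
      (fun _ _ h₁ h₂ => by
        simp only [map_add, LinearMap.map_add, LinearEquiv.map_add, LinearMap.add_apply,
          mul_add, add_mul, TensorProduct.tmul_add, TensorProduct.add_tmul, h₁, h₂])
    refine TensorProduct.induction_on y
      (by simp [LinearMap.map_zero, LinearEquiv.map_zero]) (fun y z => ?_)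
      (fun _ _ h₁ h₂ => by
        simp only [map_add, LinearMap.map_add, LinearEquiv.map_add, LinearMap.add_apply,
          mul_add, add_mul, TensorProduct.tmul_add, TensorProduct.add_tmul, h₁, h₂])
    refine TensorProduct.induction_on Y
      (by simp [LinearMap.map_zero, LinearEquiv.map_zero]) (fun x' y' => ?_)
      (fun _ _ h₁ h₂ => by
        simp only [map_add, LinearMap.map_add, LinearEquiv.map_add, LinearMap.add_apply,
          mul_add, add_mul, TensorProduct.tmul_add, TensorProduct.add_tmul, h₁, h₂])
    refine TensorProduct.induction_on y'
      (by simp [LinearMap.map_zero, LinearEquiv.map_zero]) (fun y' z' => ?_)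
      (fun _ _ h₁ h₂ => by
        simp only [map_add, LinearMap.map_add, LinearEquiv.map_add, LinearMap.add_apply,
          mul_add, add_mul, TensorProduct.tmul_add, TensorProduct.add_tmul, h₁, h₂])
    rw [contract₃_comul₃, contract₃_comul₃, reassoc_tmul, shuffle_tmul, pairL_tmul,
      map₂_apply_tmul, map₂_apply_tmul, map_tmul, map_tmul, p.lam_rho_comm x' z' v]
    rfl
  rw [tw, h1, h2]
  exact congrArg _ (congrArg _ (LinearMap.congr_fun (coassoc_six B) b).symm)

theorem counit_tw (b : B) (a : A) :
    counit (R := K) (p.tw b a) = counit (R := K) b * counit (R := K) a := by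
  have h0 (x z : B) : counit (R := K) (p.lam x (p.rho z a)) =
      p.form (antipode K x * z) a := by
    have e1 (x : B) (a : A) : counit (R := K) (p.lam x a) = p.form (antipode K x) a := by
      rw [lam_apply]
      have h := congr(p.form (antipode K x)
        (TensorProduct.rid K A $(lTensor_counit_comul (R := K) a)))
      rw [rid_tmul, one_smul] at h
      rw [← h]
      generalize comul (R := K) a = T
      hopf_tensor_induction T with u v
      simp [mul_comm]
    rw [e1, rho_apply, p.form_mul_left]
    generalize comul (R := K) a = T
    hopf_tensor_induction T with u v
    simp [mul_comm]
  have h1 (X : B ⊗[K] (B ⊗[K] B)) : counit (R := K) (p.contract₃ X (comul₃ K A a)) =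
      p.form (LinearMap.mul' K B ((antipode K).rTensor B
        ((TensorProduct.lid K B).toLinearMap.lTensor B ((counit.rTensor B).lTensor B X)))) a := by
    refine TensorProduct.induction_on X
      (by simp [LinearMap.map_zero, LinearEquiv.map_zero]) (fun x y => ?_)
      (fun _ _ h₁ h₂ => by
        simp only [map_add, LinearMap.map_add, LinearEquiv.map_add, LinearMap.add_apply,
          mul_add, add_mul, TensorProduct.tmul_add, TensorProduct.add_tmul, h₁, h₂])
    refine TensorProduct.induction_on y
      (by simp [LinearMap.map_zero, LinearEquiv.map_zero]) (fun y z => ?_)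
      (fun _ _ h₁ h₂ => by
        simp only [map_add, LinearMap.map_add, LinearEquiv.map_add, LinearMap.add_apply,
          mul_add, add_mul, TensorProduct.tmul_add, TensorProduct.add_tmul, h₁, h₂])
    rw [contract₃_comul₃, TensorProduct.counit_tmul, h0]
    simp
  rw [tw, h1, comul₃, LinearMap.comp_apply, ← LinearMap.lTensor_comp_apply _ _ comul,
      rTensor_counit_comp_comul]
  have h4 (Y : B ⊗[K] B) : (TensorProduct.lid K B).toLinearMap.lTensor B
      ((TensorProduct.mk K K B 1).lTensor B Y) = Y := by
    hopf_tensor_induction Y with u v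
    simp
  rw [h4, mul_antipode_rTensor_comul_apply, Algebra.algebraMap_eq_smul_one, map_smul,
    LinearMap.smul_apply, form_one_left, smul_eq_mul]

end SkewDualPairing

/-- The Drinfel'd quantum double of `A` and `B` with respect to a skew-dual pairing `B × A → K`. Its
underlying coalgebra is the tensor product coalgebra `A ⊗ B`; its product is
`(a ⊗ b)(a' ⊗ b') = Σ ⟨S b₁, a'₁⟩ ⟨b₃, a'₃⟩ a a'₂ ⊗ b₂ b'` with unit `1 ⊗ 1`, and its antipode is
`S(a ⊗ b) = (1 ⊗ S b)(S a ⊗ 1)`. -/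
def DrinfeldDouble (_p : SkewDualPairing K A B) : Type _ := A ⊗[K] B

namespace DrinfeldDouble

variable (p : SkewDualPairing K A B)

noncomputable instance : AddCommGroup (DrinfeldDouble p) := inferInstanceAs (AddCommGroup (A ⊗[K] B))
noncomputable instance : Module K (DrinfeldDouble p) := inferInstanceAs (Module K (A ⊗[K] B))
noncomputable instance : Coalgebra K (DrinfeldDouble p) := inferInstanceAs (Coalgebra K (A ⊗[K] B))

/-- The element `a ⊗ b`. -/
noncomputable def tmul (a : A) (b : B) : DrinfeldDouble p := (a ⊗ₜ[K] b : A ⊗[K] B)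

/-- The product of the double. -/
noncomputable instance : Mul (DrinfeldDouble p) := ⟨fun x y => p.mulLin (TensorProduct.tmul K x y)⟩
noncomputable instance : One (DrinfeldDouble p) := ⟨tmul p 1 1⟩

theorem mul_def (x y : DrinfeldDouble p) : x * y = p.mul x y := rfl

theorem one_def : (1 : DrinfeldDouble p) = tmul p 1 1 := rfl

noncomputable instance : Ring (DrinfeldDouble p) :=
  { (inferInstance : AddCommGroup (DrinfeldDouble p)),
    (inferInstance : Mul (DrinfeldDouble p)), (inferInstance : One (DrinfeldDouble p)) with
    left_distrib := fun x y z => map_add (p.mul x) y z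
    right_distrib := fun x y z => LinearMap.map_add₂ p.mul x y z
    zero_mul := fun x => LinearMap.map_zero₂ p.mul x
    mul_zero := fun x => map_zero (p.mul x)
    mul_assoc := p.mul_assoc'
    one_mul := p.one_mul'
    mul_one := p.mul_one' }

noncomputable instance : Algebra K (DrinfeldDouble p) :=
  Algebra.ofModule (fun c x y => LinearMap.map_smul₂ p.mul c x y)
    (fun c x y => map_smul (p.mul x) c y)


end DrinfeldDouble

namespace DrinfeldDouble

variable (p : SkewDualPairing K A B)

/-- The identification of the underlying space with `A ⊗ B`. -/
noncomputable def of : A ⊗[K] B ≃ₗ[K] DrinfeldDouble p := LinearEquiv.refl K (A ⊗[K] B)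

theorem of_tmul (a : A) (b : B) : of p (a ⊗ₜ b) = tmul p a b := rfl

/-- `tmul` as a bilinear map. -/
noncomputable def tmulL : A →ₗ[K] B →ₗ[K] DrinfeldDouble p :=
  (TensorProduct.mk K A B).compr₂ (of p).toLinearMap

theorem tmulL_apply (a : A) (b : B) : tmulL p a b = tmul p a b := rfl

variable {p} in
theorem ind {P : DrinfeldDouble p → Prop} (h0 : P 0) (h1 : ∀ a b, P (tmul p a b))
    (h2 : ∀ x y, P x → P y → P (x + y)) (x : DrinfeldDouble p) : P x :=
  TensorProduct.induction_on (motive := P) x h0 h1 h2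

theorem tmul_mul_tmul (a a' : A) (b b' : B) :
    tmul p a b * tmul p a' b' = of p (SkewDualPairing.LR a b' (p.tw b a')) := p.mul_tmul a a' b b'

theorem tmul_eq (a : A) (b : B) : tmul p a b = tmul p a 1 * tmul p 1 b := by
  rw [tmul_mul_tmul, p.tw_one_left, SkewDualPairing.LR_tmul, mul_one, one_mul]; rfl

theorem tmul_mul_tmul_eq (a a' : A) (b b' : B) :
    tmul p a b * tmul p a' b' = tmul p a 1 * (tmul p 1 b * tmul p a' 1) * tmul p 1 b' := by
  rw [tmul_eq p a b, tmul_eq p a' b']; simp only [mul_assoc]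

theorem tmul_one_mul (a a' : A) : tmul p (a * a') 1 = tmul p a 1 * tmul p a' 1 := by
  rw [tmul_mul_tmul, p.tw_one_left, SkewDualPairing.LR_tmul, mul_one]; rfl

theorem one_tmul_mul (b b' : B) : tmul p 1 (b * b') = tmul p 1 b * tmul p 1 b' := by
  rw [tmul_mul_tmul, p.tw_one_right, SkewDualPairing.LR_tmul, mul_one]; rfl

theorem tw_eq (a : A) (b : B) : tmul p 1 b * tmul p a 1 = of p (p.tw b a) := by
  rw [tmul_mul_tmul, SkewDualPairing.LR_one]

/-- The embedding `a ↦ a ⊗ 1`. -/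
noncomputable def inl : A →ₐ[K] DrinfeldDouble p :=
  AlgHom.ofLinearMap ((tmulL p).flip 1) rfl (tmul_one_mul p)

/-- The embedding `b ↦ 1 ⊗ b`. -/
noncomputable def inr : B →ₐ[K] DrinfeldDouble p :=
  AlgHom.ofLinearMap (tmulL p 1) rfl (one_tmul_mul p)

theorem inl_apply (a : A) : inl p a = tmul p a 1 := rfl
theorem inr_apply (b : B) : inr p b = tmul p 1 b := rfl

theorem comul_of (W : A ⊗[K] B) :
    comul (R := K) (of p W) = map (of p).toLinearMap (of p).toLinearMap (comul (R := K) W) := by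
  have : map (of p).toLinearMap (of p).toLinearMap = LinearMap.id := map_id
  rw [this]; rfl

theorem counit_of (W : A ⊗[K] B) : counit (R := K) (of p W) = counit (R := K) W := rfl

theorem comul_tmul (a : A) (b : B) : comul (R := K) (tmul p a b) =
    map₂ (tmulL p) (tmulL p) (comul a) (comul b) := by
  rw [← of_tmul, comul_of, TensorProduct.comul_tmul]
  generalize comul (R := K) a = X
  generalize comul (R := K) b = Y
  refine TensorProduct.induction_on X
    (by simp [LinearMap.map_zero, LinearEquiv.map_zero]) (fun x x' => ?_)
    (fun _ _ h₁ h₂ => by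
      simp only [map_add, LinearMap.map_add, LinearEquiv.map_add, LinearMap.add_apply,
        mul_add, add_mul, TensorProduct.tmul_add, TensorProduct.add_tmul, h₁, h₂])
  hopf_tensor_induction Y with y y'
  simp [tmulL]

theorem counit_tmul (a : A) (b : B) :
    counit (R := K) (tmul p a b) = counit (R := K) a * counit (R := K) b := by
  rw [← of_tmul, counit_of, TensorProduct.counit_tmul, smul_eq_mul, mul_comm]

theorem comul_inl (a : A) :
    comul (R := K) (tmul p a 1) = Algebra.TensorProduct.map (inl p) (inl p) (comul (R := K) a) := by
  rw [comul_tmul, Bialgebra.comul_one, Algebra.TensorProduct.one_def]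
  generalize comul (R := K) a = X
  refine TensorProduct.induction_on X
    (by simp [LinearMap.map_zero, LinearEquiv.map_zero]) (fun x x' => ?_)
    (fun _ _ h₁ h₂ => by
      simp only [map_add, LinearMap.map_add, LinearEquiv.map_add, LinearMap.add_apply,
        mul_add, add_mul, TensorProduct.tmul_add, TensorProduct.add_tmul, h₁, h₂])
  rfl

theorem comul_inr (b : B) :
    comul (R := K) (tmul p 1 b) = Algebra.TensorProduct.map (inr p) (inr p) (comul (R := K) b) := by
  rw [comul_tmul, Bialgebra.comul_one, Algebra.TensorProduct.one_def]
  generalize comul (R := K) b = X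
  refine TensorProduct.induction_on X
    (by simp [LinearMap.map_zero, LinearEquiv.map_zero]) (fun x x' => ?_)
    (fun _ _ h₁ h₂ => by
      simp only [map_add, LinearMap.map_add, LinearEquiv.map_add, LinearMap.add_apply,
        mul_add, add_mul, TensorProduct.tmul_add, TensorProduct.add_tmul, h₁, h₂])
  rfl

theorem comul_tmul_eq (a : A) (b : B) :
    comul (R := K) (tmul p a b) = comul (R := K) (tmul p a 1) * comul (R := K) (tmul p 1 b) := by
  rw [comul_inl, comul_inr, comul_tmul]
  generalize comul (R := K) a = X
  generalize comul (R := K) b = Y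
  refine TensorProduct.induction_on X
    (by simp [LinearMap.map_zero, LinearEquiv.map_zero]) (fun x x' => ?_)
    (fun _ _ h₁ h₂ => by
      simp only [map_add, LinearMap.map_add, LinearEquiv.map_add, LinearMap.add_apply,
        mul_add, add_mul, TensorProduct.tmul_add, TensorProduct.add_tmul, h₁, h₂])
  refine TensorProduct.induction_on Y
    (by simp [LinearMap.map_zero, LinearEquiv.map_zero]) (fun y y' => ?_)
    (fun _ _ h₁ h₂ => by
      simp only [map_add, LinearMap.map_add, LinearEquiv.map_add, LinearMap.add_apply,
        mul_add, add_mul, TensorProduct.tmul_add, TensorProduct.add_tmul, h₁, h₂])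
  rw [Algebra.TensorProduct.map_tmul, Algebra.TensorProduct.map_tmul,
    Algebra.TensorProduct.tmul_mul_tmul, inl_apply, inl_apply, inr_apply, inr_apply,
    ← tmul_eq, ← tmul_eq]
  rfl

theorem comul_swap (a : A) (b : B) :
    comul (R := K) (tmul p 1 b * tmul p a 1) =
      comul (R := K) (tmul p 1 b) * comul (R := K) (tmul p a 1) := by
  rw [comul_inl, comul_inr, tw_eq, comul_of, p.comul_tw]
  generalize comul (R := K) a = X
  generalize comul (R := K) b = Y
  refine TensorProduct.induction_on X
    (by simp [LinearMap.map_zero, LinearEquiv.map_zero]) (fun x x' => ?_)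
    (fun _ _ h₁ h₂ => by
      simp only [map_add, LinearMap.map_add, LinearEquiv.map_add, LinearMap.add_apply,
        mul_add, add_mul, TensorProduct.tmul_add, TensorProduct.add_tmul, h₁, h₂])
  refine TensorProduct.induction_on Y
    (by simp [LinearMap.map_zero, LinearEquiv.map_zero]) (fun y y' => ?_)
    (fun _ _ h₁ h₂ => by
      simp only [map_add, LinearMap.map_add, LinearEquiv.map_add, LinearMap.add_apply,
        mul_add, add_mul, TensorProduct.tmul_add, TensorProduct.add_tmul, h₁, h₂])
  rw [Algebra.TensorProduct.map_tmul, Algebra.TensorProduct.map_tmul,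
    Algebra.TensorProduct.tmul_mul_tmul, inl_apply, inl_apply, inr_apply, inr_apply,
    tw_eq, tw_eq]
  rfl

theorem comul_left_mul (a : A) (x : DrinfeldDouble p) :
    comul (R := K) (tmul p a 1 * x) = comul (R := K) (tmul p a 1) * comul (R := K) x := by
  refine ind (P := fun x => comul (R := K) (tmul p a 1 * x) =
    comul (R := K) (tmul p a 1) * comul (R := K) x) (by simp) (fun c y => ?_) (fun x y h₁ h₂ => by
    simp only [mul_add, map_add, h₁, h₂]) x
  rw [tmul_eq p c y, ← mul_assoc, ← tmul_one_mul, ← tmul_eq, comul_tmul_eq,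
    ← tmul_eq, comul_tmul_eq p c y, ← mul_assoc]
  simp only [comul_inl, Bialgebra.comul_mul, map_mul]

theorem comul_mul_right (b : B) (x : DrinfeldDouble p) :
    comul (R := K) (x * tmul p 1 b) = comul (R := K) x * comul (R := K) (tmul p 1 b) := by
  refine ind (P := fun x => comul (R := K) (x * tmul p 1 b) =
    comul (R := K) x * comul (R := K) (tmul p 1 b)) (by simp) (fun c y => ?_) (fun x y h₁ h₂ => by
    simp only [add_mul, map_add, h₁, h₂]) x
  rw [tmul_eq p c y, mul_assoc, ← one_tmul_mul, ← tmul_eq, comul_tmul_eq,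
    ← tmul_eq, comul_tmul_eq p c y, mul_assoc]
  simp only [comul_inr, Bialgebra.comul_mul, map_mul]

theorem comul_mul' (x y : DrinfeldDouble p) :
    comul (R := K) (x * y) = comul (R := K) x * comul (R := K) y := by
  refine ind (P := fun x => comul (R := K) (x * y) = comul (R := K) x * comul (R := K) y)
    (by simp) (fun a b => ?_) (fun x y h₁ h₂ => by simp only [add_mul, map_add, h₁, h₂]) x
  refine ind (P := fun y => comul (R := K) (tmul p a b * y) =
    comul (R := K) (tmul p a b) * comul (R := K) y) (by simp) (fun a' b' => ?_)
    (fun x y h₁ h₂ => by simp only [mul_add, map_add, h₁, h₂]) y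
  rw [tmul_mul_tmul_eq, comul_mul_right, comul_left_mul, comul_swap, comul_tmul_eq p a b,
    comul_tmul_eq p a' b']
  simp only [mul_assoc]

theorem counit_mul' (x y : DrinfeldDouble p) :
    counit (R := K) (x * y) = counit (R := K) x * counit (R := K) y := by
  refine ind (P := fun x => counit (R := K) (x * y) = counit (R := K) x * counit (R := K) y)
    (by simp) (fun a b => ?_) (fun x y h₁ h₂ => by simp only [add_mul, map_add, h₁, h₂]) x
  refine ind (P := fun y => counit (R := K) (tmul p a b * y) =
    counit (R := K) (tmul p a b) * counit (R := K) y) (by simp) (fun a' b' => ?_)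
    (fun x y h₁ h₂ => by simp only [mul_add, map_add, h₁, h₂]) y
  have h (W : A ⊗[K] B) : counit (R := K) (SkewDualPairing.LR a b' W) =
      counit (R := K) a * counit (R := K) W * counit (R := K) b' := by
    hopf_tensor_induction W with c y
    simp
    ring
  rw [tmul_mul_tmul, counit_tmul, counit_tmul, counit_of, h, p.counit_tw]
  ring

noncomputable instance : Bialgebra K (DrinfeldDouble p) :=
  Bialgebra.mk' K (DrinfeldDouble p)
    (by rw [one_def, counit_tmul, Bialgebra.counit_one, Bialgebra.counit_one, mul_one])
    (fun {x y} => counit_mul' p x y)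
    (by
      rw [one_def, comul_inl, Bialgebra.comul_one, map_one])
    (fun {x y} => comul_mul' p x y)

/-- `a ⊗ b ↦ (1 ⊗ S b) (S a ⊗ 1)`. -/
noncomputable def antipodeLin : DrinfeldDouble p →ₗ[K] DrinfeldDouble p :=
  TensorProduct.lift ((LinearMap.mul K (DrinfeldDouble p)).flip.compl₁₂
    ((inl p).toLinearMap ∘ₗ antipode K) ((inr p).toLinearMap ∘ₗ antipode K)) ∘ₗ
    (of p).symm.toLinearMap

theorem antipodeLin_tmul (a : A) (b : B) :
    antipodeLin p (tmul p a b) = tmul p 1 (antipode K b) * tmul p (antipode K a) 1 := rfl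

theorem antipode_left (x : DrinfeldDouble p) :
    LinearMap.mul' K (DrinfeldDouble p) ((antipodeLin p).rTensor (DrinfeldDouble p)
      (comul (R := K) x)) = algebraMap K _ (counit (R := K) x) := by
  refine ind (P := fun x => LinearMap.mul' K (DrinfeldDouble p)
    ((antipodeLin p).rTensor (DrinfeldDouble p) (comul (R := K) x)) =
      algebraMap K _ (counit (R := K) x)) (by simp) (fun a b => ?_)
    (fun x y h₁ h₂ => by simp only [map_add, h₁, h₂]) x
  have h (X : A ⊗[K] A) (Y : B ⊗[K] B) : LinearMap.mul' K (DrinfeldDouble p)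
      ((antipodeLin p).rTensor (DrinfeldDouble p) (map₂ (tmulL p) (tmulL p) X Y)) =
      LinearMap.mul' K (DrinfeldDouble p) (map (LinearMap.mulRight K (inl p
          (LinearMap.mul' K A ((antipode K).rTensor A X))) ∘ₗ (inr p).toLinearMap ∘ₗ antipode K)
        (inr p).toLinearMap Y) := by
    hopf_tensor_induction Y with y y'
    simp only [map_tmul, LinearMap.mul'_apply, LinearMap.comp_apply, LinearMap.mulRight_apply]
    refine TensorProduct.induction_on X
      (by simp [LinearMap.map_zero, LinearEquiv.map_zero]) (fun x x' => ?_)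
      (fun _ _ h₁ h₂ => by
        simp only [map_add, LinearMap.map_add, LinearEquiv.map_add, LinearMap.add_apply,
          mul_add, add_mul, TensorProduct.tmul_add, TensorProduct.add_tmul, h₁, h₂])
    simp only [map₂_apply_tmul, map_tmul, tmulL_apply, LinearMap.rTensor_tmul,
      LinearMap.mul'_apply, antipodeLin_tmul, tmul_eq p x' y', map_mul]
    simp only [AlgHom.toLinearMap_apply, inl_apply, inr_apply, mul_assoc]
  have h' (c : K) (Y : B ⊗[K] B) : LinearMap.mul' K (DrinfeldDouble p)
      (map (LinearMap.mulRight K (algebraMap K (DrinfeldDouble p) c) ∘ₗ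
        (inr p).toLinearMap ∘ₗ antipode K) (inr p).toLinearMap Y) =
      algebraMap K _ c * inr p (LinearMap.mul' K B ((antipode K).rTensor B Y)) := by
    refine TensorProduct.induction_on Y
      (by simp [LinearMap.map_zero, LinearEquiv.map_zero]) (fun y y' => ?_)
      (fun _ _ h₁ h₂ => by
        simp only [map_add, LinearMap.map_add, LinearEquiv.map_add, LinearMap.add_apply,
          mul_add, add_mul, TensorProduct.tmul_add, TensorProduct.add_tmul, h₁, h₂])
    simp [Algebra.commutes, mul_assoc]
  rw [comul_tmul, h, mul_antipode_rTensor_comul_apply, AlgHom.commutes, h',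
    mul_antipode_rTensor_comul_apply, AlgHom.commutes, counit_tmul, map_mul]

theorem antipode_right (x : DrinfeldDouble p) :
    LinearMap.mul' K (DrinfeldDouble p) ((antipodeLin p).lTensor (DrinfeldDouble p)
      (comul (R := K) x)) = algebraMap K _ (counit (R := K) x) := by
  refine ind (P := fun x => LinearMap.mul' K (DrinfeldDouble p)
    ((antipodeLin p).lTensor (DrinfeldDouble p) (comul (R := K) x)) =
      algebraMap K _ (counit (R := K) x)) (by simp) (fun a b => ?_)
    (fun x y h₁ h₂ => by simp only [map_add, h₁, h₂]) x
  have h (X : A ⊗[K] A) (Y : B ⊗[K] B) : LinearMap.mul' K (DrinfeldDouble p)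
      ((antipodeLin p).lTensor (DrinfeldDouble p) (map₂ (tmulL p) (tmulL p) X Y)) =
      LinearMap.mul' K (DrinfeldDouble p) (map (LinearMap.mulRight K (inr p
          (LinearMap.mul' K B ((antipode K).lTensor B Y))) ∘ₗ (inl p).toLinearMap)
        ((inl p).toLinearMap ∘ₗ antipode K) X) := by
    refine TensorProduct.induction_on X
      (by simp [LinearMap.map_zero, LinearEquiv.map_zero]) (fun x x' => ?_)
      (fun _ _ h₁ h₂ => by
        simp only [map_add, LinearMap.map_add, LinearEquiv.map_add, LinearMap.add_apply,
          mul_add, add_mul, TensorProduct.tmul_add, TensorProduct.add_tmul, h₁, h₂])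
    simp only [map_tmul, LinearMap.mul'_apply, LinearMap.comp_apply, LinearMap.mulRight_apply]
    refine TensorProduct.induction_on Y
      (by simp [LinearMap.map_zero, LinearEquiv.map_zero]) (fun y y' => ?_)
      (fun _ _ h₁ h₂ => by
        simp only [map_add, LinearMap.map_add, LinearEquiv.map_add, LinearMap.add_apply,
          mul_add, add_mul, TensorProduct.tmul_add, TensorProduct.add_tmul, h₁, h₂])
    simp only [map₂_apply_tmul, map_tmul, tmulL_apply, LinearMap.lTensor_tmul,
      LinearMap.mul'_apply, antipodeLin_tmul, tmul_eq p x y, map_mul]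
    simp only [AlgHom.toLinearMap_apply, inl_apply, inr_apply, mul_assoc]
  have h' (c : K) (X : A ⊗[K] A) : LinearMap.mul' K (DrinfeldDouble p)
      (map (LinearMap.mulRight K (algebraMap K (DrinfeldDouble p) c) ∘ₗ
        (inl p).toLinearMap) ((inl p).toLinearMap ∘ₗ antipode K) X) =
      algebraMap K _ c * inl p (LinearMap.mul' K A ((antipode K).lTensor A X)) := by
    refine TensorProduct.induction_on X
      (by simp [LinearMap.map_zero, LinearEquiv.map_zero]) (fun x x' => ?_)
      (fun _ _ h₁ h₂ => by
        simp only [map_add, LinearMap.map_add, LinearEquiv.map_add, LinearMap.add_apply,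
          mul_add, add_mul, TensorProduct.tmul_add, TensorProduct.add_tmul, h₁, h₂])
    simp [Algebra.commutes, mul_assoc]
  rw [comul_tmul, h, mul_antipode_lTensor_comul_apply, AlgHom.commutes, h',
    mul_antipode_lTensor_comul_apply, AlgHom.commutes, counit_tmul, map_mul, Algebra.commutes]

/-- The Hopf algebra structure of the double. -/
noncomputable instance : HopfAlgebra K (DrinfeldDouble p) :=
  { antipode := antipodeLin p
    mul_antipode_rTensor_comul := LinearMap.ext (antipode_left p)
    mul_antipode_lTensor_comul := LinearMap.ext (antipode_right p) }

end DrinfeldDouble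

end Double4

end DrinfeldDoubles

namespace QParams

variable {K : Type*} [Field K] (P : QParams K)

/-- The invertible generators of one Borel subalgebra: `ω_i`, `γ^{1/2}`, `D` for the positive
one, `ω'_i`, `γ'^{1/2}`, `D'` for the negative one. -/
inductive BTor : Type
  | ω (i : P.Idx)
  | γ
  | D

variable {P} in
/-- The corresponding generator of the positive Borel subalgebra. -/
def BTor.pos : P.BTor → P.Tor
  | .ω i => .ω i
  | .γ => .γ
  | .D => .D

variable {P} in
/-- The corresponding generator of the negative Borel subalgebra. -/
def BTor.neg : P.BTor → P.Tor
  | .ω i => .ω' i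
  | .γ => .γ'
  | .D => .D'

/-- The generators `e_j`, `ω_j^{±1}`, `γ^{±1/2}`, `D^{±1}` of the positive Borel subalgebra. -/
def posGens : Set P.U :=
  Set.range (U.e P) ∪ Set.range (fun x : P.BTor => U.t P x.pos) ∪
    Set.range (fun x : P.BTor => U.tinv P x.pos)

/-- The generators `f_j`, `ω'_j^{±1}`, `γ'^{±1/2}`, `D'^{±1}` of the negative Borel subalgebra. -/
def negGens : Set P.U :=
  Set.range (U.f P) ∪ Set.range (fun x : P.BTor => U.t P x.neg) ∪
    Set.range (fun x : P.BTor => U.tinv P x.neg)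

/-- The positive Borel subalgebra. -/
noncomputable def BPos : Subalgebra K P.U := Algebra.adjoin K P.posGens

/-- The negative Borel subalgebra. -/
noncomputable def BNeg : Subalgebra K P.U := Algebra.adjoin K P.negGens

namespace BPos

/-- `e_i` as an element of the positive Borel subalgebra. -/
noncomputable def e (i : P.Idx) : P.BPos :=
  ⟨U.e P i, Algebra.subset_adjoin (.inl (.inl ⟨i, rfl⟩))⟩
/-- `ω_i`, `γ^{1/2}`, `D` as elements of the positive Borel subalgebra. -/
noncomputable def t (x : P.BTor) : P.BPos :=
  ⟨U.t P x.pos, Algebra.subset_adjoin (.inl (.inr ⟨x, rfl⟩))⟩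
/-- `ω_i⁻¹`, `γ^{-1/2}`, `D⁻¹` as elements of the positive Borel subalgebra. -/
noncomputable def tinv (x : P.BTor) : P.BPos :=
  ⟨U.tinv P x.pos, Algebra.subset_adjoin (.inr ⟨x, rfl⟩)⟩

theorem isHopfSubalgebra : IsHopfSubalgebra P.BPos := by
  refine IsHopfSubalgebra.of_adjoin _ ?_ ?_
  · rintro _ ((⟨i, rfl⟩ | ⟨x, rfl⟩) | ⟨x, rfl⟩)
    · refine ⟨e P i ⊗ₜ[K] 1 + t P (.ω i) ⊗ₜ[K] e P i, ?_⟩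
      rw [U.comul_e]; rfl
    · refine ⟨t P x ⊗ₜ t P x, ?_⟩
      rw [U.comul_t]; rfl
    · refine ⟨tinv P x ⊗ₜ tinv P x, ?_⟩
      rw [U.comul_tinv]; rfl
  · rintro _ ((⟨i, rfl⟩ | ⟨x, rfl⟩) | ⟨x, rfl⟩)
    · rw [U.antipode_e]
      exact (-(tinv P (.ω i) * e P i)).2
    · simp only [U.antipode_t]
      exact (tinv P x).2
    · simp only [U.antipode_tinv]
      exact (t P x).2

end BPos

namespace BNeg

/-- `f_i` as an element of the negative Borel subalgebra. -/
noncomputable def f (i : P.Idx) : P.BNeg :=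
  ⟨U.f P i, Algebra.subset_adjoin (.inl (.inl ⟨i, rfl⟩))⟩
/-- `ω'_i`, `γ'^{1/2}`, `D'` as elements of the negative Borel subalgebra. -/
noncomputable def t (x : P.BTor) : P.BNeg :=
  ⟨U.t P x.neg, Algebra.subset_adjoin (.inl (.inr ⟨x, rfl⟩))⟩
/-- `ω'_i⁻¹`, `γ'^{-1/2}`, `D'⁻¹` as elements of the negative Borel subalgebra. -/
noncomputable def tinv (x : P.BTor) : P.BNeg :=
  ⟨U.tinv P x.neg, Algebra.subset_adjoin (.inr ⟨x, rfl⟩)⟩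

theorem isHopfSubalgebra : IsHopfSubalgebra P.BNeg := by
  refine IsHopfSubalgebra.of_adjoin _ ?_ ?_
  · rintro _ ((⟨i, rfl⟩ | ⟨x, rfl⟩) | ⟨x, rfl⟩)
    · refine ⟨f P i ⊗ₜ[K] t P (.ω i) + 1 ⊗ₜ[K] f P i, ?_⟩
      rw [U.comul_f]; rfl
    · refine ⟨t P x ⊗ₜ t P x, ?_⟩
      rw [U.comul_t]; rfl
    · refine ⟨tinv P x ⊗ₜ tinv P x, ?_⟩
      rw [U.comul_tinv]; rfl
  · rintro _ ((⟨i, rfl⟩ | ⟨x, rfl⟩) | ⟨x, rfl⟩)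
    · rw [U.antipode_f]
      exact (-(f P i * tinv P (.ω i))).2
    · simp only [U.antipode_t]
      exact (tinv P x).2
    · simp only [U.antipode_tinv]
      exact (t P x).2

end BNeg

/-- The positive Borel subalgebra is a Hopf subalgebra. -/
noncomputable instance : HopfAlgebra K P.BPos := (BPos.isHopfSubalgebra P).hopfAlgebra
/-- The negative Borel subalgebra is a Hopf subalgebra. -/
noncomputable instance : HopfAlgebra K P.BNeg := (BNeg.isHopfSubalgebra P).hopfAlgebra

/-- The values `⟨x', y⟩` of the pairing on the invertible generators `x'` of the negative and `y` of the positive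
Borel subalgebra. -/
def pairVal : P.BTor → P.BTor → K
  | .ω i, .ω j => P.chi P.r P.s i j
  | .ω _, .γ => 1
  | .ω i, .D => if i = 0 then P.r else 1
  | .γ, .ω _ => 1
  | .γ, .γ => 1
  | .γ, .D => P.rh
  | .D, .ω j => if j = 0 then P.s⁻¹ else 1
  | .D, .γ => P.sh⁻¹
  | .D, .D => 1

/-- The pairing of the Borel subalgebras takes the prescribed values on all pairs of generators:
`⟨f_i, e_j⟩ = δ_{ij} / (s - r)`; `⟨x'^{±1}, y^{±1}⟩` is `⟨x', y⟩` to the product of the signs, for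
the invertible generators; and `f_i` with an invertible generator, or an invertible generator with
`e_j`, pair to zero. -/
structure IsStdPairing (p : SkewDualPairing K P.BPos P.BNeg) : Prop where
  f_e (i j : P.Idx) : p.form (BNeg.f P i) (BPos.e P j) = if i = j then 1 / (P.s - P.r) else 0
  t_t (x y : P.BTor) : p.form (BNeg.t P x) (BPos.t P y) = P.pairVal x y
  t_tinv (x y : P.BTor) : p.form (BNeg.t P x) (BPos.tinv P y) = (P.pairVal x y)⁻¹
  tinv_t (x y : P.BTor) : p.form (BNeg.tinv P x) (BPos.t P y) = (P.pairVal x y)⁻¹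
  tinv_tinv (x y : P.BTor) : p.form (BNeg.tinv P x) (BPos.tinv P y) = P.pairVal x y
  f_t (i : P.Idx) (y : P.BTor) : p.form (BNeg.f P i) (BPos.t P y) = 0
  f_tinv (i : P.Idx) (y : P.BTor) : p.form (BNeg.f P i) (BPos.tinv P y) = 0
  t_e (x : P.BTor) (j : P.Idx) : p.form (BNeg.t P x) (BPos.e P j) = 0
  tinv_e (x : P.BTor) (j : P.Idx) : p.form (BNeg.tinv P x) (BPos.e P j) = 0

end QParams

/-! Once the skew-dual pairing exists, the theorem is formal. In the double the generators satisfy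
the relations of U: for example, among the nine terms of the product of f_i and e_j only three
survive, and they give the commutator with (ω_i - ω'_i)/(r-s). Hence there is an algebra map
`toDouble` from U to the double. In the other direction, a ⊗ b ↦ ab is a linear map from the double
to U. Applying `toDouble` after it gives the identity, and it is surjective because the commutation
relations let every product be sorted with its positive part on the left (`triangularSpan_eq_top`).
So `toDouble` is bijective, without any PBW basis. It respects coproducts because it does so on the
two Borel subalgebras. Uniqueness of the pairing (`IsStdPairing.unique`) holds since its axioms
reduce every value to values on generators.

The substance is the existence of the pairing. A form on algebras given by generators can only be
defined on them if their relations are known, but the Borel subalgebras are defined as subalgebras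
of U, where further relations could a priori be forced. This is excluded by an action of U on an
abstractly presented positive Borel algebra A: e_j and the positive invertible generators act by
left multiplication, ω'_j, γ'^{1/2}, D' by rescaling the generators, and f_i by a lowering operator
F_i. The map from A to the positive Borel subalgebra and on through this action is left
multiplication, which is faithful, so A is the positive Borel subalgebra (`BPos.isPosUniv`). An
anti-homomorphism from U_{r,s} to U_{s,r} that exchanges e_i with f_i carries the result to the
negative side (`BNeg.exists_lift`).

Operators F_i with prescribed commutators with the e_j come from first-order deformations: replacing
e_i by e_i + ε X gives a homomorphism to dual numbers over End(A), provided the linearised Serre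
relations hold. Here X is a sum of two operators, each of which q-commutes with every e_j, so these
relations reduce to scalar identities in r and s. The relations among the F_i follow from
`end_eq_zero`: the relevant expression kills 1, commutes with every e_k and q-commutes with the
invertible generators, hence is zero.

The same family F_i, with other constants, gives the pairing. For c₂ = 0 it consists of skew
derivations that commute with the left coaction, so the negative Borel subalgebra acts on the
positive one by b · a = Σ a₁⟨b, a₂⟩ (`skewAction`), and ⟨b, a⟩ is the counit of b · a
(`stdPairing`). -/

/-! ### Linearised Serre relations. -/

section SerreDerivative

variable {K A : Type*} [Field K] [Ring A] [Algebra K A]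

/-- The derivative of `qSerre u v a b` in the direction `z` of its first argument. -/
def qSerreDeriv (u v : K) (a b z : A) : A :=
  (a * z + z * a) * b - (u + v) • (z * b * a + a * b * z) + (u * v) • (b * (a * z + z * a))

/-- The derivative of `qSerre' u v a b` in the direction `z` of its second argument. -/
def qSerreDeriv' (u v : K) (a b z : A) : A :=
  a * (b * z + z * b) - (u + v) • (z * a * b + b * a * z) + (u * v) • ((b * z + z * b) * a)

theorem qSerreDeriv_lin (u v c d : K) (a b z w : A) :
    qSerreDeriv u v a b (c • z + d • w) =
      c • qSerreDeriv u v a b z + d • qSerreDeriv u v a b w := by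
  simp only [qSerreDeriv, mul_add, add_mul, mul_smul_comm, smul_mul_assoc]
  module

theorem qSerreDeriv'_lin (u v c d : K) (a b z w : A) :
    qSerreDeriv' u v a b (c • z + d • w) =
      c • qSerreDeriv' u v a b z + d • qSerreDeriv' u v a b w := by
  simp only [qSerreDeriv', mul_add, add_mul, mul_smul_comm, smul_mul_assoc]
  module

theorem qSerre_lin (u v c d : K) (a z w : A) :
    qSerre u v a (c • z + d • w) = c • qSerre u v a z + d • qSerre u v a w := by
  simp only [qSerre, mul_add, add_mul, mul_smul_comm, smul_mul_assoc]
  module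

theorem qSerre'_lin (u v c d : K) (b z w : A) :
    qSerre' u v (c • z + d • w) b = c • qSerre' u v z b + d • qSerre' u v w b := by
  simp only [qSerre', mul_add, add_mul, mul_smul_comm, smul_mul_assoc]
  module

/-- Moving z to the right leaves only the monomials abz and baz; `h1` and `h2` say that their
coefficients vanish. -/
theorem qSerreDeriv_eq_zero {u v q q' : K} {a b z : A} (h : z * a = q • (a * z))
    (h' : z * b = q' • (b * z)) (h1 : q' * (1 + q) = u + v)
    (h2 : (u + v) * (q * q') = u * v * (1 + q)) : qSerreDeriv u v a b z = 0 := by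
  simp only [qSerreDeriv, mul_add, add_mul, mul_assoc, h, h', mul_smul_comm,
    smul_mul_assoc, smul_smul, smul_add]
  match_scalars
  · linear_combination h1
  · linear_combination -h2

/-- Again the two scalar hypotheses are the coefficients of abz and baz. -/
theorem qSerreDeriv'_eq_zero {u v q q' : K} {a b z : A} (h : z * b = q • (b * z))
    (h' : z * a = q' • (a * z)) (h1 : 1 + q = (u + v) * (q * q'))
    (h2 : u + v = u * v * (1 + q) * q') : qSerreDeriv' u v a b z = 0 := by
  simp only [qSerreDeriv', mul_add, add_mul, mul_assoc, h, h', mul_smul_comm,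
    smul_mul_assoc, smul_smul, smul_add]
  match_scalars
  · linear_combination h1
  · linear_combination -h2

/-- The quadratic is (1 - uq)(1 - vq), so q must be the inverse of one of the parameters. The
weights of neighbouring generators are exactly of this kind. -/
theorem qSerre_eq_zero_of_comm {u v q : K} {a z : A} (h : z * a = q • (a * z))
    (h1 : 1 - (u + v) * q + u * v * q ^ 2 = 0) : qSerre u v a z = 0 := by
  have h3 (Z : A) : z * (a * Z) = q • (a * (z * Z)) := by
    rw [← mul_assoc, h, smul_mul_assoc, mul_assoc]
  simp only [qSerre, pow_two, mul_assoc, h, h3, mul_smul_comm, smul_smul]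
  match_scalars
  linear_combination h1

/-- Here the quadratic is (q - u)(q - v). -/
theorem qSerre'_eq_zero_of_comm {u v q : K} {b z : A} (h : z * b = q • (b * z))
    (h1 : q ^ 2 - (u + v) * q + u * v = 0) : qSerre' u v z b = 0 := by
  have h3 (Z : A) : z * (b * Z) = q • (b * (z * Z)) := by
    rw [← mul_assoc, h, smul_mul_assoc, mul_assoc]
  simp only [qSerre', pow_two, mul_assoc, h, h3, mul_smul_comm, smul_smul]
  match_scalars
  linear_combination h1

/-- The commutator with x is a derivation, so on a polynomial in a and b it gives the directional
derivative along (z, w). Since the expression is linear in b, the derivative in b is the expression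
itself. It is applied with x left multiplication by e_k and a, b lowering operators. -/
theorem commutator_qSerre (u v : K) {x a b z w : A} (ha : x * a = a * x + z)
    (hb : x * b = b * x + w) :
    x * qSerre u v a b = qSerre u v a b * x + (qSerreDeriv u v a b z + qSerre u v a w) := by
  have h3 (Z : A) : x * (a * Z) = a * (x * Z) + z * Z := by
    rw [← mul_assoc, ha, add_mul, mul_assoc]
  have h4 (Z : A) : x * (b * Z) = b * (x * Z) + w * Z := by
    rw [← mul_assoc, hb, add_mul, mul_assoc]
  simp only [qSerre, qSerreDeriv, pow_two, mul_add, add_mul, mul_sub, sub_mul, mul_assoc, ha, hb,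
    h3, h4, mul_smul_comm, smul_mul_assoc]
  module

theorem commutator_qSerre' (u v : K) {x a b z w : A} (ha : x * a = a * x + z)
    (hb : x * b = b * x + w) :
    x * qSerre' u v a b = qSerre' u v a b * x + (qSerreDeriv' u v a b w + qSerre' u v z b) := by
  have h3 (Z : A) : x * (a * Z) = a * (x * Z) + z * Z := by
    rw [← mul_assoc, ha, add_mul, mul_assoc]
  have h4 (Z : A) : x * (b * Z) = b * (x * Z) + w * Z := by
    rw [← mul_assoc, hb, add_mul, mul_assoc]
  simp only [qSerre', qSerreDeriv', pow_two, mul_add, add_mul, mul_sub, sub_mul, mul_assoc, ha, hb,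
    h3, h4, mul_smul_comm, smul_mul_assoc]
  module

-- Over dual numbers an identity splits into itself and its linearisation; this is the linearised
-- half, along z and w.
open TrivSqZeroExt in
theorem snd_qSerre (u v : K) (a b z w : A) :
    snd (qSerre u v (inl a + inr z : DualNumber A) (inl b + inr w)) =
      qSerreDeriv u v a b z + qSerre u v a w := by
  simp [qSerre, qSerreDeriv, pow_two, mul_add, add_mul, mul_assoc]
  module

open TrivSqZeroExt in
theorem snd_qSerre' (u v : K) (a b z w : A) :
    snd (qSerre' u v (inl a + inr z : DualNumber A) (inl b + inr w)) =
      qSerreDeriv' u v a b w + qSerre' u v z b := by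
  simp [qSerre', qSerreDeriv', pow_two, mul_add, add_mul, mul_assoc]
  module

theorem qSerre_mul_semiconj (u v : K) {x a b : A} {c d : K} (ha : x * a = c • (a * x))
    (hb : x * b = d • (b * x)) : x * qSerre u v a b = (c ^ 2 * d) • (qSerre u v a b * x) := by
  have h3 (Z : A) : x * (a * Z) = c • (a * (x * Z)) := by
    rw [← mul_assoc, ha, smul_mul_assoc, mul_assoc]
  have h4 (Z : A) : x * (b * Z) = d • (b * (x * Z)) := by
    rw [← mul_assoc, hb, smul_mul_assoc, mul_assoc]
  simp only [qSerre, pow_two, mul_add, add_mul, mul_sub, sub_mul, mul_assoc, ha, hb,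
    h3, h4, mul_smul_comm, smul_mul_assoc]
  module

theorem qSerre'_mul_semiconj (u v : K) {x a b : A} {c d : K} (ha : x * a = c • (a * x))
    (hb : x * b = d • (b * x)) : x * qSerre' u v a b = (c * d ^ 2) • (qSerre' u v a b * x) := by
  have h3 (Z : A) : x * (a * Z) = c • (a * (x * Z)) := by
    rw [← mul_assoc, ha, smul_mul_assoc, mul_assoc]
  have h4 (Z : A) : x * (b * Z) = d • (b * (x * Z)) := by
    rw [← mul_assoc, hb, smul_mul_assoc, mul_assoc]
  simp only [qSerre', pow_two, mul_add, add_mul, mul_sub, sub_mul, mul_assoc, ha, hb,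
    h3, h4, mul_smul_comm, smul_mul_assoc]
  module

theorem qSerre_smul (u v c d : K) (a b : A) :
    qSerre u v (c • a) (d • b) = (c ^ 2 * d) • qSerre u v a b := by
  simp only [qSerre, smul_pow, smul_mul_assoc, mul_smul_comm, smul_smul, smul_add, smul_sub]
  module

theorem qSerre'_smul (u v c d : K) (a b : A) :
    qSerre' u v (c • a) (d • b) = (c * d ^ 2) • qSerre' u v a b := by
  simp only [qSerre', smul_pow, smul_mul_assoc, mul_smul_comm, smul_smul, smul_add, smul_sub]
  module

end SerreDerivative

/-! ### Inverses of q-commuting elements, and subspaces stable under left multiplication by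
generators. -/

theorem inv_mul_semiconj {K A : Type*} [Field K] [Ring A] [Algebra K A] {x y a : A} {c : K}
    (hxy : x * y = 1) (hyx : y * x = 1) (hc : c ≠ 0) (h : x * a = c • (a * x)) :
    y * a = c⁻¹ • (a * y) := by
  have h1 : y * (x * a) * y = c • (y * (a * x) * y) := by
    rw [h, mul_smul_comm, smul_mul_assoc]
  rw [← mul_assoc, hyx, one_mul, mul_assoc y, mul_assoc a, hxy, mul_one] at h1
  rw [h1, inv_smul_smul₀ hc]

section LeftIdeal

variable {K A : Type*} [CommSemiring K] [Semiring A] [Algebra K A]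

/-- The elements x with x N ⊆ N form a subalgebra, so stability under generators makes N a left
ideal. It is used for kernels of linear maps, which gives uniqueness statements, and for the span of
products of the two Borel subalgebras. -/
theorem Submodule.eq_top_of_mul_mem {s : Set A} (hs : Algebra.adjoin K s = ⊤) (N : Submodule K A)
    (h1 : 1 ∈ N) (hmul : ∀ x ∈ s, ∀ a ∈ N, x * a ∈ N) : N = ⊤ := by
  rw [eq_top_iff]
  rintro x -
  have hx : x ∈ Algebra.adjoin K s := hs ▸ Algebra.mem_top
  have key : ∀ a ∈ N, x * a ∈ N := by
    induction hx using Algebra.adjoin_induction with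
    | mem x hx => exact hmul x hx
    | algebraMap c => intro a ha; rw [← Algebra.smul_def]; exact N.smul_mem _ ha
    | add x y _ _ hx hy => intro a ha; rw [add_mul]; exact N.add_mem (hx a ha) (hy a ha)
    | mul x y _ _ hx hy => intro a ha; rw [mul_assoc]; exact hx _ (hy a ha)
  simpa using key 1 h1

end LeftIdeal

/-! ### Models of the positive Borel relations, their rescalings and first-order deformations. -/

namespace QParams

universe u

section

variable {K : Type*} [Field K] (P : QParams K)

/-- A family of elements of an algebra that satisfies the relations of the positive Borel
subalgebra. -/
structure IsPosModel {A : Type*} [Ring A] [Algebra K A] (e : P.Idx → A) (t tinv : P.BTor → A) :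
    Prop where
  t_tinv (x : P.BTor) : t x * tinv x = 1
  tinv_t (x : P.BTor) : tinv x * t x = 1
  t_comm (x y : P.BTor) : t x * t y = t y * t x
  γ_sq : t .γ ^ 2 = (List.ofFn fun i : P.Idx => t (.ω i)).prod
  te (x : P.BTor) (i : P.Idx) : t x * e i = P.wt x.pos i • (e i * t x)
  e_comm (i j : P.Idx) (h : P.cartan i j = 0) : e i * e j = e j * e i
  e_serre (i : P.Idx) : qSerre P.r P.s (e i) (e (i + 1)) = 0
  e_serre' (i : P.Idx) : qSerre' P.r P.s (e i) (e (i + 1)) = 0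

/-- The set of generators of a model of the positive Borel subalgebra. -/
def borelGens {A : Type*} (e : P.Idx → A) (t tinv : P.BTor → A) : Set A :=
  Set.range e ∪ Set.range t ∪ Set.range tinv

end

section

variable {K : Type u} [Field K] (P : QParams K)

/-- An algebra presented by the relations of the positive Borel subalgebra. -/
structure IsPosUniv {A : Type u} [Ring A] [Algebra K A] (e : P.Idx → A) (t tinv : P.BTor → A) :
    Prop extends P.IsPosModel e t tinv where
  adjoin_eq_top : Algebra.adjoin K (P.borelGens e t tinv) = ⊤
  -- Targets in the universe of A suffice: the ones that occur are A itself, the Borel subalgebras,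
  -- their endomorphism algebras, dual numbers over these, and opposite algebras.
  exists_lift {B : Type u} [Ring B] [Algebra K B] {e' : P.Idx → B} {t' tinv' : P.BTor → B}
    (h : P.IsPosModel e' t' tinv') : ∃ φ : A →ₐ[K] B,
      (∀ i, φ (e i) = e' i) ∧ (∀ x, φ (t x) = t' x) ∧ (∀ x, φ (tinv x) = tinv' x)

end

namespace IsPosModel

variable {K : Type*} [Field K] {P : QParams K} {A B : Type*} [Ring A] [Algebra K A] [Ring B]
  [Algebra K B] {e : P.Idx → A} {t tinv : P.BTor → A}

theorem map (h : P.IsPosModel e t tinv) (φ : A →ₐ[K] B) :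
    P.IsPosModel (fun i => φ (e i)) (fun x => φ (t x)) (fun x => φ (tinv x)) where
  t_tinv x := by rw [← map_mul, h.t_tinv, map_one]
  tinv_t x := by rw [← map_mul, h.tinv_t, map_one]
  t_comm x y := by rw [← map_mul, h.t_comm, map_mul]
  γ_sq := by rw [← map_pow, h.γ_sq, map_list_prod, List.map_ofFn]; rfl
  te x i := by rw [← map_mul, h.te, map_smul, map_mul]
  e_comm i j hc := by rw [← map_mul, h.e_comm i j hc, map_mul]
  e_serre i := by rw [← map_qSerre, h.e_serre, map_zero]
  e_serre' i := by rw [← map_qSerre', h.e_serre', map_zero]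

/-- Used for the inclusion of a Borel subalgebra, so that its relations can be read off in U. -/
theorem of_map (φ : A →ₐ[K] B) (hφ : Function.Injective φ)
    (h : P.IsPosModel (fun i => φ (e i)) (fun x => φ (t x)) (fun x => φ (tinv x))) :
    P.IsPosModel e t tinv where
  t_tinv x := hφ (by rw [map_mul, h.t_tinv, map_one])
  tinv_t x := hφ (by rw [map_mul, h.tinv_t, map_one])
  t_comm x y := hφ (by rw [map_mul, h.t_comm, map_mul])
  γ_sq := hφ (by rw [map_pow, h.γ_sq, map_list_prod, List.map_ofFn]; rfl)
  te x i := hφ (by rw [map_mul, h.te, map_smul, map_mul])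
  e_comm i j hc := hφ (by rw [map_mul, h.e_comm i j hc, map_mul])
  e_serre i := hφ (by rw [map_qSerre, h.e_serre, map_zero])
  e_serre' i := hφ (by rw [map_qSerre', h.e_serre', map_zero])

/-- Rescaling the generators of a model. -/
theorem scale (h : P.IsPosModel e t tinv) (l : P.Idx → K) (m : P.BTor → K) (hm : ∀ x, m x ≠ 0)
    (hγ : m .γ ^ 2 = (List.ofFn fun i : P.Idx => m (.ω i)).prod) :
    P.IsPosModel (fun i => l i • e i) (fun x => m x • t x) (fun x => (m x)⁻¹ • tinv x) where
  t_tinv x := by simp [h.t_tinv, hm]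
  tinv_t x := by simp [h.tinv_t, hm]
  t_comm x y := by simp [h.t_comm x y, smul_smul, mul_comm]
  γ_sq := by
    rw [smul_pow, h.γ_sq, hγ]
    simp only [List.ofFn_eq_map]
    induction List.finRange P.n with
    | nil => simp
    | cons i l ih => simp [← ih, smul_smul, mul_comm]
  te x i := by
    simp only [smul_mul_assoc, mul_smul_comm, h.te]
    module
  e_comm i j hc := by simp [h.e_comm i j hc, smul_smul, mul_comm]
  e_serre i := by rw [qSerre_smul, h.e_serre, smul_zero]
  e_serre' i := by rw [qSerre'_smul, h.e_serre', smul_zero]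

open TrivSqZeroExt in
/-- First order deformations of a model along the `e_i`. -/
theorem deform (h : P.IsPosModel e t tinv) (z : P.Idx → A)
    (hz : ∀ x i, t x * z i = P.wt x.pos i • (z i * t x))
    (hc : ∀ i j, P.cartan i j = 0 → z i * e j = e j * z i)
    (hs : ∀ i, qSerreDeriv P.r P.s (e i) (e (i + 1)) (z i) = 0)
    (hs₂ : ∀ i, qSerre P.r P.s (e i) (z (i + 1)) = 0)
    (hs' : ∀ i, qSerreDeriv' P.r P.s (e i) (e (i + 1)) (z (i + 1)) = 0)
    (hs'₂ : ∀ i, qSerre' P.r P.s (z i) (e (i + 1)) = 0) :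
    P.IsPosModel (A := DualNumber A) (fun i => inl (e i) + inr (z i)) (fun x => inl (t x))
      (fun x => inl (tinv x)) where
  t_tinv x := by rw [← inl_mul, h.t_tinv, inl_one]
  tinv_t x := by rw [← inl_mul, h.tinv_t, inl_one]
  t_comm x y := by rw [← inl_mul, h.t_comm, inl_mul]
  γ_sq := by
    have := congrArg (inlAlgHom K A A) h.γ_sq
    rw [map_pow, map_list_prod, List.map_ofFn] at this
    exact this
  te x i := by ext <;> simp [h.te, hz]
  e_comm i j hij := by
    ext
    · simp [h.e_comm i j hij]
    · simp [hc i j hij, hc j i (P.cartan_symm i j ▸ hij)]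
      abel
  e_serre i := by
    ext
    · rw [← fstHom_apply K, map_qSerre]
      simp [h.e_serre]
    · rw [snd_qSerre, hs, hs₂]; simp
  e_serre' i := by
    ext
    · rw [← fstHom_apply K, map_qSerre']
      simp [h.e_serre']
    · rw [snd_qSerre', hs', hs'₂]; simp

end IsPosModel

/-! ### Products of weights over the affine diagram, and the values of the pairing on invertible
generators. -/

section

variable {K : Type*} [Field K] (P : QParams K)

/-- The factor r/s at j = i is cancelled by r⁻¹ at j = i + 1 and s at j = i - 1. This is the
orthogonality of δ to the simple roots: γ commutes with e_i. -/
theorem prod_chi_right (i : P.Idx) : ∏ j, P.chi P.r P.s i j = 1 := by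
  have hr := P.r_ne_zero
  have hs := P.s_ne_zero
  -- Each of the four factors differs from 1 at a single index, so the product over the diagram is
  -- evaluated factor by factor.
  have h (j : P.Idx) : P.chi P.r P.s i j =
      ((if i = j then P.r else 1) * (if i = j then P.s⁻¹ else 1)) *
      ((if j = i + 1 then P.r⁻¹ else 1) * (if j = i - 1 then P.s else 1)) := by
    have : i = j + 1 ↔ j = i - 1 := by rw [eq_sub_iff_add_eq, eq_comm]
    rw [chi_exp, zpow_sub₀ hr, zpow_sub₀ hs]
    simp only [this]
    split_ifs <;> simp <;> ring
  simp only [h, Finset.prod_mul_distrib, Finset.prod_ite_eq, Finset.prod_ite_eq',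
    Finset.mem_univ, if_true]
  field_simp

theorem prod_chi_left (j : P.Idx) : ∏ i, P.chi P.r P.s i j = 1 := by
  have hr := P.r_ne_zero
  have hs := P.s_ne_zero
  have h (i : P.Idx) : P.chi P.r P.s i j =
      ((if i = j then P.r else 1) * (if i = j then P.s⁻¹ else 1)) *
      ((if i = j - 1 then P.r⁻¹ else 1) * (if i = j + 1 then P.s else 1)) := by
    have : j = i + 1 ↔ i = j - 1 := by rw [eq_sub_iff_add_eq, eq_comm]
    rw [chi_exp, zpow_sub₀ hr, zpow_sub₀ hs]
    simp only [this]
    split_ifs <;> simp <;> ring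
  simp only [h, Finset.prod_mul_distrib, Finset.prod_ite_eq', Finset.mem_univ, if_true]
  field_simp

theorem pairVal_ne_zero (x y : P.BTor) : P.pairVal x y ≠ 0 := by
  have hr := P.r_ne_zero
  have hs := P.s_ne_zero
  have hrh := P.rh_ne_zero
  have hsh := P.sh_ne_zero
  cases x <;> cases y <;> simp only [pairVal, chi_exp] <;> (try split_ifs) <;>
    first | positivity | assumption | simp

/-- Pairing with ω'_i records how y acts on e_i. In the double this produces the relation between y
and f_i. -/
theorem pairVal_ω_left (i : P.Idx) (y : P.BTor) : P.pairVal (.ω i) y = P.wt y.pos i := by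
  cases y <;> rfl

/-- The counterpart for the relation between negative invertible generators and e_i. For x = ω'_j it
rests on `chi_swap`; for D' it explains the negative power of s in the prescribed values. -/
theorem pairVal_ω_right (i : P.Idx) (x : P.BTor) : P.pairVal x (.ω i) = (P.wt x.neg i)⁻¹ := by
  cases x with
  | ω j => simp [pairVal, wt, BTor.neg, chi_swap]
  | γ => simp [pairVal, wt, BTor.neg]
  | D => simp only [pairVal, wt, BTor.neg]; split_ifs <;> simp

/-- Compatibility of the prescribed values with γ = ω_0 ⋯ ω_{n-1}. The square root of s enters here:
⟨D', γ^{1/2}⟩ has to square to ⟨D', ω_0⟩ = s⁻¹, the other factors being 1. -/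
theorem pairVal_γ_right_sq (x : P.BTor) :
    P.pairVal x .γ ^ 2 = (List.ofFn fun i => P.pairVal x (.ω i)).prod := by
  rw [List.prod_ofFn]
  cases x with
  | ω j => simp [pairVal, prod_chi_right]
  | γ => simp [pairVal]
  | D => simp [pairVal, s]

/-- The analogous compatibility with γ' = ω'_0 ⋯ ω'_{n-1}; here ⟨γ'^{1/2}, D⟩ has to square to r. -/
theorem pairVal_γ_left_sq (y : P.BTor) :
    P.pairVal .γ y ^ 2 = ∏ i, P.pairVal (.ω i) y := by
  cases y with
  | ω j => simp [pairVal, prod_chi_left]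
  | γ => simp [pairVal]
  | D => simp [pairVal, r]

theorem prod_wt_neg (i : P.Idx) : ∏ j, P.wt (.ω' j) i = 1 := by
  have h (j : P.Idx) : P.wt (.ω' j) i = (P.chi P.r P.s j i)⁻¹ := P.chi_swap i j
  simp only [h, Finset.prod_inv_distrib, prod_chi_left, inv_one]

/-- A rescaling of the generators of the positive Borel subalgebra. -/
structure Scaling where
  l : P.Idx → K
  m : P.BTor → K
  l_ne_zero (i : P.Idx) : l i ≠ 0
  m_ne_zero (x : P.BTor) : m x ≠ 0
  γ_sq : m .γ ^ 2 = (List.ofFn fun i : P.Idx => m (.ω i)).prod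

variable {P}

/-- The inverse rescaling. -/
@[simps]
def Scaling.inv (c : P.Scaling) : P.Scaling where
  l i := (c.l i)⁻¹
  m x := (c.m x)⁻¹
  l_ne_zero i := inv_ne_zero (c.l_ne_zero i)
  m_ne_zero x := inv_ne_zero (c.m_ne_zero x)
  γ_sq := by
    rw [inv_pow, c.γ_sq, List.prod_ofFn, List.prod_ofFn, Finset.prod_inv_distrib]

/-- The rescaling `e_j ↦ e_j`, `y ↦ ⟨x, y⟩ y`. -/
@[simps]
def Scaling.pair (x : P.BTor) : P.Scaling where
  l _ := 1
  m y := P.pairVal x y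
  l_ne_zero _ := one_ne_zero
  m_ne_zero y := P.pairVal_ne_zero x y
  γ_sq := P.pairVal_γ_right_sq x

/-- The rescaling given by conjugation with an invertible generator of the negative Borel
subalgebra. -/
@[simps]
def Scaling.conj (x : P.BTor) : P.Scaling where
  l i := P.wt x.neg i
  m _ := 1
  l_ne_zero _ := P.wt_ne_zero _ _
  m_ne_zero _ := one_ne_zero
  γ_sq := by simp

end

/-! ### Rescaling automorphisms of the universal positive Borel algebra. -/

namespace IsPosUniv

variable {K : Type u} [Field K] {P : QParams K} {A : Type u} [Ring A] [Algebra K A]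
  {e : P.Idx → A} {t tinv : P.BTor → A}

theorem algHom_ext (h : P.IsPosUniv e t tinv) {B : Type*} [Ring B] [Algebra K B]
    {φ ψ : A →ₐ[K] B} (he : ∀ i, φ (e i) = ψ (e i)) (ht : ∀ x, φ (t x) = ψ (t x))
    (hti : ∀ x, φ (tinv x) = ψ (tinv x)) : φ = ψ := by
  refine AlgHom.ext_of_adjoin_eq_top h.adjoin_eq_top ?_
  rintro _ ((⟨i, rfl⟩ | ⟨x, rfl⟩) | ⟨x, rfl⟩)
  exacts [he i, ht x, hti x]

/-- The linear counterpart of `algHom_ext`, applied to differences of linear maps that satisfy the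
same recursion under left multiplication by generators. -/
theorem linearMap_eq_zero (h : P.IsPosUniv e t tinv) {M : Type*} [AddCommGroup M] [Module K M]
    {X : A →ₗ[K] M} (h1 : X 1 = 0)
    (he : ∀ i a, X a = 0 → X (e i * a) = 0) (ht : ∀ x a, X a = 0 → X (t x * a) = 0)
    (hti : ∀ x a, X a = 0 → X (tinv x * a) = 0) : X = 0 := by
  rw [← LinearMap.ker_eq_top]
  refine Submodule.eq_top_of_mul_mem h.adjoin_eq_top _ h1 ?_
  rintro _ ((⟨i, rfl⟩ | ⟨x, rfl⟩) | ⟨x, rfl⟩) a ha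
  exacts [he i a ha, ht x a ha, hti x a ha]

/-- The automorphism that rescales the generators. -/
noncomputable def scaleHom (h : P.IsPosUniv e t tinv) (c : P.Scaling) : A →ₐ[K] A :=
  (h.exists_lift (h.toIsPosModel.scale c.l c.m c.m_ne_zero c.γ_sq)).choose

section

variable (h : P.IsPosUniv e t tinv) (c : P.Scaling)

theorem scaleHom_e (i : P.Idx) : h.scaleHom c (e i) = c.l i • e i :=
  (h.exists_lift (h.toIsPosModel.scale c.l c.m c.m_ne_zero c.γ_sq)).choose_spec.1 i

theorem scaleHom_t (x : P.BTor) : h.scaleHom c (t x) = c.m x • t x :=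
  (h.exists_lift (h.toIsPosModel.scale c.l c.m c.m_ne_zero c.γ_sq)).choose_spec.2.1 x

theorem scaleHom_tinv (x : P.BTor) : h.scaleHom c (tinv x) = (c.m x)⁻¹ • tinv x :=
  (h.exists_lift (h.toIsPosModel.scale c.l c.m c.m_ne_zero c.γ_sq)).choose_spec.2.2 x

theorem scaleHom_scaleHom_inv (a : A) : h.scaleHom c (h.scaleHom c.inv a) = a := by
  have : (h.scaleHom c).comp (h.scaleHom c.inv) = AlgHom.id K A := by
    apply h.algHom_ext <;> intro i <;>
      simp [scaleHom_e, scaleHom_t, scaleHom_tinv, smul_smul, c.l_ne_zero, c.m_ne_zero]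
  exact DFunLike.congr_fun this a

theorem scaleHom_inv_scaleHom (a : A) : h.scaleHom c.inv (h.scaleHom c a) = a := by
  have : (h.scaleHom c.inv).comp (h.scaleHom c) = AlgHom.id K A := by
    apply h.algHom_ext <;> intro i <;>
      simp [scaleHom_e, scaleHom_t, scaleHom_tinv, smul_smul, c.l_ne_zero, c.m_ne_zero]
  exact DFunLike.congr_fun this a

/-! ### Deformations of left multiplication and the lowering operators. -/

/-- `a ↦ c₁ σ_i⁻¹(ω_i a) + c₂ σ_i⁻¹(τ_i(a))`, where `σ_i` is the rescaling by `⟨ω'_i, -⟩` and `τ_i`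
is conjugation with `ω'_i`. -/
noncomputable def derivValue (c₁ c₂ : K) (i : P.Idx) : Module.End K A :=
  c₁ • ((h.scaleHom (Scaling.pair (.ω i)).inv).toLinearMap * Algebra.lmul K A (t (.ω i))) +
    c₂ • ((h.scaleHom (Scaling.pair (.ω i)).inv).toLinearMap *
      (h.scaleHom (Scaling.conj (.ω i))).toLinearMap)

/-- The scalars of the two summands, the weights of e_j under ω_i and under ω'_i, differ in general.
The linearised relations are linear in the direction, so they can be checked on each summand
separately. -/
theorem derivValue_summands_e (i j : P.Idx) :
    (h.scaleHom (Scaling.pair (.ω i)).inv).toLinearMap * Algebra.lmul K A (t (.ω i)) *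
        Algebra.lmul K A (e j) = P.wt (.ω i) j • (Algebra.lmul K A (e j) *
      ((h.scaleHom (Scaling.pair (.ω i)).inv).toLinearMap * Algebra.lmul K A (t (.ω i)))) ∧
    (h.scaleHom (Scaling.pair (.ω i)).inv).toLinearMap *
        (h.scaleHom (Scaling.conj (.ω i))).toLinearMap *
        Algebra.lmul K A (e j) = P.wt (.ω' i) j • (Algebra.lmul K A (e j) *
      ((h.scaleHom (Scaling.pair (.ω i)).inv).toLinearMap *
        (h.scaleHom (Scaling.conj (.ω i))).toLinearMap)) := by
  constructor
  · ext a
    have : t (.ω i) * (e j * a) = P.wt (.ω i) j • (e j * (t (.ω i) * a)) := by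
      rw [← mul_assoc, h.te, smul_mul_assoc, mul_assoc]; rfl
    simp [this, scaleHom_e]
  · ext a
    simp [scaleHom_e, BTor.neg]

/-- Multiplication by ω_i and conjugation by ω'_i both commute with multiplication by t x; the
weight comes from σ_i⁻¹ alone. This is why σ_i⁻¹ is built into `derivValue`: the direction of
deformation must have the same weight as e_i. -/
theorem lmul_t_derivValue (c₁ c₂ : K) (x : P.BTor) (i : P.Idx) :
    Algebra.lmul K A (t x) * h.derivValue c₁ c₂ i =
      P.wt x.pos i • (h.derivValue c₁ c₂ i * Algebra.lmul K A (t x)) := by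
  have hw := P.wt_ne_zero x.pos i
  ext a
  have : t (.ω i) * (t x * a) = t x * (t (.ω i) * a) := by
    rw [← mul_assoc, h.t_comm, mul_assoc]
  simp [derivValue, this, scaleHom_t,
    pairVal_ω_left, smul_smul, mul_add]
  match_scalars <;> field_simp

theorem isPosModel_lmul (h : P.IsPosUniv e t tinv) : P.IsPosModel (fun i => Algebra.lmul K A (e i))
    (fun x => Algebra.lmul K A (t x)) (fun x => Algebra.lmul K A (tinv x)) :=
  h.toIsPosModel.map (Algebra.lmul K A)

/-- The scalars are those of the two summands: r/s, s/r for e_i itself, s, r for e_{i+1}, and r⁻¹,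
s⁻¹ for e_{i-1}. With u = r and v = s they satisfy the identities required by `qSerreDeriv_eq_zero`,
`qSerre_eq_zero_of_comm` and their primed versions. Generators that are not linked in the diagram
have weight 1. -/
theorem isPosModel_deriv (c₁ c₂ : K) (i : P.Idx) : P.IsPosModel (A := DualNumber (Module.End K A))
    (fun j => .inl (Algebra.lmul K A (e j)) + .inr (if j = i then h.derivValue c₁ c₂ i else 0))
    (fun x => .inl (Algebra.lmul K A (t x))) (fun x => .inl (Algebra.lmul K A (tinv x))) := by
  have hr := P.r_ne_zero
  have hs := P.s_ne_zero
  refine h.isPosModel_lmul.deform _ (fun x j => ?_) (fun j k hc => ?_) (fun j => ?_) (fun j => ?_)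
    (fun j => ?_) (fun j => ?_)
  · split_ifs with hj
    · subst hj; exact h.lmul_t_derivValue c₁ c₂ x j
    · simp
  · split_ifs with hj
    · subst hj
      have h1 : P.wt (.ω j) k = 1 := P.chi_zero _ _ (P.cartan_symm j k ▸ hc)
      have h2 : P.wt (.ω' j) k = 1 := P.chi_zero _ _ (P.cartan_symm j k ▸ hc)
      obtain ⟨h3, h4⟩ := h.derivValue_summands_e j k
      rw [derivValue, add_mul, mul_add, smul_mul_assoc, smul_mul_assoc, h3, h4, h1, h2, one_smul,
        one_smul, mul_smul_comm, mul_smul_comm]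
    · simp
  · split_ifs with hj
    · subst hj
      obtain ⟨h1, h2⟩ := h.derivValue_summands_e j j
      obtain ⟨h3, h4⟩ := h.derivValue_summands_e j (j + 1)
      simp only [wt, chi_self, chi_left] at h1 h2 h3 h4
      rw [derivValue, qSerreDeriv_lin, qSerreDeriv_eq_zero h1 h3, qSerreDeriv_eq_zero h2 h4] <;>
        first | (field_simp; done) | (field_simp; ring) | simp
    · simp [qSerreDeriv]
  · split_ifs with hj
    · subst hj
      obtain ⟨h1, h2⟩ := h.derivValue_summands_e (j + 1) j
      simp only [wt, chi_right] at h1 h2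
      rw [derivValue, qSerre_lin, qSerre_eq_zero_of_comm h1, qSerre_eq_zero_of_comm h2] <;>
        first | (field_simp; done) | (field_simp; ring) | simp
    · simp [qSerre]
  · split_ifs with hj
    · subst hj
      obtain ⟨h1, h2⟩ := h.derivValue_summands_e (j + 1) (j + 1)
      obtain ⟨h3, h4⟩ := h.derivValue_summands_e (j + 1) j
      simp only [wt, chi_self, chi_right] at h1 h2 h3 h4
      rw [derivValue, qSerreDeriv'_lin, qSerreDeriv'_eq_zero h1 h3, qSerreDeriv'_eq_zero h2 h4] <;>
        first | (field_simp; done) | (field_simp; ring) | simp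
    · simp [qSerreDeriv']
  · split_ifs with hj
    · subst hj
      obtain ⟨h1, h2⟩ := h.derivValue_summands_e j (j + 1)
      simp only [wt, chi_left] at h1 h2
      rw [derivValue, qSerre'_lin, qSerre'_eq_zero_of_comm h1, qSerre'_eq_zero_of_comm h2] <;>
        first | (field_simp; done) | (field_simp; ring) | simp
    · simp [qSerre']

/-- The deformation of left multiplication that underlies the lowering operators. -/
noncomputable def derivHom (c₁ c₂ : K) (i : P.Idx) : A →ₐ[K] DualNumber (Module.End K A) :=
  (h.exists_lift (h.isPosModel_deriv c₁ c₂ i)).choose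

theorem derivHom_e (c₁ c₂ : K) (i j : P.Idx) : h.derivHom c₁ c₂ i (e j) =
    .inl (Algebra.lmul K A (e j)) + .inr (if j = i then h.derivValue c₁ c₂ i else 0) :=
  (h.exists_lift (h.isPosModel_deriv c₁ c₂ i)).choose_spec.1 j

theorem derivHom_t (c₁ c₂ : K) (i : P.Idx) (x : P.BTor) :
    h.derivHom c₁ c₂ i (t x) = .inl (Algebra.lmul K A (t x)) :=
  (h.exists_lift (h.isPosModel_deriv c₁ c₂ i)).choose_spec.2.1 x

theorem derivHom_tinv (c₁ c₂ : K) (i : P.Idx) (x : P.BTor) :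
    h.derivHom c₁ c₂ i (tinv x) = .inl (Algebra.lmul K A (tinv x)) :=
  (h.exists_lift (h.isPosModel_deriv c₁ c₂ i)).choose_spec.2.2 x

theorem fst_derivHom (c₁ c₂ : K) (i : P.Idx) (a : A) :
    (h.derivHom c₁ c₂ i a).fst = Algebra.lmul K A a := by
  have : (TrivSqZeroExt.fstHom K (Module.End K A) (Module.End K A)).comp (h.derivHom c₁ c₂ i) =
      Algebra.lmul K A := by
    apply h.algHom_ext <;> intro j <;>
      simp only [AlgHom.comp_apply, TrivSqZeroExt.fstHom_apply, derivHom_e, derivHom_t,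
        derivHom_tinv, TrivSqZeroExt.fst_add, TrivSqZeroExt.fst_inl, TrivSqZeroExt.fst_inr,
        add_zero]
  exact DFunLike.congr_fun this a

/-- The lowering operator `F_i`: the linear map with `F_i(1) = 0`, `F_i(y a) = ⟨ω'_i, y⟩ y F_i(a)`
for the invertible generators `y` and
`F_i(e_j a) = e_j F_i(a) + δ_{ij} (c₁ ω_i a + c₂ ω'_i a ω'_i⁻¹)`. -/
noncomputable def lower (c₁ c₂ : K) (i : P.Idx) : Module.End K A :=
  (h.scaleHom (Scaling.pair (.ω i))).toLinearMap ∘ₗ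
    { toFun := fun a => (h.derivHom c₁ c₂ i a).snd 1
      map_add' := by intro a b; simp
      map_smul' := by intro c a; simp }

theorem lower_apply (c₁ c₂ : K) (i : P.Idx) (a : A) :
    h.lower c₁ c₂ i a = h.scaleHom (Scaling.pair (.ω i)) ((h.derivHom c₁ c₂ i a).snd 1) := rfl

theorem lower_one (c₁ c₂ : K) (i : P.Idx) : h.lower c₁ c₂ i 1 = 0 := by
  simp [lower_apply]

/-- Leibniz rule in the dual numbers, evaluated at 1. The outer σ_i fixes e_j and cancels the σ_i⁻¹
inside `derivValue`. -/
theorem lower_e_mul (c₁ c₂ : K) (i j : P.Idx) (a : A) : h.lower c₁ c₂ i (e j * a) =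
    e j * h.lower c₁ c₂ i a +
      if j = i then c₁ • (t (.ω i) * a) + c₂ • h.scaleHom (Scaling.conj (.ω i)) a else 0 := by
  have h1 : (h.derivHom c₁ c₂ i (e j)).snd = if j = i then h.derivValue c₁ c₂ i else 0 := by
    rw [derivHom_e, TrivSqZeroExt.snd_add, TrivSqZeroExt.snd_inl, TrivSqZeroExt.snd_inr, zero_add]
  simp only [lower_apply, map_mul, TrivSqZeroExt.snd_mul, fst_derivHom, h1]
  split_ifs <;> simp [scaleHom_e, derivValue, scaleHom_scaleHom_inv]

/-- The invertible generators are not deformed; the scalar is the effect of the outer σ_i on t x. -/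
theorem lower_t_mul (c₁ c₂ : K) (i : P.Idx) (x : P.BTor) (a : A) :
    h.lower c₁ c₂ i (t x * a) = P.wt x.pos i • (t x * h.lower c₁ c₂ i a) := by
  simp [lower_apply, fst_derivHom, derivHom_t, scaleHom_t, pairVal_ω_left]

theorem lower_tinv_mul (c₁ c₂ : K) (i : P.Idx) (x : P.BTor) (a : A) :
    h.lower c₁ c₂ i (tinv x * a) = (P.wt x.pos i)⁻¹ • (tinv x * h.lower c₁ c₂ i a) := by
  simp [lower_apply, fst_derivHom, derivHom_tinv, scaleHom_tinv, pairVal_ω_left]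

/-- Both sides obey the same recursion on e_j a exactly when the inhomogeneous term at j = i scales
correctly. Its ω_i part scales by m(ω_i), its conjugation part by 1, and the right-hand side by k
l_i. The factors c₁ and c₂ are kept in the hypotheses so that an absent summand imposes nothing; the
pairing uses this with c₂ = 0. -/
theorem scaleHom_lower (c₁ c₂ k : K) (i : P.Idx) (h₁ : c₁ * c.m (.ω i) = c₁ * (k * c.l i))
    (h₂ : c₂ = c₂ * (k * c.l i)) (a : A) :
    h.scaleHom c (h.lower c₁ c₂ i a) = k • h.lower c₁ c₂ i (h.scaleHom c a) := by
  have hcomm (a : A) : h.scaleHom c (h.scaleHom (Scaling.conj (.ω i)) a) =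
      h.scaleHom (Scaling.conj (.ω i)) (h.scaleHom c a) := by
    have : (h.scaleHom c).comp (h.scaleHom (Scaling.conj (.ω i))) =
        (h.scaleHom (Scaling.conj (.ω i))).comp (h.scaleHom c) := by
      apply h.algHom_ext <;> intro j <;>
        simp [scaleHom_e, scaleHom_t, scaleHom_tinv, smul_smul, mul_comm]
    exact DFunLike.congr_fun this a
  have key : (h.scaleHom c).toLinearMap ∘ₗ h.lower c₁ c₂ i -
      k • h.lower c₁ c₂ i ∘ₗ (h.scaleHom c).toLinearMap = 0 := by
    apply h.linearMap_eq_zero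
    · simp [lower_one]
    · intro j a ha
      simp only [LinearMap.sub_apply, LinearMap.comp_apply, LinearMap.smul_apply,
        AlgHom.toLinearMap_apply, sub_eq_zero] at ha ⊢
      simp only [lower_e_mul, map_add, map_mul, scaleHom_e, smul_mul_assoc, map_smul, ha, smul_add]
      split_ifs with hj
      · subst hj
        simp only [map_add, map_smul, map_mul, scaleHom_t, hcomm, smul_mul_assoc, smul_add,
          smul_smul, mul_smul_comm, h₁]
        have h₂' (z : A) : c₂ • z = (c₂ * (k * c.l j)) • z := by rw [← h₂]
        rw [h₂']
        simp only [mul_comm, mul_left_comm]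
      · simp [smul_smul, mul_comm]
    · intro x a ha
      simp only [LinearMap.sub_apply, LinearMap.comp_apply, LinearMap.smul_apply,
        AlgHom.toLinearMap_apply, sub_eq_zero] at ha ⊢
      simp only [lower_t_mul, map_mul, scaleHom_t, smul_mul_assoc, map_smul, ha, mul_smul_comm,
        smul_smul]
      ring_nf
    · intro x a ha
      simp only [LinearMap.sub_apply, LinearMap.comp_apply, LinearMap.smul_apply,
        AlgHom.toLinearMap_apply, sub_eq_zero] at ha ⊢
      simp only [lower_tinv_mul, map_mul, scaleHom_tinv, smul_mul_assoc, map_smul, ha,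
        mul_smul_comm, smul_smul]
      ring_nf
  exact sub_eq_zero.1 (LinearMap.congr_fun key a)

/-! ### The lowering operators satisfy the relations of the f_i. -/

/-- The commutator of `e_j` and the lowering operator `F_i`, up to sign. -/
noncomputable def lowerValue (c₁ c₂ : K) (i : P.Idx) : Module.End K A :=
  (-c₁) • Algebra.lmul K A (t (.ω i)) + (-c₂) • (h.scaleHom (Scaling.conj (.ω i))).toLinearMap

theorem lmul_e_lower (c₁ c₂ : K) (i j : P.Idx) : Algebra.lmul K A (e j) * h.lower c₁ c₂ i =
    h.lower c₁ c₂ i * Algebra.lmul K A (e j) + if j = i then h.lowerValue c₁ c₂ i else 0 := by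
  ext a
  split_ifs with hj <;> simp [lower_e_mul, lowerValue, hj]
  abel

theorem lmul_t_lower (c₁ c₂ : K) (i : P.Idx) (x : P.BTor) :
    Algebra.lmul K A (t x) * h.lower c₁ c₂ i =
    (P.wt x.pos i)⁻¹ • (h.lower c₁ c₂ i * Algebra.lmul K A (t x)) := by
  ext a
  simp [lower_t_mul, P.wt_ne_zero]

/-- Conjugation has m = 1 and l_i equal to the weight, so k must be the inverse weight. -/
theorem conj_lower (c₁ c₂ : K) (i : P.Idx) (x : P.BTor) :
    (h.scaleHom (Scaling.conj x)).toLinearMap * h.lower c₁ c₂ i =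
    (P.wt x.neg i)⁻¹ • (h.lower c₁ c₂ i * (h.scaleHom (Scaling.conj x)).toLinearMap) := by
  ext a
  exact h.scaleHom_lower _ c₁ c₂ _ i (by simp [P.wt_ne_zero])
    (by simp [P.wt_ne_zero]) a

/-- An operator that kills `1`, commutes with the `e_j` and commutes up to scalars with the
invertible generators is zero. -/
theorem end_eq_zero (h : P.IsPosUniv e t tinv) {X : Module.End K A} (h1 : X 1 = 0)
    (he : ∀ i, Algebra.lmul K A (e i) * X = X * Algebra.lmul K A (e i))
    (ht : ∀ x, ∃ k : K, k ≠ 0 ∧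
      Algebra.lmul K A (t x) * X = k • (X * Algebra.lmul K A (t x))) : X = 0 := by
  apply h.linearMap_eq_zero h1
  · intro i a ha
    have := LinearMap.congr_fun (he i) a
    simpa [ha] using this.symm
  · intro x a ha
    obtain ⟨k, hk, hx⟩ := ht x
    have := LinearMap.congr_fun hx a
    simpa [ha, hk] using this.symm
  · intro x a ha
    obtain ⟨k, hk, hx⟩ := ht x
    have := LinearMap.congr_fun (inv_mul_semiconj (h.isPosModel_lmul.t_tinv x)
      (h.isPosModel_lmul.tinv_t x) hk hx) a
    simpa [ha, hk] using this.symm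

/-- The commutator of F_i and F_j kills 1. It commutes with every e_k: all weights between unlinked
indices are 1, so `lowerValue` for one index commutes with the lowering operator of the other, and
the correction terms cancel. Then `end_eq_zero` applies. -/
theorem lower_comm (c₁ c₂ : K) (i j : P.Idx) (hc : P.cartan i j = 0) :
    h.lower c₁ c₂ i * h.lower c₁ c₂ j = h.lower c₁ c₂ j * h.lower c₁ c₂ i := by
  rw [← sub_eq_zero]
  have hw (i j : P.Idx) (hc : P.cartan i j = 0) :
      h.lowerValue c₁ c₂ i * h.lower c₁ c₂ j = h.lower c₁ c₂ j * h.lowerValue c₁ c₂ i := by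
    have h1 := h.lmul_t_lower c₁ c₂ j (.ω i)
    have h2 := h.conj_lower c₁ c₂ j (.ω i)
    have h3 : P.wt (.ω i) j = 1 := P.chi_zero _ _ (P.cartan_symm i j ▸ hc)
    have h4 : P.wt (.ω' i) j = 1 := P.chi_zero _ _ (P.cartan_symm i j ▸ hc)
    simp only [BTor.pos, BTor.neg, h3, h4, inv_one, one_smul] at h1 h2
    simp only [lowerValue, add_mul, mul_add, smul_mul_assoc, mul_smul_comm, h1, h2]
  apply h.end_eq_zero
  · simp [lower_one]
  · intro k
    have h1 (i j : P.Idx) (hc : P.cartan i j = 0) :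
        Algebra.lmul K A (e k) * (h.lower c₁ c₂ i * h.lower c₁ c₂ j) =
        h.lower c₁ c₂ i * h.lower c₁ c₂ j * Algebra.lmul K A (e k) +
        ((if k = j then h.lower c₁ c₂ i * h.lowerValue c₁ c₂ j else 0) +
          if k = i then h.lower c₁ c₂ j * h.lowerValue c₁ c₂ i else 0) := by
      rw [← mul_assoc, lmul_e_lower, add_mul, mul_assoc, lmul_e_lower, mul_add, ite_mul, mul_ite,
        hw i j hc]
      simp only [mul_assoc, zero_mul, mul_zero, add_assoc]
    rw [mul_sub, sub_mul, h1 i j hc, h1 j i (P.cartan_symm i j ▸ hc)]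
    abel
  · intro x
    refine ⟨(P.wt x.pos i)⁻¹ * (P.wt x.pos j)⁻¹, by simp [P.wt_ne_zero], ?_⟩
    have h1 (i j : P.Idx) : Algebra.lmul K A (t x) * (h.lower c₁ c₂ i * h.lower c₁ c₂ j) =
        ((P.wt x.pos i)⁻¹ * (P.wt x.pos j)⁻¹) •
          (h.lower c₁ c₂ i * h.lower c₁ c₂ j * Algebra.lmul K A (t x)) := by
      rw [← mul_assoc, lmul_t_lower, smul_mul_assoc, mul_assoc, lmul_t_lower, mul_smul_comm,
        smul_smul, mul_assoc]
    rw [mul_sub, sub_mul, h1 i j, h1 j i, smul_sub, mul_comm (P.wt x.pos j)⁻¹]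

/-- By `end_eq_zero` it is enough to commute the Serre expression with each e_k. This gives its
linearisation along `lowerValue`, whose two summands q-commute with the lowering operators with
inverse weights. The scalar identities are therefore those of the e-relations with r⁻¹ and s⁻¹. -/
theorem lower_serre (c₁ c₂ : K) (i : P.Idx) :
    qSerre P.r⁻¹ P.s⁻¹ (h.lower c₁ c₂ i) (h.lower c₁ c₂ (i + 1)) = 0 := by
  have hr := P.r_ne_zero
  have hs := P.s_ne_zero
  apply h.end_eq_zero
  · simp [qSerre, pow_two, lower_one]
  · intro k
    -- The correction terms depend on k: the direction in the first argument is present for k = i,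
    -- that in the second for k = i + 1. Each vanishes by itself.
    rw [commutator_qSerre _ _ (h.lmul_e_lower _ _ _ k) (h.lmul_e_lower _ _ _ k), add_eq_left]
    have e1 : qSerreDeriv P.r⁻¹ P.s⁻¹ (h.lower c₁ c₂ i) (h.lower c₁ c₂ (i + 1))
        (h.lowerValue c₁ c₂ i) = 0 := by
      have h1 := h.lmul_t_lower c₁ c₂ i (.ω i)
      have h2 := h.conj_lower c₁ c₂ i (.ω i)
      have h3 := h.lmul_t_lower c₁ c₂ (i + 1) (.ω i)
      have h4 := h.conj_lower c₁ c₂ (i + 1) (.ω i)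
      simp only [BTor.pos, BTor.neg, wt, chi_self, chi_left] at h1 h2 h3 h4
      rw [lowerValue, qSerreDeriv_lin, qSerreDeriv_eq_zero h1 h3, qSerreDeriv_eq_zero h2 h4] <;>
        first | (field_simp; done) | (field_simp; ring) | simp
    have e2 : qSerre P.r⁻¹ P.s⁻¹ (h.lower c₁ c₂ i) (h.lowerValue c₁ c₂ (i + 1)) = 0 := by
      have h1 := h.lmul_t_lower c₁ c₂ i (.ω (i + 1))
      have h2 := h.conj_lower c₁ c₂ i (.ω (i + 1))
      simp only [BTor.pos, BTor.neg, wt, chi_right] at h1 h2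
      rw [lowerValue, qSerre_lin, qSerre_eq_zero_of_comm h1, qSerre_eq_zero_of_comm h2] <;>
        first | (field_simp; done) | (field_simp; ring) | simp
    split_ifs <;> (try simp only [e1, e2]) <;> simp [qSerre, qSerreDeriv]
  · intro x
    exact ⟨_, by simp [P.wt_ne_zero], qSerre_mul_semiconj _ _ (h.lmul_t_lower _ _ _ x)
      (h.lmul_t_lower _ _ _ x)⟩

theorem lower_serre' (c₁ c₂ : K) (i : P.Idx) :
    qSerre' P.r⁻¹ P.s⁻¹ (h.lower c₁ c₂ i) (h.lower c₁ c₂ (i + 1)) = 0 := by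
  have hr := P.r_ne_zero
  have hs := P.s_ne_zero
  apply h.end_eq_zero
  · simp [qSerre', pow_two, lower_one]
  · intro k
    rw [commutator_qSerre' _ _ (h.lmul_e_lower _ _ _ k) (h.lmul_e_lower _ _ _ k), add_eq_left]
    have e1 : qSerreDeriv' P.r⁻¹ P.s⁻¹ (h.lower c₁ c₂ i) (h.lower c₁ c₂ (i + 1))
        (h.lowerValue c₁ c₂ (i + 1)) = 0 := by
      have h1 := h.lmul_t_lower c₁ c₂ (i + 1) (.ω (i + 1))
      have h2 := h.conj_lower c₁ c₂ (i + 1) (.ω (i + 1))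
      have h3 := h.lmul_t_lower c₁ c₂ i (.ω (i + 1))
      have h4 := h.conj_lower c₁ c₂ i (.ω (i + 1))
      simp only [BTor.pos, BTor.neg, wt, chi_self, chi_right] at h1 h2 h3 h4
      rw [lowerValue, qSerreDeriv'_lin, qSerreDeriv'_eq_zero h1 h3, qSerreDeriv'_eq_zero h2 h4] <;>
        first | (field_simp; done) | (field_simp; ring) | simp
    have e2 : qSerre' P.r⁻¹ P.s⁻¹ (h.lowerValue c₁ c₂ i) (h.lower c₁ c₂ (i + 1)) = 0 := by
      have h1 := h.lmul_t_lower c₁ c₂ (i + 1) (.ω i)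
      have h2 := h.conj_lower c₁ c₂ (i + 1) (.ω i)
      simp only [BTor.pos, BTor.neg, wt, chi_left] at h1 h2
      rw [lowerValue, qSerre'_lin, qSerre'_eq_zero_of_comm h1, qSerre'_eq_zero_of_comm h2] <;>
        first | (field_simp; done) | (field_simp; ring) | simp
    split_ifs <;> (try simp only [e1, e2]) <;> simp [qSerre', qSerreDeriv']
  · intro x
    exact ⟨_, by simp [P.wt_ne_zero], qSerre'_mul_semiconj _ _ (h.lmul_t_lower _ _ _ x)
      (h.lmul_t_lower _ _ _ x)⟩

end

end IsPosUniv

/-! ### Existence of the abstractly presented positive Borel algebra. -/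

/-- A universal model of the positive Borel subalgebra exists. -/
theorem exists_isPosUniv {K : Type u} [Field K] (P : QParams K) :
    ∃ (A : Type u) (_ : Ring A) (_ : Algebra K A) (e : P.Idx → A) (t tinv : P.BTor → A),
      P.IsPosUniv e t tinv := by
  let G := P.Idx ⊕ P.BTor ⊕ P.BTor
  -- Two words are identified when they agree in every model in `Type u`. Each defining relation
  -- then holds in the quotient because it holds in all models, and evaluation in a model factors
  -- through the quotient by construction.
  let Rel : FreeAlgebra K G → FreeAlgebra K G → Prop := fun x y =>
    ∀ (B : Type u) [Ring B] [Algebra K B] (e : P.Idx → B) (t tinv : P.BTor → B),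
      P.IsPosModel e t tinv → FreeAlgebra.lift K (Sum.elim e (Sum.elim t tinv)) x =
        FreeAlgebra.lift K (Sum.elim e (Sum.elim t tinv)) y
  let π : FreeAlgebra K G →ₐ[K] RingQuot Rel := RingQuot.mkAlgHom K Rel
  have hπ {x y : FreeAlgebra K G} (h : Rel x y) : π x = π y := RingQuot.mkAlgHom_rel K h
  let e (i : P.Idx) : FreeAlgebra K G := FreeAlgebra.ι K (.inl i)
  let t (x : P.BTor) : FreeAlgebra K G := FreeAlgebra.ι K (.inr (.inl x))
  let tinv (x : P.BTor) : FreeAlgebra K G := FreeAlgebra.ι K (.inr (.inr x))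
  refine ⟨RingQuot Rel, inferInstance, inferInstance, fun i => π (e i), fun x => π (t x),
    fun x => π (tinv x), ⟨⟨fun x => ?_, fun x => ?_, fun x y => ?_, ?_, fun x i => ?_,
      fun i j hc => ?_, fun i => ?_, fun i => ?_⟩, ?_, fun {B} _ _ e' t' tinv' h => ?_⟩⟩
  · rw [← map_mul, ← map_one π]
    exact hπ fun B _ _ e' t' tinv' h => by simpa [t, tinv] using h.t_tinv x
  · rw [← map_mul, ← map_one π]
    exact hπ fun B _ _ e' t' tinv' h => by simpa [t, tinv] using h.tinv_t x
  · rw [← map_mul, ← map_mul]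
    exact hπ fun B _ _ e' t' tinv' h => by simpa [t] using h.t_comm x y
  · have : (List.ofFn fun i => π (t (.ω i))).prod = π (List.ofFn fun i => t (.ω i)).prod := by
      rw [map_list_prod, List.map_ofFn]; rfl
    rw [← map_pow, this]
    exact hπ fun B _ _ e' t' tinv' h => by
      simpa [t, map_list_prod, List.map_ofFn, Function.comp_def] using h.γ_sq
  · rw [← map_mul, ← map_mul, ← map_smul]
    exact hπ fun B _ _ e' t' tinv' h => by simpa [t, e] using h.te x i
  · rw [← map_mul, ← map_mul]
    exact hπ fun B _ _ e' t' tinv' h => by simpa [e] using h.e_comm i j hc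
  · rw [← map_qSerre, ← map_zero π]
    exact hπ fun B _ _ e' t' tinv' h => by simpa [e, map_qSerre] using h.e_serre i
  · rw [← map_qSerre', ← map_zero π]
    exact hπ fun B _ _ e' t' tinv' h => by simpa [e, map_qSerre'] using h.e_serre' i
  · rw [eq_top_iff]
    rintro x -
    obtain ⟨y, rfl⟩ := RingQuot.mkAlgHom_surjective K Rel x
    change π y ∈ _
    induction y using FreeAlgebra.induction with
    | grade0 c => rw [AlgHom.commutes]; exact Subalgebra.algebraMap_mem _ _
    | grade1 g =>
      apply Algebra.subset_adjoin
      obtain i | x | x := g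
      exacts [.inl (.inl ⟨i, rfl⟩), .inl (.inr ⟨x, rfl⟩), .inr ⟨x, rfl⟩]
    | mul a b ha hb => rw [map_mul]; exact mul_mem ha hb
    | add a b ha hb => rw [map_add]; exact add_mem ha hb
  · let ψ : RingQuot Rel →ₐ[K] B := RingQuot.liftAlgHom K
      ⟨FreeAlgebra.lift K (Sum.elim e' (Sum.elim t' tinv')), fun _ _ hxy => hxy B e' t' tinv' h⟩
    have hψ (x : FreeAlgebra K G) : ψ (π x) =
        FreeAlgebra.lift K (Sum.elim e' (Sum.elim t' tinv')) x :=
      RingQuot.liftAlgHom_mkAlgHom_apply K _ _ _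
    exact ⟨ψ, fun i => by simp [hψ, e], fun x => by simp [hψ, t], fun x => by simp [hψ, tinv]⟩

/-! ### Models of the negative Borel relations, and assembling a model of U from two Borel models.
-/

section

variable {K : Type*} [Field K] (P : QParams K)

/-- A family of elements of an algebra that satisfies the relations of the negative Borel
subalgebra. -/
structure IsNegModel {A : Type*} [Ring A] [Algebra K A] (f : P.Idx → A) (t tinv : P.BTor → A) :
    Prop where
  t_tinv (x : P.BTor) : t x * tinv x = 1
  tinv_t (x : P.BTor) : tinv x * t x = 1
  t_comm (x y : P.BTor) : t x * t y = t y * t x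
  γ_sq : t .γ ^ 2 = (List.ofFn fun i : P.Idx => t (.ω i)).prod
  tf (x : P.BTor) (i : P.Idx) : t x * f i = (P.wt x.neg i)⁻¹ • (f i * t x)
  f_comm (i j : P.Idx) (h : P.cartan i j = 0) : f i * f j = f j * f i
  f_serre (i : P.Idx) : qSerre P.r⁻¹ P.s⁻¹ (f i) (f (i + 1)) = 0
  f_serre' (i : P.Idx) : qSerre' P.r⁻¹ P.s⁻¹ (f i) (f (i + 1)) = 0

variable {P}

theorem IsNegModel.map {A B : Type*} [Ring A] [Algebra K A] [Ring B] [Algebra K B]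
    {f : P.Idx → A} {t tinv : P.BTor → A} (h : P.IsNegModel f t tinv) (φ : A →ₐ[K] B) :
    P.IsNegModel (fun i => φ (f i)) (fun x => φ (t x)) (fun x => φ (tinv x)) where
  t_tinv x := by rw [← map_mul, h.t_tinv, map_one]
  tinv_t x := by rw [← map_mul, h.tinv_t, map_one]
  t_comm x y := by rw [← map_mul, h.t_comm, map_mul]
  γ_sq := by rw [← map_pow, h.γ_sq, map_list_prod, List.map_ofFn]; rfl
  tf x i := by rw [← map_mul, h.tf, map_smul, map_mul]
  f_comm i j hc := by rw [← map_mul, h.f_comm i j hc, map_mul]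
  f_serre i := by rw [← map_qSerre, h.f_serre, map_zero]
  f_serre' i := by rw [← map_qSerre', h.f_serre', map_zero]

theorem IsNegModel.of_map {A B : Type*} [Ring A] [Algebra K A] [Ring B] [Algebra K B]
    {f : P.Idx → A} {t tinv : P.BTor → A} (φ : A →ₐ[K] B) (hφ : Function.Injective φ)
    (h : P.IsNegModel (fun i => φ (f i)) (fun x => φ (t x)) (fun x => φ (tinv x))) :
    P.IsNegModel f t tinv where
  t_tinv x := hφ (by rw [map_mul, h.t_tinv, map_one])
  tinv_t x := hφ (by rw [map_mul, h.tinv_t, map_one])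
  t_comm x y := hφ (by rw [map_mul, h.t_comm, map_mul])
  γ_sq := hφ (by rw [map_pow, h.γ_sq, map_list_prod, List.map_ofFn]; rfl)
  tf x i := hφ (by rw [map_mul, h.tf, map_smul, map_mul])
  f_comm i j hc := hφ (by rw [map_mul, h.f_comm i j hc, map_mul])
  f_serre i := hφ (by rw [map_qSerre, h.f_serre, map_zero])
  f_serre' i := hφ (by rw [map_qSerre', h.f_serre', map_zero])

/-- The function on the invertible generators with given values on the two Borel subalgebras. -/
def Tor.elim {X : Type*} (t t' : P.BTor → X) : P.Tor → X
  | .ω i => t (.ω i)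
  | .ω' i => t' (.ω i)
  | .γ => t .γ
  | .γ' => t' .γ
  | .D => t .D
  | .D' => t' .D

@[simp] theorem Tor.elim_pos {X : Type*} (t t' : P.BTor → X) (x : P.BTor) :
    Tor.elim t t' x.pos = t x := by cases x <;> rfl

@[simp] theorem Tor.elim_neg {X : Type*} (t t' : P.BTor → X) (x : P.BTor) :
    Tor.elim t t' x.neg = t' x := by cases x <;> rfl

theorem Tor.forall {p : P.Tor → Prop} : (∀ x, p x) ↔ (∀ x : P.BTor, p x.pos) ∧
    ∀ x : P.BTor, p x.neg := by
  refine ⟨fun h => ⟨fun x => h _, fun x => h _⟩, fun ⟨h, h'⟩ x => ?_⟩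
  cases x with
  | ω i => exact h (.ω i)
  | ω' i => exact h' (.ω i)
  | γ => exact h .γ
  | γ' => exact h' .γ
  | D => exact h .D
  | D' => exact h' .D

theorem IsModel.toIsPosModel {A : Type*} [Ring A] [Algebra K A] {e f : P.Idx → A}
    {t tinv : P.Tor → A} (h : P.IsModel e f t tinv) :
    P.IsPosModel e (fun x => t x.pos) (fun x => tinv x.pos) where
  t_tinv _ := h.t_tinv _
  tinv_t _ := h.tinv_t _
  t_comm _ _ := h.t_comm _ _
  γ_sq := h.γ_sq
  te _ _ := h.te _ _
  e_comm := h.e_comm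
  e_serre := h.e_serre
  e_serre' := h.e_serre'

theorem IsModel.toIsNegModel {A : Type*} [Ring A] [Algebra K A] {e f : P.Idx → A}
    {t tinv : P.Tor → A} (h : P.IsModel e f t tinv) :
    P.IsNegModel f (fun x => t x.neg) (fun x => tinv x.neg) where
  t_tinv _ := h.t_tinv _
  tinv_t _ := h.tinv_t _
  t_comm _ _ := h.t_comm _ _
  γ_sq := h.γ'_sq
  tf _ _ := h.tf _ _
  f_comm := h.f_comm
  f_serre := h.f_serre
  f_serre' := h.f_serre'

/-- Models of the Borel subalgebras that satisfy the cross relations form a model of `U`. -/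
theorem IsModel.of_borel {A : Type*} [Ring A] [Algebra K A] {e f : P.Idx → A}
    {t tinv t' tinv' : P.BTor → A} (h : P.IsPosModel e t tinv) (h' : P.IsNegModel f t' tinv')
    (tt' : ∀ x y, t x * t' y = t' y * t x)
    (tf : ∀ x i, t x * f i = (P.wt x.pos i)⁻¹ • (f i * t x))
    (te : ∀ x i, t' x * e i = P.wt x.neg i • (e i * t' x))
    (ef : ∀ i j, e i * f j - f j * e i =
      ((if i = j then 1 else 0) / (P.r - P.s)) • (t (.ω i) - t' (.ω i))) :
    P.IsModel e f (Tor.elim t t') (Tor.elim tinv tinv') where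
  t_tinv := Tor.forall.2 ⟨by simpa using h.t_tinv, by simpa using h'.t_tinv⟩
  tinv_t := Tor.forall.2 ⟨by simpa using h.tinv_t, by simpa using h'.tinv_t⟩
  t_comm := Tor.forall.2 ⟨fun x => Tor.forall.2 ⟨by simpa using h.t_comm x, by simpa using tt' x⟩,
    fun x => Tor.forall.2 ⟨fun y => by simpa using (tt' y x).symm, by simpa using h'.t_comm x⟩⟩
  γ_sq := h.γ_sq
  γ'_sq := h'.γ_sq
  t_e := Tor.forall.2 ⟨fun x i => by
      rw [Tor.elim_pos, Tor.elim_pos, h.te, smul_mul_assoc, mul_assoc, h.t_tinv, mul_one],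
    fun x i => by
      rw [Tor.elim_neg, Tor.elim_neg, te, smul_mul_assoc, mul_assoc, h'.t_tinv, mul_one]⟩
  t_f := Tor.forall.2 ⟨fun x i => by
      rw [Tor.elim_pos, Tor.elim_pos, tf, smul_mul_assoc, mul_assoc, h.t_tinv, mul_one],
    fun x i => by
      rw [Tor.elim_neg, Tor.elim_neg, h'.tf, smul_mul_assoc, mul_assoc, h'.t_tinv, mul_one]⟩
  e_f := ef
  e_comm := h.e_comm
  f_comm := h'.f_comm
  e_serre := h.e_serre
  e_serre' := h.e_serre'
  f_serre := h'.f_serre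
  f_serre' := h'.f_serre'

end

/-! ### The action of U on the universal positive Borel algebra, and the presentation of the
positive Borel subalgebra. -/

namespace IsPosUniv

variable {K : Type u} [Field K] {P : QParams K} {A : Type u} [Ring A] [Algebra K A]
  {e : P.Idx → A} {t tinv : P.BTor → A}

theorem scaleHom_comm (h : P.IsPosUniv e t tinv) (c d : P.Scaling) (a : A) :
    h.scaleHom c (h.scaleHom d a) = h.scaleHom d (h.scaleHom c a) := by
  have : (h.scaleHom c).comp (h.scaleHom d) = (h.scaleHom d).comp (h.scaleHom c) := by
    apply h.algHom_ext <;> intro i <;>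
      simp [scaleHom_e, scaleHom_t, scaleHom_tinv, smul_smul, mul_comm]
  exact DFunLike.congr_fun this a

/-- A product of rescalings is again a rescaling, so the relation γ' = ω'_0 ⋯ ω'_{n-1} for these
operators is an identity of scalars on each generator. -/
theorem scaleHom_γ_sq (h : P.IsPosUniv e t tinv) (c : P.BTor → P.Scaling)
    (hl : ∀ j, (c .γ).l j ^ 2 = ∏ i, (c (.ω i)).l j)
    (hm : ∀ y, (c .γ).m y ^ 2 = ∏ i, (c (.ω i)).m y) :
    (h.scaleHom (c .γ)).toLinearMap ^ 2 =
      (List.ofFn fun i => (h.scaleHom (c (.ω i))).toLinearMap).prod := by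
  -- The product is rewritten as one of algebra endomorphisms, so that it is determined by its
  -- values on generators.
  have key (l : List P.Idx) : (l.map fun i => (h.scaleHom (c (.ω i))).toLinearMap).prod =
      (l.map fun i => h.scaleHom (c (.ω i))).prod.toLinearMap := by
    induction l with
    | nil => rfl
    | cons i l ih => simp only [List.map_cons, List.prod_cons, ih]; rfl
  have he (l : List P.Idx) (j : P.Idx) : (l.map fun i => h.scaleHom (c (.ω i))).prod (e j) =
      (l.map fun i => (c (.ω i)).l j).prod • e j := by
    induction l with
    | nil => simp
    | cons i l ih => simp [ih, scaleHom_e, smul_smul, mul_comm]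
  have ht (l : List P.Idx) (y : P.BTor) : (l.map fun i => h.scaleHom (c (.ω i))).prod (t y) =
      (l.map fun i => (c (.ω i)).m y).prod • t y := by
    induction l with
    | nil => simp
    | cons i l ih => simp [ih, scaleHom_t, smul_smul, mul_comm]
  have hti (l : List P.Idx) (y : P.BTor) :
      (l.map fun i => h.scaleHom (c (.ω i))).prod (tinv y) =
        ((l.map fun i => (c (.ω i)).m y).prod)⁻¹ • tinv y := by
    induction l with
    | nil => simp
    | cons i l ih => simp [ih, scaleHom_tinv, smul_smul, mul_comm]
  have hsq : (h.scaleHom (c .γ)).comp (h.scaleHom (c .γ)) =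
      ((List.finRange P.n).map fun i => h.scaleHom (c (.ω i))).prod := by
    apply h.algHom_ext <;> intro i
    · rw [he, ← List.ofFn_eq_map, List.prod_ofFn, ← hl]
      simp [scaleHom_e, smul_smul, pow_two]
    · rw [ht, ← List.ofFn_eq_map, List.prod_ofFn, ← hm]
      simp [scaleHom_t, smul_smul, pow_two]
    · rw [hti, ← List.ofFn_eq_map, List.prod_ofFn, ← hm]
      simp [scaleHom_tinv, smul_smul, pow_two]
  rw [List.ofFn_eq_map, key, ← hsq, pow_two]
  rfl

/-- Lowering operators together with suitable rescalings. -/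
theorem isNegModel_lower (h : P.IsPosUniv e t tinv) (c₁ c₂ : K) (c : P.BTor → P.Scaling)
    (hl : ∀ j, (c .γ).l j ^ 2 = ∏ i, (c (.ω i)).l j)
    (hm : ∀ y, (c .γ).m y ^ 2 = ∏ i, (c (.ω i)).m y)
    (h₁ : ∀ x i, c₁ * (c x).m (.ω i) = c₁ * ((P.wt x.neg i)⁻¹ * (c x).l i))
    (h₂ : ∀ x i, c₂ = c₂ * ((P.wt x.neg i)⁻¹ * (c x).l i)) :
    P.IsNegModel (h.lower c₁ c₂) (fun x => (h.scaleHom (c x)).toLinearMap)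
      (fun x => (h.scaleHom (c x).inv).toLinearMap) where
  t_tinv _ := LinearMap.ext (h.scaleHom_scaleHom_inv _)
  tinv_t _ := LinearMap.ext (h.scaleHom_inv_scaleHom _)
  t_comm _ _ := LinearMap.ext (h.scaleHom_comm _ _)
  γ_sq := h.scaleHom_γ_sq c hl hm
  tf x i := LinearMap.ext fun a => h.scaleHom_lower (c x) c₁ c₂ _ i (h₁ x i) (h₂ x i) a
  f_comm := h.lower_comm c₁ c₂
  f_serre := h.lower_serre c₁ c₂
  f_serre' := h.lower_serre' c₁ c₂

/-- The action of `U` on the universal model of the positive Borel subalgebra. -/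
theorem isModel_verma (h : P.IsPosUniv e t tinv) :
    P.IsModel (fun i => Algebra.lmul K A (e i)) (h.lower (-(1 / (P.r - P.s))) (1 / (P.r - P.s)))
      (Tor.elim (fun x => Algebra.lmul K A (t x))
        fun x => (h.scaleHom (Scaling.conj x)).toLinearMap)
      (Tor.elim (fun x => Algebra.lmul K A (tinv x))
        fun x => (h.scaleHom (Scaling.conj x).inv).toLinearMap) := by
  refine .of_borel h.isPosModel_lmul ?_ (fun x y => ?_)
    (fun x i => h.lmul_t_lower _ _ i x) (fun x i => ?_) (fun i j => ?_)
  · refine h.isNegModel_lower _ _ Scaling.conj (fun j => ?_) (by simp)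
      (fun x i => by simp [P.wt_ne_zero]) (fun x i => by simp [P.wt_ne_zero])
    -- γ'^{1/2} is central, so it acts by weight 1; the weights of ω'_0, …, ω'_{n-1} on e_j multiply
    -- to 1.
    exact (one_pow 2).trans (P.prod_wt_neg j).symm
  · ext a
    simp [scaleHom_t]
  · ext a
    simp [scaleHom_e]
  -- The constants c₁ = -1/(r-s) and c₂ = 1/(r-s) are chosen so that `lowerValue` becomes (ω_i -
  -- ω'_i)/(r-s), with ω'_i acting by conjugation.
  · rw [h.lmul_e_lower, add_sub_cancel_left]
    split_ifs with hij
    · subst hij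
      rw [lowerValue]
      module
    · simp

end IsPosUniv

/-- The positive Borel subalgebra is presented by the relations among its generators. -/
theorem BPos.isPosUniv {K : Type u} [Field K] (P : QParams K) :
    P.IsPosUniv (BPos.e P) (BPos.t P) (BPos.tinv P) := by
  have hm : P.IsPosModel (BPos.e P) (BPos.t P) (BPos.tinv P) :=
    .of_map P.BPos.val Subtype.val_injective (U.isModel P).toIsPosModel
  have hgen : Algebra.adjoin K (P.borelGens (BPos.e P) (BPos.t P) (BPos.tinv P)) = ⊤ := by
    refine Eq.trans (congrArg _ ?_) (Algebra.adjoin_adjoin_coe_preimage (R := K) (s := P.posGens))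
    ext x
    simp only [borelGens, posGens, Set.mem_union, Set.mem_range, Subtype.ext_iff]
    rfl
  obtain ⟨A, _, _, e, t, tinv, h⟩ := exists_isPosUniv P
  obtain ⟨j, hje, hjt, hjti⟩ := h.exists_lift hm
  have hsurj : Function.Surjective j := by
    rw [← AlgHom.range_eq_top, eq_top_iff, ← hgen, Algebra.adjoin_le_iff]
    rintro _ ((⟨i, rfl⟩ | ⟨x, rfl⟩) | ⟨x, rfl⟩)
    exacts [⟨_, hje i⟩, ⟨_, hjt x⟩, ⟨_, hjti x⟩]
  -- The positive generators act on A by left multiplication, so the composite A → U → End(A) is the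
  -- regular representation. Evaluation at 1 recovers a from its operator; hence j is injective.
  have hψ : (U.lift h.isModel_verma).comp (P.BPos.val.comp j) = Algebra.lmul K A := by
    apply h.algHom_ext <;> intro i
    · rw [AlgHom.comp_apply, AlgHom.comp_apply, hje]
      exact U.lift_e _ i
    · rw [AlgHom.comp_apply, AlgHom.comp_apply, hjt]
      exact (U.lift_t _ i.pos).trans (Tor.elim_pos _ _ _)
    · rw [AlgHom.comp_apply, AlgHom.comp_apply, hjti]
      exact (U.lift_tinv _ i.pos).trans (Tor.elim_pos _ _ _)
  have hinj : Function.Injective j := by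
    intro a b hab
    have ha := congr($hψ a 1)
    have hb := congr($hψ b 1)
    simp only [AlgHom.comp_apply, hab] at ha hb
    simpa using ha.symm.trans hb
  let J : A ≃ₐ[K] P.BPos := AlgEquiv.ofBijective j ⟨hinj, hsurj⟩
  refine { hm with adjoin_eq_top := hgen, exists_lift := fun {B} _ _ e' t' tinv' h' => ?_ }
  obtain ⟨φ, h1, h2, h3⟩ := h.exists_lift h'
  refine ⟨φ.comp J.symm.toAlgHom, fun i => ?_, fun x => ?_, fun x => ?_⟩
  · rw [← h1, ← hje]; exact congrArg φ (J.symm_apply_apply (e i))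
  · rw [← h2, ← hjt]; exact congrArg φ (J.symm_apply_apply (t x))
  · rw [← h3, ← hjti]; exact congrArg φ (J.symm_apply_apply (tinv x))

end QParams

/-! ### Order reversal with exchange of r and s, and the presentation of the negative Borel
subalgebra. -/

section OpSerre

variable {K A : Type*} [Field K] [Ring A] [Algebra K A] {u v : K}

-- Reading the relation backwards exchanges its first and last coefficients, 1 and uv; dividing by
-- uv inverts both parameters. This turns the f-relations, in r⁻¹ and s⁻¹, into e-relations in the
-- opposite algebra.
open MulOpposite in
theorem qSerre_op (hu : u ≠ 0) (hv : v ≠ 0) (a b : A) :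
    qSerre u v (op a) (op b) = (u * v) • op (qSerre u⁻¹ v⁻¹ a b) := by
  apply unop_injective
  simp only [qSerre, unop_add, unop_sub, unop_smul, unop_mul, unop_pow, unop_op, mul_assoc]
  match_scalars <;> field_simp
  ring

open MulOpposite in
theorem qSerre'_op (hu : u ≠ 0) (hv : v ≠ 0) (a b : A) :
    qSerre' u v (op a) (op b) = (u * v) • op (qSerre' u⁻¹ v⁻¹ a b) := by
  apply unop_injective
  simp only [qSerre', unop_add, unop_sub, unop_smul, unop_mul, unop_pow, unop_op, mul_assoc]
  match_scalars <;> field_simp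
  ring

end OpSerre

namespace QParams

section

variable {K : Type*} [Field K] (P : QParams K)

/-- The parameters with `r` and `s` exchanged. -/
abbrev swap : QParams K where
  n := P.n
  two_lt_n := P.two_lt_n
  rh := P.sh
  sh := P.rh
  rh_ne_zero := P.sh_ne_zero
  sh_ne_zero := P.rh_ne_zero
  sq_ne_sq := P.sq_ne_sq.symm

variable {P}

/-- The invertible generators for the exchanged parameters. -/
def BTor.swap : P.BTor → P.swap.BTor
  | .ω i => .ω i
  | .γ => .γ
  | .D => .D

/-- The inverse of `BTor.swap`. -/
def BTor.unswap : P.swap.BTor → P.BTor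
  | .ω i => .ω i
  | .γ => .γ
  | .D => .D

theorem BTor.unswap_swap (x : P.BTor) : x.swap.unswap = x := by cases x <;> rfl

theorem wt_swap_neg (x : P.BTor) (i : P.Idx) : P.swap.wt x.swap.neg i = P.wt x.pos i := by
  cases x <;> rfl

theorem wt_swap_pos (x : P.BTor) (i : P.Idx) : P.swap.wt x.swap.pos i = P.wt x.neg i := by
  cases x <;> rfl

theorem wt_unswap_neg (x : P.swap.BTor) (i : P.Idx) :
    P.wt x.unswap.neg i = P.swap.wt x.pos i := by
  cases x <;> rfl

variable {A : Type*} [Ring A] [Algebra K A]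

open MulOpposite

/-- Order reversal inverts the weights, and the weight of a negative invertible generator becomes
that of the positive one after r and s are exchanged. So the relations of the negative Borel algebra
for (r, s) are opposite to those of the positive one for (s, r). -/
theorem IsNegModel.op {f : P.Idx → A} {t tinv : P.BTor → A} (h : P.IsNegModel f t tinv) :
    P.swap.IsPosModel (A := Aᵐᵒᵖ) (fun i => op (f i)) (fun x => op (t x.unswap))
      (fun x => op (tinv x.unswap)) where
  t_tinv x := by rw [← op_mul, h.tinv_t, op_one]
  tinv_t x := by rw [← op_mul, h.t_tinv, op_one]
  t_comm x y := by rw [← op_mul, ← op_mul, h.t_comm]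
  γ_sq := ((congrArg MulOpposite.op h.γ_sq).trans (op_prod_ofFn fun _ _ => h.t_comm _ _).symm :)
  te x i := by
    rw [← op_mul, ← op_mul, ← op_smul, h.tf, wt_unswap_neg, smul_inv_smul₀ (P.swap.wt_ne_zero _ _)]
  e_comm i j hc := by rw [← op_mul, ← op_mul, h.f_comm i j hc]
  e_serre i := by
    rw [qSerre_op P.swap.r_ne_zero P.swap.s_ne_zero, qSerre_symm]
    exact (congrArg _ (congrArg MulOpposite.op (h.f_serre i))).trans (smul_zero _)
  e_serre' i := by
    rw [qSerre'_op P.swap.r_ne_zero P.swap.s_ne_zero, qSerre'_symm]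
    exact (congrArg _ (congrArg MulOpposite.op (h.f_serre' i))).trans (smul_zero _)

theorem IsNegModel.op_swap {f : P.Idx → A} {t tinv : P.swap.BTor → A}
    (h : P.swap.IsNegModel f t tinv) :
    P.IsPosModel (A := Aᵐᵒᵖ) (fun i => MulOpposite.op (f i)) (fun x => MulOpposite.op (t x.swap))
      (fun x => MulOpposite.op (tinv x.swap)) where
  t_tinv x := by rw [← op_mul, h.tinv_t, op_one]
  tinv_t x := by rw [← op_mul, h.t_tinv, op_one]
  t_comm x y := by rw [← op_mul, ← op_mul, h.t_comm]
  γ_sq := ((congrArg MulOpposite.op h.γ_sq).trans (op_prod_ofFn fun _ _ => h.t_comm _ _).symm :)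
  te x i := by
    rw [← op_mul, ← op_mul, ← op_smul, h.tf, wt_swap_neg, smul_inv_smul₀ (P.wt_ne_zero _ _)]
  e_comm i j hc := by rw [← op_mul, ← op_mul, h.f_comm i j hc]
  e_serre i := by
    rw [qSerre_op P.r_ne_zero P.s_ne_zero, qSerre_symm]
    exact (congrArg _ (congrArg MulOpposite.op (h.f_serre i))).trans (smul_zero _)
  e_serre' i := by
    rw [qSerre'_op P.r_ne_zero P.s_ne_zero, qSerre'_symm]
    exact (congrArg _ (congrArg MulOpposite.op (h.f_serre' i))).trans (smul_zero _)

theorem IsPosModel.op_swap {e : P.Idx → A} {t tinv : P.swap.BTor → A}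
    (h : P.swap.IsPosModel e t tinv) :
    P.IsNegModel (A := Aᵐᵒᵖ) (fun i => MulOpposite.op (e i)) (fun x => MulOpposite.op (t x.swap))
      (fun x => MulOpposite.op (tinv x.swap)) where
  t_tinv x := by rw [← op_mul, h.tinv_t, op_one]
  tinv_t x := by rw [← op_mul, h.t_tinv, op_one]
  t_comm x y := by rw [← op_mul, ← op_mul, h.t_comm]
  γ_sq := ((congrArg MulOpposite.op h.γ_sq).trans (op_prod_ofFn fun _ _ => h.t_comm _ _).symm :)
  tf x i := by
    rw [← op_mul, ← op_mul, ← op_smul, h.te, wt_swap_pos, inv_smul_smul₀ (P.wt_ne_zero _ _)]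
  f_comm i j hc := by rw [← op_mul, ← op_mul, h.e_comm i j hc]
  f_serre i := by
    rw [qSerre_op (inv_ne_zero P.r_ne_zero) (inv_ne_zero P.s_ne_zero), qSerre_symm, inv_inv,
      inv_inv]
    exact (congrArg _ (congrArg MulOpposite.op (h.e_serre i))).trans (smul_zero _)
  f_serre' i := by
    rw [qSerre'_op (inv_ne_zero P.r_ne_zero) (inv_ne_zero P.s_ne_zero), qSerre'_symm, inv_inv,
      inv_inv]
    exact (congrArg _ (congrArg MulOpposite.op (h.e_serre' i))).trans (smul_zero _)

variable (P) in
/-- The family in the opposite algebra that defines the anti-isomorphism of `U_{r,s}` and `U_{s,r}`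
which exchanges `e_i` and `f_i`. -/
theorem isModel_swap : P.IsModel (A := P.swap.Uᵐᵒᵖ) (fun i => op (U.f P.swap i))
    (fun i => op (U.e P.swap i))
    (Tor.elim (fun x => op (U.t P.swap x.swap.neg)) fun x => op (U.t P.swap x.swap.pos))
    (Tor.elim (fun x => op (U.tinv P.swap x.swap.neg)) fun x => op (U.tinv P.swap x.swap.pos)) := by
  have h := U.isModel P.swap
  refine .of_borel h.toIsNegModel.op_swap h.toIsPosModel.op_swap (fun x y => ?_) (fun x i => ?_)
    (fun x i => ?_) (fun i j => ?_)
  · rw [← op_mul, ← op_mul, h.t_comm]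
  · rw [← op_mul, ← op_mul, ← op_smul, h.te, wt_swap_neg, inv_smul_smul₀ (P.wt_ne_zero _ _)]
  · rw [← op_mul, ← op_mul, ← op_smul, h.tf, wt_swap_pos, smul_inv_smul₀ (P.wt_ne_zero _ _)]
  · rw [← op_mul, ← op_mul, ← op_sub, ← op_sub, ← op_smul, h.e_f]
    congr 1
    by_cases hij : i = j
    · subst hij
      -- Two signs cancel: r - s becomes s - r, and ω_i and ω'_i change places.
      have hk : -(1 / (P.swap.r - P.swap.s)) = 1 / (P.r - P.s) := by
        change -(1 / (P.s - P.r)) = _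
        rw [← neg_sub P.r, div_neg, neg_neg]
      simp only [if_true]
      rw [← neg_sub (U.t P.swap _), smul_neg, ← neg_smul, hk]
      rfl
    · simp [hij, Ne.symm hij]

end

/-- The universal property of the negative Borel subalgebra. -/
theorem BNeg.exists_lift {K : Type u} [Field K] {P : QParams K} {B : Type u} [Ring B] [Algebra K B]
    {f : P.Idx → B} {t tinv : P.BTor → B} (h : P.IsNegModel f t tinv) :
    ∃ φ : P.BNeg →ₐ[K] B, (∀ i, φ (BNeg.f P i) = f i) ∧ (∀ x, φ (BNeg.t P x) = t x) ∧
      (∀ x, φ (BNeg.tinv P x) = tinv x) := by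
  -- The opposite algebra of B is a model of the positive Borel relations with r and s exchanged,
  -- for which the presentation is already known.
  obtain ⟨χ, hχe, hχt, hχti⟩ := (BPos.isPosUniv P.swap).exists_lift h.op
  let θ : P.U →ₐ[K] P.swap.Uᵐᵒᵖ := U.lift P.isModel_swap
  have hθf (i : P.Idx) : (θ (U.f P i)).unop = BPos.e P.swap i :=
    congrArg MulOpposite.unop (U.lift_f P.isModel_swap i)
  have hθt (x : P.BTor) : (θ (U.t P x.neg)).unop = BPos.t P.swap x.swap :=
    congrArg MulOpposite.unop ((U.lift_t P.isModel_swap _).trans (Tor.elim_neg _ _ x))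
  have hθti (x : P.BTor) : (θ (U.tinv P x.neg)).unop = BPos.tinv P.swap x.swap :=
    congrArg MulOpposite.unop ((U.lift_tinv P.isModel_swap _).trans (Tor.elim_neg _ _ x))
  have hmem (b : P.U) (hb : b ∈ P.BNeg) : (θ b).unop ∈ P.swap.BPos := by
    induction hb using Algebra.adjoin_induction with
    | mem x hx =>
      obtain (⟨i, rfl⟩ | ⟨x, rfl⟩) | ⟨x, rfl⟩ := hx
      · rw [hθf]; exact Subtype.prop _
      · simp only [hθt]; exact Subtype.prop _
      · simp only [hθti]; exact Subtype.prop _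
    | algebraMap c => rw [AlgHom.commutes]; exact Subalgebra.algebraMap_mem _ _
    | add x y _ _ hx hy => rw [map_add]; exact add_mem hx hy
    | mul x y _ _ hx hy => rw [map_mul]; exact mul_mem hy hx
  -- The restriction of θ to the Borel subalgebras, read as a linear map, reverses products. So does
  -- χ when read with values in B, and therefore their composite is an algebra homomorphism.
  let g : P.BNeg →ₗ[K] P.swap.BPos :=
    { toFun := fun b => ⟨(θ b).unop, hmem b b.2⟩
      map_add' := fun a b => Subtype.ext (congrArg MulOpposite.unop (map_add θ a.1 b.1))
      map_smul' := fun c a => Subtype.ext (congrArg MulOpposite.unop (map_smul θ c a.1)) }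
  have g_mul (a b : P.BNeg) : g (a * b) = g b * g a :=
    Subtype.ext (congrArg MulOpposite.unop (map_mul θ a.1 b.1))
  have g_one : g 1 = 1 := Subtype.ext (congrArg MulOpposite.unop (map_one θ))
  refine ⟨AlgHom.ofLinearMap ((MulOpposite.opLinearEquiv K).symm.toLinearMap ∘ₗ χ.toLinearMap ∘ₗ g)
    ?_ ?_, fun i => ?_, fun x => ?_, fun x => ?_⟩
  · change (χ (g 1)).unop = 1
    rw [g_one, map_one, MulOpposite.unop_one]
  · intro a b
    change (χ (g (a * b))).unop = (χ (g a)).unop * (χ (g b)).unop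
    rw [g_mul, map_mul, MulOpposite.unop_mul]
  · have : g (BNeg.f P i) = BPos.e P.swap i := Subtype.ext (hθf i)
    change (χ (g _)).unop = _
    rw [this, hχe, MulOpposite.unop_op]
  · have : g (BNeg.t P x) = BPos.t P.swap x.swap := Subtype.ext (hθt x)
    change (χ (g _)).unop = _
    rw [this, hχt, BTor.unswap_swap, MulOpposite.unop_op]
  · have : g (BNeg.tinv P x) = BPos.tinv P.swap x.swap := Subtype.ext (hθti x)
    change (χ (g _)).unop = _
    rw [this, hχti, BTor.unswap_swap, MulOpposite.unop_op]

/-! ### Coproduct and counit on the generators of the Borel subalgebras. -/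

open Coalgebra

section

variable {K : Type*} [Field K] (P : QParams K)

/-- Checked in U ⊗ U, into which the tensor square of the subalgebra embeds; the other coproduct
formulas are obtained in the same way. -/
theorem BPos.comul_e (i : P.Idx) :
    comul (R := K) (BPos.e P i) = BPos.e P i ⊗ₜ 1 + BPos.t P (.ω i) ⊗ₜ BPos.e P i :=
  IsHopfSubalgebra.map_val_injective _
    (((BPos.isHopfSubalgebra P).map_comulHom (BPos.e P i)).trans (U.comul_e P i))

theorem BPos.comul_t (x : P.BTor) : comul (R := K) (BPos.t P x) = BPos.t P x ⊗ₜ BPos.t P x :=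
  IsHopfSubalgebra.map_val_injective _
    (((BPos.isHopfSubalgebra P).map_comulHom (BPos.t P x)).trans (U.comul_t P _))

theorem BPos.comul_tinv (x : P.BTor) :
    comul (R := K) (BPos.tinv P x) = BPos.tinv P x ⊗ₜ BPos.tinv P x :=
  IsHopfSubalgebra.map_val_injective _
    (((BPos.isHopfSubalgebra P).map_comulHom (BPos.tinv P x)).trans (U.comul_tinv P _))

theorem BNeg.comul_f (i : P.Idx) :
    comul (R := K) (BNeg.f P i) = BNeg.f P i ⊗ₜ BNeg.t P (.ω i) + 1 ⊗ₜ BNeg.f P i :=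
  IsHopfSubalgebra.map_val_injective _
    (((BNeg.isHopfSubalgebra P).map_comulHom (BNeg.f P i)).trans (U.comul_f P i))

theorem BNeg.comul_t (x : P.BTor) : comul (R := K) (BNeg.t P x) = BNeg.t P x ⊗ₜ BNeg.t P x :=
  IsHopfSubalgebra.map_val_injective _
    (((BNeg.isHopfSubalgebra P).map_comulHom (BNeg.t P x)).trans (U.comul_t P _))

theorem BNeg.comul_tinv (x : P.BTor) :
    comul (R := K) (BNeg.tinv P x) = BNeg.tinv P x ⊗ₜ BNeg.tinv P x :=
  IsHopfSubalgebra.map_val_injective _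
    (((BNeg.isHopfSubalgebra P).map_comulHom (BNeg.tinv P x)).trans (U.comul_tinv P _))

theorem BPos.counit_e (i : P.Idx) : counit (R := K) (BPos.e P i) = 0 := U.counit_e P i
theorem BPos.counit_t (x : P.BTor) : counit (R := K) (BPos.t P x) = 1 := U.counit_t P _
theorem BPos.counit_tinv (x : P.BTor) : counit (R := K) (BPos.tinv P x) = 1 := U.counit_tinv P _
theorem BNeg.counit_f (i : P.Idx) : counit (R := K) (BNeg.f P i) = 0 := U.counit_f P i
theorem BNeg.counit_t (x : P.BTor) : counit (R := K) (BNeg.t P x) = 1 := U.counit_t P _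
theorem BNeg.counit_tinv (x : P.BTor) : counit (R := K) (BNeg.tinv P x) = 1 := U.counit_tinv P _

theorem BNeg.isNegModel : P.IsNegModel (BNeg.f P) (BNeg.t P) (BNeg.tinv P) :=
  .of_map P.BNeg.val Subtype.val_injective (U.isModel P).toIsNegModel

variable {P}

theorem BPos.induction {p : P.BPos → Prop} (e : ∀ i, p (BPos.e P i)) (t : ∀ x, p (BPos.t P x))
    (tinv : ∀ x, p (BPos.tinv P x)) (algebraMap : ∀ c, p (algebraMap K _ c))
    (add : ∀ a b, p a → p b → p (a + b)) (mul : ∀ a b, p a → p b → p (a * b)) (a : P.BPos) :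
    p a := by
  obtain ⟨a, ha⟩ := a
  induction ha using Algebra.adjoin_induction with
  | mem x hx =>
    obtain (⟨i, rfl⟩ | ⟨x, rfl⟩) | ⟨x, rfl⟩ := hx
    exacts [e i, t x, tinv x]
  | algebraMap c => exact algebraMap c
  | add x y hx hy hx' hy' => exact add ⟨x, hx⟩ ⟨y, hy⟩ hx' hy'
  | mul x y hx hy hx' hy' => exact mul ⟨x, hx⟩ ⟨y, hy⟩ hx' hy'

theorem BNeg.induction {p : P.BNeg → Prop} (f : ∀ i, p (BNeg.f P i)) (t : ∀ x, p (BNeg.t P x))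
    (tinv : ∀ x, p (BNeg.tinv P x)) (algebraMap : ∀ c, p (algebraMap K _ c))
    (add : ∀ a b, p a → p b → p (a + b)) (mul : ∀ a b, p a → p b → p (a * b)) (a : P.BNeg) :
    p a := by
  obtain ⟨a, ha⟩ := a
  induction ha using Algebra.adjoin_induction with
  | mem x hx =>
    obtain (⟨i, rfl⟩ | ⟨x, rfl⟩) | ⟨x, rfl⟩ := hx
    exacts [f i, t x, tinv x]
  | algebraMap c => exact algebraMap c
  | add x y hx hy hx' hy' => exact add ⟨x, hx⟩ ⟨y, hy⟩ hx' hy'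
  | mul x y hx hy hx' hy' => exact mul ⟨x, hx⟩ ⟨y, hy⟩ hx' hy'

end

/-! ### Construction of the skew-dual pairing. -/

/-- Without the conjugation term F_i is a skew derivation, the rule that corresponds to Δᵒᵖ(f_i) =
ω'_i ⊗ f_i + f_i ⊗ 1. Both sides obey the same recursion in a. -/
theorem IsPosUniv.lower_mul {K : Type u} [Field K] {P : QParams K} {A : Type u} [Ring A]
    [Algebra K A] {e : P.Idx → A} {t tinv : P.BTor → A} (h : P.IsPosUniv e t tinv) (c₁ : K)
    (i : P.Idx) (a b : A) : h.lower c₁ 0 i (a * b) =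
      h.scaleHom (Scaling.pair (.ω i)) a * h.lower c₁ 0 i b + h.lower c₁ 0 i a * b := by
  have key : h.lower c₁ 0 i ∘ₗ LinearMap.mulRight K b -
      LinearMap.mulRight K (h.lower c₁ 0 i b) ∘ₗ (h.scaleHom (Scaling.pair (.ω i))).toLinearMap -
      LinearMap.mulRight K b ∘ₗ h.lower c₁ 0 i = 0 := by
    apply h.linearMap_eq_zero
    · simp [h.lower_one]
    · intro j a ha
      simp only [LinearMap.sub_apply, LinearMap.comp_apply, LinearMap.mulRight_apply,
        AlgHom.toLinearMap_apply] at ha ⊢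
      rw [sub_sub, sub_eq_zero] at ha ⊢
      simp only [mul_assoc, h.lower_e_mul, map_mul, h.scaleHom_e, ha, Scaling.pair_l, one_smul,
        zero_smul, add_zero, mul_add, add_mul]
      split_ifs <;> simp only [smul_mul_assoc, mul_assoc, zero_mul, add_zero, add_assoc]
    · intro x a ha
      simp only [LinearMap.sub_apply, LinearMap.comp_apply, LinearMap.mulRight_apply,
        AlgHom.toLinearMap_apply] at ha ⊢
      rw [sub_sub, sub_eq_zero] at ha ⊢
      simp only [mul_assoc, h.lower_t_mul, map_mul, h.scaleHom_t, ha, Scaling.pair_m,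
        pairVal_ω_left, mul_add, smul_add, smul_mul_assoc]
    · intro x a ha
      simp only [LinearMap.sub_apply, LinearMap.comp_apply, LinearMap.mulRight_apply,
        AlgHom.toLinearMap_apply] at ha ⊢
      rw [sub_sub, sub_eq_zero] at ha ⊢
      simp only [mul_assoc, h.lower_tinv_mul, map_mul, h.scaleHom_tinv, ha, Scaling.pair_m,
        pairVal_ω_left, mul_add, smul_add, smul_mul_assoc]
  have := LinearMap.congr_fun key a
  simpa [sub_sub, sub_eq_zero] using this

section

variable {K : Type u} [Field K] (P : QParams K)

/-- The constant c₁ is the prescribed value ⟨f_i, e_i⟩. Unlike in the action of U, an invertible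
generator x of the negative side acts here by y ↦ ⟨x, y⟩ y and fixes the e_j; compatibility with F_i
is `pairVal_ω_right`. -/
theorem isNegModel_skewDeriv : P.IsNegModel ((BPos.isPosUniv P).lower (1 / (P.s - P.r)) 0)
    (fun x => ((BPos.isPosUniv P).scaleHom (Scaling.pair x)).toLinearMap)
    (fun x => ((BPos.isPosUniv P).scaleHom (Scaling.pair x).inv).toLinearMap) :=
  (BPos.isPosUniv P).isNegModel_lower _ _ Scaling.pair (by simp) P.pairVal_γ_left_sq
    (fun x i => by simp [pairVal_ω_right]) (by simp)

/-- The action of the negative Borel subalgebra on the positive one, `b · a = Σ a₁ ⟨b, a₂⟩`. -/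
noncomputable def skewAction : P.BNeg →ₐ[K] Module.End K P.BPos :=
  (BNeg.exists_lift P.isNegModel_skewDeriv).choose

theorem skewAction_f (i : P.Idx) : P.skewAction (BNeg.f P i) =
    (BPos.isPosUniv P).lower (1 / (P.s - P.r)) 0 i :=
  (BNeg.exists_lift P.isNegModel_skewDeriv).choose_spec.1 i

theorem skewAction_t (x : P.BTor) : P.skewAction (BNeg.t P x) =
    ((BPos.isPosUniv P).scaleHom (Scaling.pair x)).toLinearMap :=
  (BNeg.exists_lift P.isNegModel_skewDeriv).choose_spec.2.1 x

theorem skewAction_tinv (x : P.BTor) : P.skewAction (BNeg.tinv P x) =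
    ((BPos.isPosUniv P).scaleHom (Scaling.pair x).inv).toLinearMap :=
  (BNeg.exists_lift P.isNegModel_skewDeriv).choose_spec.2.2 x

theorem skewAction_one_right (b : P.BNeg) :
    P.skewAction b 1 = algebraMap K _ (counit (R := K) b) := by
  induction b using BNeg.induction with
  | f i => rw [skewAction_f, IsPosUniv.lower_one, BNeg.counit_f, map_zero]
  | t x => rw [skewAction_t, AlgHom.toLinearMap_apply, map_one, BNeg.counit_t, map_one]
  | tinv x => rw [skewAction_tinv, AlgHom.toLinearMap_apply, map_one, BNeg.counit_tinv, map_one]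
  | algebraMap c =>
    rw [AlgHom.commutes, Module.algebraMap_end_apply, Bialgebra.counit_algebraMap,
      Algebra.algebraMap_eq_smul_one]
  | add a b ha hb => rw [map_add, LinearMap.add_apply, ha, hb, map_add, map_add]
  | mul a b ha hb =>
    rw [map_mul, Module.End.mul_apply, hb, Algebra.algebraMap_eq_smul_one, map_smul, ha,
      Bialgebra.counit_mul, map_mul, Algebra.smul_def, Algebra.commutes]

/-- The left coaction is compatible with rescaling only if e_i is fixed, because the summand e_i ⊗ 1
of Δ(e_i) is not rescaled on the right. -/
theorem comul_scaleHom (c : P.Scaling) (hc : ∀ i, c.l i = 1) (a : P.BPos) :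
    comul (R := K) ((BPos.isPosUniv P).scaleHom c a) =
      ((BPos.isPosUniv P).scaleHom c).toLinearMap.lTensor _ (comul a) := by
  have h := BPos.isPosUniv P
  have : (Bialgebra.comulAlgHom K P.BPos).comp (h.scaleHom c) =
      (Algebra.TensorProduct.map (AlgHom.id K _) (h.scaleHom c)).comp
        (Bialgebra.comulAlgHom K P.BPos) := by
    apply h.algHom_ext <;> intro i <;>
      simp [h.scaleHom_e, h.scaleHom_t, h.scaleHom_tinv, hc, BPos.comul_e, BPos.comul_t,
        BPos.comul_tinv]
  exact DFunLike.congr_fun this a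

/-- Both sides obey the same recursion. The extra term for e_i is c₁ Δ(ω_i)Δ(a) on the left; on the
right it comes from the summand ω_i ⊗ e_i of Δ(e_i), and the two agree since ω_i is group-like. -/
theorem comul_lower (c₁ : K) (i : P.Idx) (a : P.BPos) :
    comul (R := K) ((BPos.isPosUniv P).lower c₁ 0 i a) =
      ((BPos.isPosUniv P).lower c₁ 0 i).lTensor _ (comul a) := by
  have h := BPos.isPosUniv P
  have key : comul ∘ₗ h.lower c₁ 0 i - (h.lower c₁ 0 i).lTensor _ ∘ₗ comul = 0 := by
    apply h.linearMap_eq_zero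
    · simp [h.lower_one, Algebra.TensorProduct.one_def]
    · intro j a ha
      simp only [LinearMap.sub_apply, LinearMap.comp_apply, sub_eq_zero] at ha ⊢
      simp only [h.lower_e_mul, Bialgebra.comul_mul, map_add, ha, zero_smul, add_zero]
      have hif : comul (R := K) (if j = i then c₁ • (BPos.t P (.ω i) * a) else 0) =
          if j = i then c₁ • (comul (BPos.t P (.ω i)) * comul a) else 0 := by
        split_ifs <;> simp
      rw [hif]
      -- Once the hypothesis on a has been used, Δ(a) can be any tensor, and by linearity a pure
      -- one.
      generalize comul (R := K) a = T
      rw [BPos.comul_e, BPos.comul_t]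
      induction T with
      | zero => simp
      | add T T' hT hT' =>
        simp only [map_add, mul_add]
        rw [← hT, ← hT']
        split_ifs <;> (try simp only [smul_add]) <;> abel
      | tmul x y =>
        simp only [add_mul, Algebra.TensorProduct.tmul_mul_tmul, one_mul, LinearMap.lTensor_tmul,
          map_add, h.lower_e_mul, TensorProduct.tmul_add, zero_smul, add_zero]
        split_ifs with hj
        · subst hj; simp only [TensorProduct.tmul_smul, add_assoc]
        · simp
    · intro y a ha
      simp only [LinearMap.sub_apply, LinearMap.comp_apply, sub_eq_zero] at ha ⊢
      simp only [h.lower_t_mul, Bialgebra.comul_mul, map_smul, ha]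
      generalize comul (R := K) a = T
      rw [BPos.comul_t]
      induction T with
      | zero => simp
      | add T T' hT hT' => simp only [mul_add, map_add, smul_add, hT, hT']
      | tmul x y => simp [h.lower_t_mul]
    · intro y a ha
      simp only [LinearMap.sub_apply, LinearMap.comp_apply, sub_eq_zero] at ha ⊢
      simp only [h.lower_tinv_mul, Bialgebra.comul_mul, map_smul, ha]
      generalize comul (R := K) a = T
      rw [BPos.comul_tinv]
      induction T with
      | zero => simp
      | add T T' hT hT' => simp only [mul_add, map_add, smul_add, hT, hT']
      | tmul x y => simp [h.lower_tinv_mul]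
  exact sub_eq_zero.1 (LinearMap.congr_fun key a)

/-- The maps that commute with the left coaction form an algebra, so the generators of the negative
side suffice. -/
theorem comul_skewAction (b : P.BNeg) (a : P.BPos) :
    comul (R := K) (P.skewAction b a) = (P.skewAction b).lTensor _ (comul a) := by
  induction b using BNeg.induction generalizing a with
  | f i => rw [skewAction_f, comul_lower]
  | t x => rw [skewAction_t]; exact P.comul_scaleHom _ (by simp) a
  | tinv x => rw [skewAction_tinv]; exact P.comul_scaleHom _ (by simp) a
  | algebraMap c =>
    rw [AlgHom.commutes, Algebra.algebraMap_eq_smul_one, LinearMap.lTensor_smul]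
    simp [Module.End.one_eq_id]
  | add x y hx hy => simp only [map_add, LinearMap.add_apply, LinearMap.lTensor_add, hx, hy]
  | mul x y hx hy =>
    rw [map_mul, Module.End.mul_apply, hx, hy, ← LinearMap.lTensor_comp_apply]; rfl

/-- The action of `b₁ ⊗ b₂` by `x ⊗ y ↦ (b₂ · x) ⊗ (b₁ · y)`. -/
noncomputable def skewAction₂ : P.BNeg ⊗[K] P.BNeg →ₐ[K] Module.End K (P.BPos ⊗[K] P.BPos) :=
  (Module.endTensorEndAlgHom (R := K) (S := K) (A := K)).comp
    ((Algebra.TensorProduct.map P.skewAction P.skewAction).comp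
      (Algebra.TensorProduct.comm K P.BNeg P.BNeg).toAlgHom)

theorem skewAction₂_tmul (b b' : P.BNeg) (x y : P.BPos) :
    P.skewAction₂ (b ⊗ₜ b') (x ⊗ₜ y) = P.skewAction b' x ⊗ₜ P.skewAction b y := by
  simp only [skewAction₂, AlgHom.comp_apply]
  rfl

/-- The positive Borel subalgebra is a module algebra for the opposite coproduct. Both Δ and
`skewAction₂` are multiplicative, so only generators matter: rescalings are algebra maps, and for
f_i it is the skew Leibniz rule `IsPosUniv.lower_mul`. -/
theorem skewAction_mul' (b : P.BNeg) : P.skewAction b ∘ₗ LinearMap.mul' K P.BPos =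
    LinearMap.mul' K P.BPos ∘ₗ P.skewAction₂ (comul b) := by
  induction b using BNeg.induction with
  | f i =>
    ext x y
    simp [BNeg.comul_f, skewAction₂_tmul, skewAction_f, skewAction_t, IsPosUniv.lower_mul]
  | t x => ext; simp [BNeg.comul_t, skewAction₂_tmul, skewAction_t]
  | tinv x => ext; simp [BNeg.comul_tinv, skewAction₂_tmul, skewAction_tinv]
  | algebraMap c =>
    rw [Bialgebra.comul_algebraMap, AlgHom.commutes, AlgHom.commutes]
    ext x y
    simp
  | add x y hx hy => rw [map_add, map_add, map_add, LinearMap.add_comp, LinearMap.comp_add, hx, hy]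
  | mul x y hx hy =>
    rw [map_mul, Bialgebra.comul_mul, map_mul, Module.End.mul_eq_comp, Module.End.mul_eq_comp,
      LinearMap.comp_assoc, hy, ← LinearMap.comp_assoc, hx, LinearMap.comp_assoc]

/-- The pairing of the Borel subalgebras. -/
noncomputable def stdForm : P.BNeg →ₗ[K] P.BPos →ₗ[K] K :=
  P.skewAction.toLinearMap.compr₂ counit

theorem stdForm_apply (b : P.BNeg) (a : P.BPos) :
    P.stdForm b a = counit (R := K) (P.skewAction b a) := rfl

/-- The counit on the second leg of `comul_skewAction` shows that the action is recovered from the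
form as b · a = Σ a₁⟨b, a₂⟩. -/
theorem skewAction_eq_rid (b : P.BNeg) (a : P.BPos) :
    P.skewAction b a = TensorProduct.rid K _ ((P.stdForm b).lTensor _ (comul a)) := by
  have h := lTensor_counit_comul (R := K) (P.skewAction b a)
  rw [comul_skewAction, ← LinearMap.lTensor_comp_apply] at h
  have h' : P.stdForm b = counit ∘ₗ P.skewAction b := rfl
  rw [h', h, TensorProduct.rid_tmul, one_smul]

/-- The skew-dual pairing of the Borel subalgebras. -/
noncomputable def stdPairing : SkewDualPairing K P.BPos P.BNeg where
  form := P.stdForm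
  form_one_right b := by
    rw [stdForm_apply, skewAction_one_right, Bialgebra.counit_algebraMap]
  form_one_left a := by rw [stdForm_apply, map_one, Module.End.one_apply]
  form_mul_right b a₁ a₂ := by
    -- The counit of the module algebra identity is the pairing axiom for a₁a₂, because the counit
    -- is multiplicative.
    have h := congrArg (counit (R := K)) (LinearMap.congr_fun (P.skewAction_mul' b) (a₁ ⊗ₜ a₂))
    refine h.trans ?_
    rw [LinearMap.comp_apply]
    generalize comul (R := K) b = T
    induction T with
    | zero => simp
    | add T T' hT hT' => simp only [map_add, LinearMap.add_apply, hT, hT']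
    | tmul x y => simp [skewAction₂_tmul, stdForm_apply]
  form_mul_left b₁ b₂ a := by
    -- ⟨b₁b₂, a⟩ is the counit of b₁ · (b₂ · a); expanding the inner action gives Σ ⟨b₁, a₁⟩⟨b₂,
    -- a₂⟩.
    rw [stdForm_apply, map_mul, Module.End.mul_apply, P.skewAction_eq_rid b₂ a]
    generalize comul (R := K) a = T
    induction T with
    | zero => simp
    | add T T' hT hT' => simp only [map_add, hT, hT']
    | tmul x y => simp [stdForm_apply, mul_comm]

theorem isStdPairing_stdPairing : P.IsStdPairing P.stdPairing where
  f_e i j := by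
    change P.stdForm _ _ = _
    -- Writing e_j as e_j · 1 makes the recursion applicable; only the term c₁ω_i remains, and its
    -- counit is c₁.
    rw [stdForm_apply, skewAction_f, ← mul_one (BPos.e P j), IsPosUniv.lower_e_mul,
      IsPosUniv.lower_one]
    by_cases hij : i = j
    · simp [hij, BPos.counit_t]
    · simp [hij, Ne.symm hij]
  t_t x y := by
    change P.stdForm _ _ = _
    simp [stdForm_apply, skewAction_t, IsPosUniv.scaleHom_t, BPos.counit_t]
  t_tinv x y := by
    change P.stdForm _ _ = _
    simp [stdForm_apply, skewAction_t, IsPosUniv.scaleHom_tinv, BPos.counit_tinv]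
  tinv_t x y := by
    change P.stdForm _ _ = _
    simp [stdForm_apply, skewAction_tinv, IsPosUniv.scaleHom_t, BPos.counit_t]
  tinv_tinv x y := by
    change P.stdForm _ _ = _
    simp [stdForm_apply, skewAction_tinv, IsPosUniv.scaleHom_tinv, BPos.counit_tinv]
  f_t i y := by
    change P.stdForm _ _ = _
    rw [stdForm_apply, skewAction_f, ← mul_one (BPos.t P y), IsPosUniv.lower_t_mul,
      IsPosUniv.lower_one]
    simp
  f_tinv i y := by
    change P.stdForm _ _ = _
    rw [stdForm_apply, skewAction_f, ← mul_one (BPos.tinv P y), IsPosUniv.lower_tinv_mul,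
      IsPosUniv.lower_one]
    simp
  t_e x j := by
    change P.stdForm _ _ = _
    simp [stdForm_apply, skewAction_t, IsPosUniv.scaleHom_e, BPos.counit_e]
  tinv_e x j := by
    change P.stdForm _ _ = _
    simp [stdForm_apply, skewAction_tinv, IsPosUniv.scaleHom_e, BPos.counit_e]

end

/-! ### Uniqueness of the pairing. -/

open Coalgebra HopfAlgebra

section uniqueness

variable {K A B : Type*} [Field K] [Ring A] [Ring B] [HopfAlgebra K A] [HopfAlgebra K B]

theorem _root_.SkewDualPairing.form_algebraMap (p : SkewDualPairing K A B) (b : B) (c : K) :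
    p.form b (algebraMap K A c) = c * counit (R := K) b := by
  rw [Algebra.algebraMap_eq_smul_one, map_smul, p.form_one_right, smul_eq_mul]

theorem _root_.SkewDualPairing.form_mul_of_groupLike (p : SkewDualPairing K A B) {g : B}
    (hg : comul (R := K) g = g ⊗ₜ g) (a a' : A) :
    p.form g (a * a') = p.form g a * p.form g a' := by
  simp [p.form_mul_right, hg]

theorem _root_.SkewDualPairing.ext_form {p q : SkewDualPairing K A B} (h : p.form = q.form) :
    p = q := by
  cases p; cases q; congr

variable {P : QParams K} {p q : SkewDualPairing K P.BPos P.BNeg}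

/-- Pairing with a group-like element is multiplicative in a, hence determined on generators. -/
theorem IsStdPairing.form_groupLike_eq {g : P.BNeg} (hg : comul (R := K) g = g ⊗ₜ g)
    (he : ∀ j, p.form g (BPos.e P j) = q.form g (BPos.e P j))
    (ht : ∀ y, p.form g (BPos.t P y) = q.form g (BPos.t P y))
    (hti : ∀ y, p.form g (BPos.tinv P y) = q.form g (BPos.tinv P y)) (a : P.BPos) :
    p.form g a = q.form g a := by
  induction a using BPos.induction with
  | e j => exact he j
  | t y => exact ht y
  | tinv y => exact hti y
  | algebraMap c => rw [p.form_algebraMap, q.form_algebraMap]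
  | add a b ha hb => rw [map_add, map_add, ha, hb]
  | mul a b ha hb => rw [p.form_mul_of_groupLike hg, q.form_mul_of_groupLike hg, ha, hb]

theorem IsStdPairing.form_t_eq (hp : P.IsStdPairing p) (hq : P.IsStdPairing q) (x : P.BTor)
    (a : P.BPos) : p.form (BNeg.t P x) a = q.form (BNeg.t P x) a :=
  form_groupLike_eq (BNeg.comul_t P x) (fun j => by rw [hp.t_e, hq.t_e])
    (fun y => by rw [hp.t_t, hq.t_t]) (fun y => by rw [hp.t_tinv, hq.t_tinv]) a

theorem IsStdPairing.form_tinv_eq (hp : P.IsStdPairing p) (hq : P.IsStdPairing q) (x : P.BTor)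
    (a : P.BPos) : p.form (BNeg.tinv P x) a = q.form (BNeg.tinv P x) a :=
  form_groupLike_eq (BNeg.comul_tinv P x) (fun j => by rw [hp.tinv_e, hq.tinv_e])
    (fun y => by rw [hp.tinv_t, hq.tinv_t]) (fun y => by rw [hp.tinv_tinv, hq.tinv_tinv]) a

/-- The coproduct of f_i involves only f_i, ω'_i and 1, so the induction over products closes once
the group-like case is settled. -/
theorem IsStdPairing.form_f_eq (hp : P.IsStdPairing p) (hq : P.IsStdPairing q) (i : P.Idx)
    (a : P.BPos) : p.form (BNeg.f P i) a = q.form (BNeg.f P i) a := by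
  induction a using BPos.induction with
  | e j => rw [hp.f_e, hq.f_e]
  | t y => rw [hp.f_t, hq.f_t]
  | tinv y => rw [hp.f_tinv, hq.f_tinv]
  | algebraMap c => rw [p.form_algebraMap, q.form_algebraMap]
  | add a b ha hb => rw [map_add, map_add, ha, hb]
  | mul a b ha hb =>
    simp [p.form_mul_right, q.form_mul_right, BNeg.comul_f, ha, hb, hp.form_t_eq hq,
      p.form_one_left, q.form_one_left]

/-- A skew-dual pairing of the Borel subalgebras is determined by its values on generators. -/
theorem IsStdPairing.unique (hp : P.IsStdPairing p) (hq : P.IsStdPairing q) : p = q := by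
  refine SkewDualPairing.ext_form (LinearMap.ext fun b => ?_)
  induction b using BNeg.induction with
  | f i => exact LinearMap.ext (hp.form_f_eq hq i)
  | t x => exact LinearMap.ext (hp.form_t_eq hq x)
  | tinv x => exact LinearMap.ext (hp.form_tinv_eq hq x)
  | algebraMap c =>
    ext a
    rw [Algebra.algebraMap_eq_smul_one, map_smul, map_smul, LinearMap.smul_apply,
      LinearMap.smul_apply, p.form_one_left, q.form_one_left]
  | add a b ha hb => rw [map_add, map_add, ha, hb]
  | mul a b ha hb =>
    ext x
    rw [p.form_mul_left, q.form_mul_left]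
    generalize comul (R := K) x = T
    induction T with
    | zero => simp
    | add T T' hT hT' => simp only [map_add, hT, hT']
    | tmul x y => simp [ha, hb]

end uniqueness

/-! ### Cross relations in the double, and the homomorphism from U. -/

section cross

variable {K : Type*} [Field K] {P : QParams K}

theorem BPos.comul₃_t (x : P.BTor) :
    comul₃ K P.BPos (BPos.t P x) = BPos.t P x ⊗ₜ (BPos.t P x ⊗ₜ BPos.t P x) := by
  simp [comul₃, BPos.comul_t]

theorem BNeg.comul₃_t (x : P.BTor) :
    comul₃ K P.BNeg (BNeg.t P x) = BNeg.t P x ⊗ₜ (BNeg.t P x ⊗ₜ BNeg.t P x) := by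
  simp [comul₃, BNeg.comul_t]

theorem BPos.comul₃_e (i : P.Idx) : comul₃ K P.BPos (BPos.e P i) =
    BPos.e P i ⊗ₜ (1 ⊗ₜ 1) + (BPos.t P (.ω i) ⊗ₜ (BPos.e P i ⊗ₜ 1) +
      BPos.t P (.ω i) ⊗ₜ (BPos.t P (.ω i) ⊗ₜ BPos.e P i)) := by
  simp [comul₃, BPos.comul_e, Algebra.TensorProduct.one_def, TensorProduct.tmul_add]

theorem BNeg.comul₃_f (i : P.Idx) : comul₃ K P.BNeg (BNeg.f P i) =
    BNeg.f P i ⊗ₜ (BNeg.t P (.ω i) ⊗ₜ BNeg.t P (.ω i)) + (1 ⊗ₜ (BNeg.f P i ⊗ₜ BNeg.t P (.ω i)) +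
      1 ⊗ₜ (1 ⊗ₜ BNeg.f P i)) := by
  simp [comul₃, BNeg.comul_f, BNeg.comul_t, TensorProduct.tmul_add]

theorem BNeg.antipode_f (i : P.Idx) :
    antipode K (BNeg.f P i) = -(BNeg.f P i * BNeg.tinv P (.ω i)) :=
  Subtype.ext (U.antipode_f P i)

theorem BNeg.antipode_t (x : P.BTor) : antipode K (BNeg.t P x) = BNeg.tinv P x :=
  Subtype.ext (U.antipode_t P _)

theorem BNeg.coe_antipode (b : P.BNeg) : ((antipode K b : P.BNeg) : P.U) = antipode K (b : P.U) :=
  rfl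

theorem BPos.coe_antipode (a : P.BPos) : ((antipode K a : P.BPos) : P.U) = antipode K (a : P.U) :=
  rfl

variable {p : SkewDualPairing K P.BPos P.BNeg}

namespace IsStdPairing

theorem form_antipode_f_t (hp : P.IsStdPairing p) (i : P.Idx) (y : P.BTor) :
    p.form (antipode K (BNeg.f P i)) (BPos.t P y) = 0 := by
  simp [BNeg.antipode_f, p.form_mul_left, BPos.comul_t, hp.f_t]

theorem form_antipode_f_e (hp : P.IsStdPairing p) (i j : P.Idx) :
    p.form (antipode K (BNeg.f P i)) (BPos.e P j) =
    -if i = j then 1 / (P.s - P.r) else 0 := by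
  simp [BNeg.antipode_f, p.form_mul_left, BPos.comul_e, hp.f_t, hp.f_e, p.form_one_right,
    BNeg.counit_tinv]

/-- For group-like elements the two pairing factors are inverse to each other. -/
theorem t_mul_t (hp : P.IsStdPairing p) (x y : P.BTor) : DrinfeldDouble.tmul p 1 (BNeg.t P x) *
    DrinfeldDouble.tmul p (BPos.t P y) 1 = DrinfeldDouble.tmul p (BPos.t P y) (BNeg.t P x) := by
  rw [DrinfeldDouble.tw_eq, SkewDualPairing.tw, BPos.comul₃_t, BNeg.comul₃_t, p.contract₃_tmul,
    BNeg.antipode_t, hp.tinv_t, hp.t_t, inv_mul_cancel₀ (P.pairVal_ne_zero x y), one_smul]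
  rfl

/-- Only the middle term ω_i ⊗ e_i ⊗ 1 of the iterated coproduct survives. It contributes ⟨x⁻¹,
ω_i⟩, which is the weight by `pairVal_ω_right`. -/
theorem t_mul_e (hp : P.IsStdPairing p) (x : P.BTor) (i : P.Idx) :
    DrinfeldDouble.tmul p 1 (BNeg.t P x) *
    DrinfeldDouble.tmul p (BPos.e P i) 1 =
      P.wt x.neg i • DrinfeldDouble.tmul p (BPos.e P i) (BNeg.t P x) := by
  rw [DrinfeldDouble.tw_eq, SkewDualPairing.tw, BPos.comul₃_e, BNeg.comul₃_t]
  simp only [map_add, p.contract₃_tmul, BNeg.antipode_t, hp.tinv_e, hp.t_e, hp.tinv_t,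
    p.form_one_right, BNeg.counit_t, mul_zero, zero_smul, zero_add, add_zero, mul_one,
    pairVal_ω_right, inv_inv, map_smul]
  rfl

theorem f_mul_t (hp : P.IsStdPairing p) (i : P.Idx) (y : P.BTor) :
    DrinfeldDouble.tmul p 1 (BNeg.f P i) *
    DrinfeldDouble.tmul p (BPos.t P y) 1 =
      P.wt y.pos i • DrinfeldDouble.tmul p (BPos.t P y) (BNeg.f P i) := by
  rw [DrinfeldDouble.tw_eq, SkewDualPairing.tw, BPos.comul₃_t, BNeg.comul₃_f]
  simp only [map_add, LinearMap.add_apply, p.contract₃_tmul, hp.form_antipode_f_t, hp.f_t, hp.t_t,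
    antipode_one, p.form_one_left, BPos.counit_t, zero_mul, mul_zero, zero_smul, zero_add, add_zero,
    one_mul, pairVal_ω_left, map_smul]
  rfl

/-- Of the nine products of terms, three survive. The two middle terms give e_j ⊗ f_i, the two last
ones give ω_j with factor ⟨f_i, e_j⟩, and the two first ones give ω'_i with factor ⟨S(f_i), e_j⟩ =
-⟨f_i, e_j⟩. -/
theorem f_mul_e (hp : P.IsStdPairing p) (i j : P.Idx) : DrinfeldDouble.tmul p 1 (BNeg.f P i) *
    DrinfeldDouble.tmul p (BPos.e P j) 1 = DrinfeldDouble.tmul p (BPos.e P j) (BNeg.f P i) +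
      ((if i = j then 1 else 0) / (P.s - P.r)) • (DrinfeldDouble.tmul p (BPos.t P (.ω j)) 1 -
        DrinfeldDouble.tmul p 1 (BNeg.t P (.ω i))) := by
  rw [DrinfeldDouble.tw_eq, SkewDualPairing.tw, BPos.comul₃_e, BNeg.comul₃_f]
  simp only [map_add, LinearMap.add_apply, p.contract₃_tmul, hp.form_antipode_f_t,
    hp.form_antipode_f_e, hp.f_e, hp.t_e, antipode_one, p.form_one_left, p.form_one_right,
    BPos.counit_t, BPos.counit_e, BNeg.counit_t, BNeg.counit_f, mul_zero, zero_smul,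
    zero_add, add_zero, one_mul, mul_one, one_smul, map_smul, DrinfeldDouble.of_tmul]
  split_ifs <;> module

/-- The generators of the double satisfy the relations of `U`. -/
theorem isModel_double (hp : P.IsStdPairing p) : P.IsModel (A := DrinfeldDouble p)
    (fun i => DrinfeldDouble.inl p (BPos.e P i)) (fun i => DrinfeldDouble.inr p (BNeg.f P i))
    (Tor.elim (fun x => DrinfeldDouble.inl p (BPos.t P x))
      fun x => DrinfeldDouble.inr p (BNeg.t P x))
    (Tor.elim (fun x => DrinfeldDouble.inl p (BPos.tinv P x))
      fun x => DrinfeldDouble.inr p (BNeg.tinv P x)) := by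
  have hm : P.IsPosModel (BPos.e P) (BPos.t P) (BPos.tinv P) :=
    .of_map P.BPos.val Subtype.val_injective (U.isModel P).toIsPosModel
  refine .of_borel (hm.map _) ((BNeg.isNegModel P).map _) (fun x y => ?_) (fun x i => ?_)
    (fun x i => ?_) (fun i j => ?_)
  · rw [DrinfeldDouble.inl_apply, DrinfeldDouble.inr_apply, hp.t_mul_t, ← DrinfeldDouble.tmul_eq]
  · rw [DrinfeldDouble.inl_apply, DrinfeldDouble.inr_apply, hp.f_mul_t, ← DrinfeldDouble.tmul_eq,
      inv_smul_smul₀ (P.wt_ne_zero _ _)]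
  · rw [DrinfeldDouble.inl_apply, DrinfeldDouble.inr_apply, hp.t_mul_e, ← DrinfeldDouble.tmul_eq]
  · rw [DrinfeldDouble.inl_apply, DrinfeldDouble.inr_apply, hp.f_mul_e, ← DrinfeldDouble.tmul_eq,
      DrinfeldDouble.inl_apply, DrinfeldDouble.inr_apply]
    by_cases hij : i = j
    · subst hij
      -- The product formula yields f_i e_i - e_i f_i with denominator s - r; reversing both signs
      -- gives the relation of U.
      rw [← neg_sub P.r]
      simp only [div_neg]
      module
    · simp [hij, Ne.symm hij]

/-- The homomorphism from `U` to the double. -/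
noncomputable def toDouble (hp : P.IsStdPairing p) : P.U →ₐ[K] DrinfeldDouble p :=
  U.lift hp.isModel_double

theorem toDouble_t_pos (hp : P.IsStdPairing p) (x : P.BTor) :
    hp.toDouble (U.t P x.pos) = DrinfeldDouble.inl p (BPos.t P x) :=
  (U.lift_t _ _).trans (Tor.elim_pos _ _ _)

theorem toDouble_tinv_pos (hp : P.IsStdPairing p) (x : P.BTor) :
    hp.toDouble (U.tinv P x.pos) = DrinfeldDouble.inl p (BPos.tinv P x) :=
  (U.lift_tinv _ _).trans (Tor.elim_pos _ _ _)

theorem toDouble_t_neg (hp : P.IsStdPairing p) (x : P.BTor) :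
    hp.toDouble (U.t P x.neg) = DrinfeldDouble.inr p (BNeg.t P x) :=
  (U.lift_t _ _).trans (Tor.elim_neg _ _ _)

theorem toDouble_tinv_neg (hp : P.IsStdPairing p) (x : P.BTor) :
    hp.toDouble (U.tinv P x.neg) = DrinfeldDouble.inr p (BNeg.tinv P x) :=
  (U.lift_tinv _ _).trans (Tor.elim_neg _ _ _)

theorem toDouble_pos (hp : P.IsStdPairing p) (a : P.BPos) :
    hp.toDouble a = DrinfeldDouble.inl p a := by
  induction a using BPos.induction with
  | e i => exact U.lift_e _ i
  | t x => exact hp.toDouble_t_pos x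
  | tinv x => exact hp.toDouble_tinv_pos x
  | algebraMap c => exact (AlgHom.commutes _ _).trans (AlgHom.commutes _ _).symm
  | add a b ha hb => rw [map_add, ← ha, ← hb, ← map_add]; rfl
  | mul a b ha hb => rw [map_mul, ← ha, ← hb, ← map_mul]; rfl

theorem toDouble_neg (hp : P.IsStdPairing p) (b : P.BNeg) :
    hp.toDouble b = DrinfeldDouble.inr p b := by
  induction b using BNeg.induction with
  | f i => exact U.lift_f _ i
  | t x => exact hp.toDouble_t_neg x
  | tinv x => exact hp.toDouble_tinv_neg x
  | algebraMap c => exact (AlgHom.commutes _ _).trans (AlgHom.commutes _ _).symm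
  | add a b ha hb => rw [map_add, ← ha, ← hb, ← map_add]; rfl
  | mul a b ha hb => rw [map_mul, ← ha, ← hb, ← map_mul]; rfl

/-- Thus `toDouble` undoes the multiplication map a ⊗ b ↦ ab, which makes that map injective without
a basis of U. -/
theorem toDouble_mul (hp : P.IsStdPairing p) (a : P.BPos) (b : P.BNeg) :
    hp.toDouble (a * b) = DrinfeldDouble.tmul p a b := by
  rw [map_mul, toDouble_pos, toDouble_neg, DrinfeldDouble.tmul_eq]
  rfl

end IsStdPairing

end cross

/-! ### Spanning half of the triangular decomposition. -/

section triangular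

variable {K : Type u} [Field K] (P : QParams K)

/-- The linear span of the products of elements of the positive and of the negative Borel
subalgebra. -/
noncomputable def triangularSpan : Submodule K P.U :=
  LinearMap.range (TensorProduct.lift
    ((LinearMap.mul K P.U).compl₁₂ P.BPos.val.toLinearMap P.BNeg.val.toLinearMap))

variable {P}

theorem mul_mem_triangularSpan (a : P.BPos) (b : P.BNeg) : (a * b : P.U) ∈ P.triangularSpan :=
  ⟨a ⊗ₜ b, rfl⟩

theorem triangularSpan_induction {N : Submodule K P.U}
    (h : ∀ (a : P.BPos) (b : P.BNeg), (a * b : P.U) ∈ N) : P.triangularSpan ≤ N := by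
  rintro _ ⟨T, rfl⟩
  induction T with
  | zero => rw [map_zero]; exact zero_mem _
  | add T T' hT hT' => rw [map_add]; exact add_mem hT hT'
  | tmul a b => exact h a b

theorem pos_mul_mem_triangularSpan (a : P.BPos) {x : P.U} (hx : x ∈ P.triangularSpan) :
    a * x ∈ P.triangularSpan := by
  refine triangularSpan_induction (N := P.triangularSpan.comap (LinearMap.mulLeft K (a : P.U)))
    (fun c b => ?_) hx
  change (a * (c * b) : P.U) ∈ P.triangularSpan
  rw [← mul_assoc]
  exact mul_mem_triangularSpan (a * c) b

theorem mul_neg_mem_triangularSpan (b : P.BNeg) {x : P.U} (hx : x ∈ P.triangularSpan) :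
    x * b ∈ P.triangularSpan := by
  refine triangularSpan_induction (N := P.triangularSpan.comap (LinearMap.mulRight K (b : P.U)))
    (fun a c => ?_) hx
  change (a * c * b : P.U) ∈ P.triangularSpan
  rw [mul_assoc]
  exact mul_mem_triangularSpan a (c * b)

theorem pos_mem_triangularSpan (a : P.BPos) : (a : P.U) ∈ P.triangularSpan := by
  simpa using mul_mem_triangularSpan a 1

/-- The span is closed under left multiplication by `y` as soon as `y` can be moved past the
generators of the positive Borel subalgebra. -/
theorem mul_mem_triangularSpan_of_gens {y : P.U} (hy : y ∈ P.BNeg)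
    (he : ∀ (i : P.Idx) (a : P.BPos), y * a ∈ P.triangularSpan →
      y * (U.e P i * a) ∈ P.triangularSpan)
    (ht : ∀ (x : P.BTor) (a : P.BPos), y * a ∈ P.triangularSpan →
      y * (U.t P x.pos * a) ∈ P.triangularSpan)
    (hti : ∀ (x : P.BTor) (a : P.BPos), y * a ∈ P.triangularSpan →
      y * (U.tinv P x.pos * a) ∈ P.triangularSpan) {x : P.U} (hx : x ∈ P.triangularSpan) :
    y * x ∈ P.triangularSpan := by
  -- The positive elements a with y a in the span form a subspace that contains 1, because y is
  -- negative, and that is stable under the positive generators. The remaining negative factor is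
  -- then multiplied on from the right, which keeps the span.
  have key : P.triangularSpan.comap (LinearMap.mulLeft K y ∘ₗ P.BPos.val.toLinearMap) = ⊤ := by
    refine Submodule.eq_top_of_mul_mem (BPos.isPosUniv P).adjoin_eq_top _ ?_ ?_
    · change y * 1 ∈ P.triangularSpan
      rw [mul_one]
      simpa using mul_mem_triangularSpan (P := P) 1 ⟨y, hy⟩
    · rintro _ ((⟨i, rfl⟩ | ⟨z, rfl⟩) | ⟨z, rfl⟩) a ha
      exacts [he i a ha, ht z a ha, hti z a ha]
  refine triangularSpan_induction (N := P.triangularSpan.comap (LinearMap.mulLeft K y))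
    (fun a b => ?_) hx
  have ha : a ∈ P.triangularSpan.comap (LinearMap.mulLeft K y ∘ₗ P.BPos.val.toLinearMap) :=
    key ▸ Submodule.mem_top
  change (y * (a * b) : P.U) ∈ P.triangularSpan
  rw [← mul_assoc]
  exact mul_neg_mem_triangularSpan b ha

theorem mul_mul_mem_triangularSpan {y g : P.U} {a : P.BPos} {c : K} (hg : g ∈ P.BPos)
    (h : y * g = c • (g * y)) (ha : y * a ∈ P.triangularSpan) :
    y * (g * a) ∈ P.triangularSpan := by
  rw [← mul_assoc, h, smul_mul_assoc, mul_assoc]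
  exact Submodule.smul_mem _ _ (pos_mul_mem_triangularSpan ⟨g, hg⟩ ha)

theorem t_mul_mem_triangularSpan (x : P.BTor) {z : P.U} (hz : z ∈ P.triangularSpan) :
    U.t P x.neg * z ∈ P.triangularSpan := by
  have h := U.isModel P
  refine mul_mem_triangularSpan_of_gens (y := U.t P x.neg) (BNeg.t P x).2
    (fun i a => ?_) (fun y a => ?_)
    (fun y a => ?_) hz
  · exact mul_mul_mem_triangularSpan (BPos.e P i).2 (h.te _ _)
  · exact mul_mul_mem_triangularSpan (c := 1) (BPos.t P y).2 (by rw [one_smul, h.t_comm])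
  · refine mul_mul_mem_triangularSpan (c := 1⁻¹) (BPos.tinv P y).2 ?_
    have := inv_mul_semiconj (h.t_tinv y.pos) (h.tinv_t y.pos) one_ne_zero
      (by rw [one_smul, h.t_comm] : U.t P y.pos * U.t P x.neg = (1 : K) • _)
    rw [this, inv_one, one_smul, one_smul]

theorem tinv_mul_mem_triangularSpan (x : P.BTor) {z : P.U} (hz : z ∈ P.triangularSpan) :
    U.tinv P x.neg * z ∈ P.triangularSpan := by
  have h := U.isModel P
  have h' {a : P.U} {c : K} (hc : c ≠ 0) := inv_mul_semiconj (a := a) (c := c) (h.t_tinv x.neg)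
    (h.tinv_t x.neg) hc
  refine mul_mem_triangularSpan_of_gens (y := U.tinv P x.neg) (BNeg.tinv P x).2
    (fun i a => ?_) (fun y a => ?_)
    (fun y a => ?_) hz
  · exact mul_mul_mem_triangularSpan (BPos.e P i).2 (h' (P.wt_ne_zero _ _) (h.te _ _))
  · exact mul_mul_mem_triangularSpan (BPos.t P y).2
      (h' one_ne_zero (by rw [one_smul, h.t_comm]))
  · exact mul_mul_mem_triangularSpan (c := 1) (BPos.tinv P y).2 (by rw [one_smul, h.tinv_comm])

/-- Moving f_i past e_j leaves multiples of ω_j a and ω'_j a. The first is positive, and the second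
lies in the span by `t_mul_mem_triangularSpan`. -/
theorem f_mul_mem_triangularSpan (i : P.Idx) {z : P.U} (hz : z ∈ P.triangularSpan) :
    U.f P i * z ∈ P.triangularSpan := by
  have h := U.isModel P
  refine mul_mem_triangularSpan_of_gens (y := U.f P i) (BNeg.f P i).2
    (fun j a ha => ?_) (fun y a => ?_)
    (fun y a => ?_) hz
  · have hef := h.e_f j i
    rw [sub_eq_iff_eq_add, ← sub_eq_iff_eq_add'] at hef
    rw [← mul_assoc, ← hef, sub_mul, smul_mul_assoc, sub_mul, mul_assoc]
    refine sub_mem (pos_mul_mem_triangularSpan (BPos.e P j) ha)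
      (Submodule.smul_mem _ _ (sub_mem ?_ ?_))
    · exact pos_mem_triangularSpan (BPos.t P (.ω j) * a)
    · exact t_mul_mem_triangularSpan (.ω j) (pos_mem_triangularSpan a)
  · refine mul_mul_mem_triangularSpan (c := P.wt y.pos i) (BPos.t P y).2 ?_
    rw [h.tf, smul_inv_smul₀ (P.wt_ne_zero _ _)]
  · exact mul_mul_mem_triangularSpan (BPos.tinv P y).2 (h.f_tinv _ _)

/-- `U` is spanned by products of elements of the positive and of the negative Borel subalgebra. -/
theorem triangularSpan_eq_top : P.triangularSpan = ⊤ := by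
  refine Submodule.eq_top_of_mul_mem (U.adjoin_gens P) _ (pos_mem_triangularSpan 1) ?_
  rintro _ (((⟨i, rfl⟩ | ⟨i, rfl⟩) | ⟨x, rfl⟩) | ⟨x, rfl⟩) a ha
  · exact pos_mul_mem_triangularSpan (BPos.e P i) ha
  · exact f_mul_mem_triangularSpan i ha
  · revert x
    exact Tor.forall.2 ⟨fun x => pos_mul_mem_triangularSpan (BPos.t P x) ha,
      fun x => t_mul_mem_triangularSpan x ha⟩
  · revert x
    exact Tor.forall.2 ⟨fun x => pos_mul_mem_triangularSpan (BPos.tinv P x) ha,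
      fun x => tinv_mul_mem_triangularSpan x ha⟩

end triangular

/-! ### The isomorphism of Hopf algebras. -/

namespace IsStdPairing

variable {K : Type u} [Field K] {P : QParams K} {p : SkewDualPairing K P.BPos P.BNeg}

theorem bijective_toDouble (hp : P.IsStdPairing p) : Function.Bijective hp.toDouble := by
  -- Multiplication a ⊗ b ↦ ab is a right inverse of `toDouble`, which is therefore surjective. By
  -- the triangular decomposition m is surjective too, and this makes `toDouble` injective.
  let m : DrinfeldDouble p →ₗ[K] P.U := TensorProduct.lift
    ((LinearMap.mul K P.U).compl₁₂ P.BPos.val.toLinearMap P.BNeg.val.toLinearMap) ∘ₗ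
      (DrinfeldDouble.of p).symm.toLinearMap
  have hm (x : DrinfeldDouble p) : hp.toDouble (m x) = x :=
    DrinfeldDouble.ind (P := fun x => hp.toDouble (m x) = x) (by simp only [map_zero])
      (fun a b => hp.toDouble_mul a b) (fun x y hx hy => by rw [map_add, map_add, hx, hy]) x
  refine ⟨fun x y hxy => ?_, fun x => ⟨_, hm x⟩⟩
  have hs (x : P.U) : ∃ z, m z = x := by
    obtain ⟨T, hT⟩ : x ∈ P.triangularSpan := by
      rw [triangularSpan_eq_top]; exact Submodule.mem_top
    exact ⟨DrinfeldDouble.of p T, hT⟩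
  obtain ⟨z, rfl⟩ := hs x
  obtain ⟨w, rfl⟩ := hs y
  rw [hm, hm] at hxy
  rw [hxy]

/-- On the positive Borel subalgebra `toDouble` is the embedding a ↦ a ⊗ 1, which respects
coproducts. With the negative counterpart this is enough, since the two subalgebras generate U. -/
theorem map_toDouble_comul_pos (hp : P.IsStdPairing p) (a : P.BPos) :
    Algebra.TensorProduct.map hp.toDouble hp.toDouble (comul (R := K) (a : P.U)) =
      comul (R := K) (hp.toDouble a) := by
  have h : hp.toDouble.comp P.BPos.val = DrinfeldDouble.inl p := AlgHom.ext hp.toDouble_pos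
  rw [toDouble_pos, DrinfeldDouble.inl_apply, DrinfeldDouble.comul_inl, ← h,
    Algebra.TensorProduct.map_comp]
  exact congrArg _ ((BPos.isHopfSubalgebra P).map_comulHom a).symm

theorem map_toDouble_comul_neg (hp : P.IsStdPairing p) (b : P.BNeg) :
    Algebra.TensorProduct.map hp.toDouble hp.toDouble (comul (R := K) (b : P.U)) =
      comul (R := K) (hp.toDouble b) := by
  have h : hp.toDouble.comp P.BNeg.val = DrinfeldDouble.inr p := AlgHom.ext hp.toDouble_neg
  rw [toDouble_neg, DrinfeldDouble.inr_apply, DrinfeldDouble.comul_inr, ← h,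
    Algebra.TensorProduct.map_comp]
  exact congrArg _ ((BNeg.isHopfSubalgebra P).map_comulHom b).symm

theorem counit_toDouble_pos (hp : P.IsStdPairing p) (a : P.BPos) :
    counit (R := K) (hp.toDouble a) = counit (R := K) (a : P.U) := by
  rw [toDouble_pos, DrinfeldDouble.inl_apply, DrinfeldDouble.counit_tmul, Bialgebra.counit_one,
    mul_one]
  rfl

theorem counit_toDouble_neg (hp : P.IsStdPairing p) (b : P.BNeg) :
    counit (R := K) (hp.toDouble b) = counit (R := K) (b : P.U) := by
  rw [toDouble_neg, DrinfeldDouble.inr_apply, DrinfeldDouble.counit_tmul, Bialgebra.counit_one,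
    one_mul]
  rfl

/-- Homomorphisms from `U` that agree on the Borel subalgebras are equal. -/
theorem _root_.QParams.algHom_ext_borel {A : Type*} [Ring A] [Algebra K A] {φ ψ : P.U →ₐ[K] A}
    (hpos : ∀ a : P.BPos, φ a = ψ a) (hneg : ∀ b : P.BNeg, φ b = ψ b) : φ = ψ :=
  U.algHom_ext P (fun i => hpos (BPos.e P i)) (fun i => hneg (BNeg.f P i))
    (Tor.forall.2 ⟨fun x => hpos (BPos.t P x), fun x => hneg (BNeg.t P x)⟩)
    (Tor.forall.2 ⟨fun x => hpos (BPos.tinv P x), fun x => hneg (BNeg.tinv P x)⟩)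

/-- `U` is isomorphic to the double as a bialgebra. -/
noncomputable def doubleEquiv (hp : P.IsStdPairing p) : P.U ≃ₐc[K] DrinfeldDouble p :=
  BialgEquiv.ofAlgEquiv (AlgEquiv.ofBijective hp.toDouble hp.bijective_toDouble)
    (algHom_ext_borel hp.counit_toDouble_pos hp.counit_toDouble_neg)
    (algHom_ext_borel hp.map_toDouble_comul_pos hp.map_toDouble_comul_neg)

theorem doubleEquiv_symm_tmul (hp : P.IsStdPairing p) (a : P.BPos) (b : P.BNeg) :
    hp.doubleEquiv.symm (DrinfeldDouble.tmul p a b) = a * b :=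
  hp.doubleEquiv.symm_apply_eq.2 (hp.toDouble_mul a b).symm

theorem doubleEquiv_symm_inl (hp : P.IsStdPairing p) (a : P.BPos) :
    hp.doubleEquiv.symm (DrinfeldDouble.tmul p a 1) = a := by
  rw [doubleEquiv_symm_tmul, OneMemClass.coe_one, mul_one]

theorem doubleEquiv_symm_inr (hp : P.IsStdPairing p) (b : P.BNeg) :
    hp.doubleEquiv.symm (DrinfeldDouble.tmul p 1 b) = b := by
  rw [doubleEquiv_symm_tmul, OneMemClass.coe_one, one_mul]

/-- The antipode of a ⊗ b in the double is (1 ⊗ S(b))(S(a) ⊗ 1), which goes to S(b)S(a) = S(ab) in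
U. -/
theorem doubleEquiv_symm_antipode (hp : P.IsStdPairing p) (x : DrinfeldDouble p) :
    hp.doubleEquiv.symm (antipode K x) = antipode K (hp.doubleEquiv.symm x) := by
  refine DrinfeldDouble.ind (P := fun x => hp.doubleEquiv.symm (antipode K x) =
    antipode K (hp.doubleEquiv.symm x)) (by simp only [map_zero]) (fun a b => ?_)
    (fun x y hx hy => by simp only [map_add, hx, hy]) x
  rw [doubleEquiv_symm_tmul, antipode_mul_antidistrib, ← BPos.coe_antipode, ← BNeg.coe_antipode,
    ← hp.doubleEquiv_symm_inl, ← hp.doubleEquiv_symm_inr, ← map_mul]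
  rfl

end IsStdPairing

end QParams

theorem theorem2p5 {K : Type*} [Field K] (P : QParams K) :
    (∃! p : SkewDualPairing K P.BPos P.BNeg, P.IsStdPairing p) ∧
      ∀ p : SkewDualPairing K P.BPos P.BNeg, P.IsStdPairing p →
        ∃ φ : DrinfeldDouble p ≃ₐc[K] P.U,
          (∀ x, φ (HopfAlgebra.antipode K x) = HopfAlgebra.antipode K (φ x)) ∧
          (∀ i, φ (DrinfeldDouble.tmul p (QParams.BPos.e P i) 1) = QParams.U.e P i) ∧
          (∀ i, φ (DrinfeldDouble.tmul p 1 (QParams.BNeg.f P i)) = QParams.U.f P i) ∧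
          (∀ x, φ (DrinfeldDouble.tmul p (QParams.BPos.t P x) 1) = QParams.U.t P x.pos) ∧
          (∀ x, φ (DrinfeldDouble.tmul p (QParams.BPos.tinv P x) 1) = QParams.U.tinv P x.pos) ∧
          (∀ x, φ (DrinfeldDouble.tmul p 1 (QParams.BNeg.t P x)) = QParams.U.t P x.neg) ∧
          (∀ x, φ (DrinfeldDouble.tmul p 1 (QParams.BNeg.tinv P x)) = QParams.U.tinv P x.neg) :=
  ⟨⟨P.stdPairing, P.isStdPairing_stdPairing, fun _ hq => hq.unique P.isStdPairing_stdPairing⟩,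
    -- The relations of U provide a map out of U, so φ arises as the inverse of that map; on a ⊗ b
    -- it is the product ab.
    fun _ hp => ⟨hp.doubleEquiv.symm, hp.doubleEquiv_symm_antipode,
      fun i => hp.doubleEquiv_symm_inl (QParams.BPos.e P i),
      fun i => hp.doubleEquiv_symm_inr (QParams.BNeg.f P i),
      fun x => hp.doubleEquiv_symm_inl (QParams.BPos.t P x),
      fun x => hp.doubleEquiv_symm_inl (QParams.BPos.tinv P x),
      fun x => hp.doubleEquiv_symm_inr (QParams.BNeg.t P x),
      fun x => hp.doubleEquiv_symm_inr (QParams.BNeg.tinv P x)⟩⟩
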